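/- **Model.** A system has $L\ge 1$ threads. Requests $1,2,\dots,N$ arrive at deterministic times $0=a_1\le a_2\le\cdots\le a_N$. The file of request $i$ is stored with an $(n_i,k_i)$ MDS code ($1\le k_i\le n_i$) as $n_i$ coded chunks; request $i$ is completed as soon as any $k_i$ of them have been downloaded, and then all threads still serving it are released at once. A chunk is available if its request has arrived and is unfinished and the chunk has been neither downloaded nor put under service; each thread serves one chunk at a time. The downloading times of all chunks are i.i.d. exponential with mean $1/\mu$, $\mu>0$. Preemption is not allowed: once a thread has started a chunk, it serves it until the chunk is downloaded or its request is completed. Threads may be left idle. A (possibly randomized) policy is online if its decisions up to time $t$ depend only on its own randomness, on the requests that have arrived by time $t$, and on what has been observed of the downloads by time $t$. With $c_{i,\pi}$ the completion time of request $i$ under $\pi$, put $$\overline D_\pi=\frac1N\sum_{i=1}^N\bigl(\mathbb E\{c_{i,\pi}\}-a_i\bigr),$$ and let $\overline D_{\mathrm{opt}}$ be the infimum of $\overline D_\pi$ over all non-preemptive online policies. Let $d_{\min}=\min_i (n_i-k_i+1)$. **Non-preemptive SEDPT-R.** At any time, idle threads are assigned one after the other, each to an available chunk of a request $j$ that minimizes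 $\alpha_j-\delta_j$ among the unfinished requests that still have an available chunk, where $\alpha_j$ is the number of chunks still to be downloaded for completing request $j$ and $\delta_j$ is the number of threads currently assigned to it. This goes on until all $L$ threads are occupied or no chunk is available. Ties, and the choice among the available chunks of a request, are arbitrary. **Theorem.** Suppose that $d_{\min}\ge L$. Then, for any request parameters $N\ge1$ and $(a_i,k_i,n_i)_{i=1}^N$, the average flow time of non-preemptive SEDPT-R is finite and $$\overline D_{\mathrm{opt}}\le \overline D_{\text{SEDPT-R}}\le \overline D_{\mathrm{opt}}+\frac1\mu .$$ The same inequalities hold as $N\to\infty$: for an infinite sequence $(a_i,k_i,n_i)_{i\ge1}$ with $n_i-k_i+1\ge L$ for all $i$, they hold (in $[0,\infty]$) when $\overline D_\pi$ is replaced by $\limsup_{N\to\infty}\overline D_\pi(N)$, where $\overline D_\pi(N)$ is the average flow time of the system with the first $N$ requests only, and $\overline D_{\mathrm{opt}}$ by the infimum of this limsup over all non-preemptive online policies. -/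

import Mathlib

open MeasureTheory ProbabilityTheory Filter
open scoped ENNReal NNReal

noncomputable section

/-- A sequence of read requests, numbered from `0`: arrival times `a i` and parameters `(n i, k i)`
of the MDS code of the file of request `i`. A finite system consists of the first `N` requests of
such a sequence; what comes after them is then irrelevant. -/
structure RequestSeq where
  a : ℕ → ℝ≥0
  k : ℕ → ℕ
  n : ℕ → ℕ
  first : a 0 = 0
  mono : Monotone a
  k_pos : ∀ i, 1 ≤ k i
  k_le_n : ∀ i, k i ≤ n i

/-- The Hamming distance of the code of file `i`. -/
def RequestSeq.d (R : RequestSeq) (i : ℕ) : ℕ := R.n i - R.k i + 1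

/-- Chunk `(i, c)` is coded chunk `c` of file `i`; it exists when `i < N` and `c < n i`. -/
abbrev Chunk := ℕ × ℕ

/-- A non-preemptive schedule: the time at which some thread starts downloading a chunk, with `∞`
for never. Once started, a chunk occupies its thread until it is downloaded or until its request is
completed. -/
abbrev Schedule := Chunk → ℝ≥0∞

section Dynamics

variable (R : RequestSeq) (N : ℕ) (x : Chunk → ℝ) (s : Schedule)

/-- The time at which chunk `c` is downloaded, when its downloading time is `x c` (and its request
has not been completed before). -/
def finish (c : Chunk) : ℝ≥0∞ := s c + ENNReal.ofReal (x c)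

/-- The number of chunks of request `i` that are downloaded by time `t`. -/
def downloaded (i : ℕ) (t : ℝ≥0∞) : ℕ :=
  ((Finset.range (R.n i)).filter fun c => finish x s (i, c) ≤ t).card

/-- The completion time of request `i`: the first time at which `k i` of its chunks are
downloaded. -/
def completion (i : ℕ) : ℝ≥0∞ := sInf {t : ℝ≥0∞ | R.k i ≤ downloaded R x s i t}

/-- Request `i` has arrived by time `t` and is not completed at time `t`. -/
def Unfinished (t : ℝ≥0) (i : ℕ) : Prop := i < N ∧ R.a i ≤ t ∧ (t : ℝ≥0∞) < completion R x s i

/-- The number of chunks that remain to be downloaded for completing request `i` at time `t`. -/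
def remaining (t : ℝ≥0) (i : ℕ) : ℕ := R.k i - downloaded R x s i t

/-- The number of threads serving request `i` just after time `t`: each chunk under service occupies
one thread, and all threads of a request are released when the request is completed. -/
def inService (t : ℝ≥0) (i : ℕ) : ℕ :=
  ((Finset.range (R.n i)).filter fun c =>
    s (i, c) ≤ t ∧ (t : ℝ≥0∞) < finish x s (i, c) ∧ (t : ℝ≥0∞) < completion R x s i).card

/-- The number of threads serving request `i` at time `t`, after the downloads, completions and
terminations of time `t`, but before idle threads are assigned at time `t`. -/
def inServiceBefore (t : ℝ≥0) (i : ℕ) : ℕ :=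
  ((Finset.range (R.n i)).filter fun c =>
    s (i, c) < t ∧ (t : ℝ≥0∞) < finish x s (i, c) ∧ (t : ℝ≥0∞) < completion R x s i).card

/-- The number of chunks of request `i` that have been started before time `t`. -/
def startedBefore (t : ℝ≥0) (i : ℕ) : ℕ :=
  ((Finset.range (R.n i)).filter fun c => s (i, c) < t).card

/-- The number of chunks of request `i` that are started at time `t`. -/
def startedAt (t : ℝ≥0) (i : ℕ) : ℕ :=
  ((Finset.range (R.n i)).filter fun c => s (i, c) = t).card

/-- The schedule `s` can be carried out by `L` threads serving the first `N` requests: only existing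
chunks are started, after the arrival and before the completion of their request, and at no time
are more than `L` threads occupied. -/
structure Feasible (L : ℕ) : Prop where
  exists_of_start : ∀ i c, s (i, c) ≠ ∞ → i < N ∧ c < R.n i
  arrival_le : ∀ i c, (R.a i : ℝ≥0∞) ≤ s (i, c)
  lt_completion : ∀ i c, s (i, c) ≠ ∞ → s (i, c) < completion R x s i
  capacity : ∀ t : ℝ≥0, ∑ i ∈ Finset.range N, inService R x s t i ≤ L

/-- Under the schedule `s`, the downloading times `x'` are compatible with everything that has been
observed by time `t` when the downloading times are `x`: the downloading times of the chunks that
have been downloaded, and, for any other chunk that has been started, how long it has been under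
service without being downloaded. -/
def SameObservations (x' : Chunk → ℝ) (t : ℝ≥0) : Prop :=
  ∀ i c, s (i, c) ≤ t →
    (finish x s (i, c) ≤ min (t : ℝ≥0∞) (completion R x s i) → x' (i, c) = x (i, c)) ∧
    (min (t : ℝ≥0∞) (completion R x s i) < finish x s (i, c) →
      min (t : ℝ≥0∞) (completion R x s i) < finish x' s (i, c))

/-- The assignment of idle threads at time `t` under non-preemptive SEDPT-R. The list `l` has the
requests to which the idle threads are assigned one after the other; each time the request has the
smallest number of remaining chunks minus number of assigned threads, among the unfinished requests
that have an available chunk not under service. This stops only when all `L` threads are occupied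
or all available chunks of the unfinished requests are under service. -/
def SEDPTAssignment (L : ℕ) (t : ℝ≥0) : Prop :=
  (∃ l : List ℕ, (∀ i, startedAt R s t i = l.count i) ∧
    ∀ p i q, l = p ++ i :: q → ∀ j, Unfinished R N x s t j →
      startedBefore R s t j + p.count j < R.n j →
      (remaining R x s t i : ℤ) - (inServiceBefore R x s t i + p.count i : ℕ) ≤
        (remaining R x s t j : ℤ) - (inServiceBefore R x s t j + p.count j : ℕ)) ∧
  (∑ i ∈ Finset.range N, inService R x s t i = L ∨
    ∀ j, Unfinished R N x s t j → ∀ c < R.n j, s (j, c) ≤ t)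

end Dynamics

/-- The same requests have arrived by time `t`, with the same parameters. -/
def SameArrivals (R : RequestSeq) (N : ℕ) (R' : RequestSeq) (N' : ℕ) (t : ℝ≥0) : Prop :=
  ∀ i, ((i < N ∧ R.a i ≤ t) ↔ (i < N' ∧ R'.a i ≤ t)) ∧
    (i < N ∧ R.a i ≤ t → R.a i = R'.a i ∧ R.k i = R'.k i ∧ R.n i = R'.n i)

/-- A non-preemptive online policy for `L` threads, with private randomness `u : 𝒰` (a one-point
`𝒰` gives the deterministic policies). It may leave threads idle. It is online: what it does up to
time `t` depends only on `u`, on the requests that have arrived by time `t`, and on what has been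
observed of the downloads by time `t`. -/
structure Policy (L : ℕ) (𝒰 : Type*) [MeasurableSpace 𝒰] where
  start : RequestSeq → ℕ → 𝒰 → (Chunk → ℝ) → Schedule
  measurable_start : ∀ R N c, Measurable fun p : 𝒰 × (Chunk → ℝ) => start R N p.1 p.2 c
  feasible : ∀ R N u x, (∀ c, 0 < x c) → Feasible R N x (start R N u x) L
  online : ∀ R N R' N' u x x' (t : ℝ≥0), (∀ c, 0 < x c) → (∀ c, 0 < x' c) →
    SameArrivals R N R' N' t → SameObservations R x (start R N u x) x' t →
    ∀ c, start R N u x c ≤ t ∨ start R' N' u x' c ≤ t → start R N u x c = start R' N' u x' c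

/-- The policy is non-preemptive SEDPT-R (with any rule for breaking ties and for choosing among the
available chunks of a request). -/
def Policy.IsSEDPTR {L : ℕ} {𝒰 : Type*} [MeasurableSpace 𝒰] (π : Policy L 𝒰) : Prop :=
  ∀ R N u x, (∀ c, 0 < x c) → ∀ t : ℝ≥0, SEDPTAssignment R N x (π.start R N u x) L t

section FlowTime

variable {L : ℕ} {𝒰 Ω : Type*} [MeasurableSpace 𝒰] [MeasurableSpace Ω]
  (P : Measure Ω) (U : Ω → 𝒰) (X : Chunk → Ω → ℝ)

/-- The average flow time of the first `N` requests of `R` (with no further requests arriving) under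
the policy `π`, when the downloading times are `X` and the private randomness is `U`. -/
def avgFlowTime (π : Policy L 𝒰) (R : RequestSeq) (N : ℕ) : ℝ≥0∞ :=
  (∑ i ∈ Finset.range N,
    ((∫⁻ ω, completion R (fun c => X c ω) (π.start R N (U ω) fun c => X c ω) i ∂P) - R.a i)) / N

/-- The optimal average flow time among all non-preemptive online policies. -/
def optFlowTime (L : ℕ) (R : RequestSeq) (N : ℕ) : ℝ≥0∞ :=
  ⨅ π : Policy L 𝒰, avgFlowTime P U X π R N

/-- The average flow time when the number of requests tends to infinity. -/
def limAvgFlowTime (π : Policy L 𝒰) (R : RequestSeq) : ℝ≥0∞ :=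
  limsup (fun N => avgFlowTime P U X π R N) atTop

/-- The optimal average flow time among all non-preemptive online policies, when the number of
requests tends to infinity. -/
def optLimFlowTime (L : ℕ) (R : RequestSeq) : ℝ≥0∞ :=
  ⨅ π : Policy L 𝒰, limAvgFlowTime P U X π R

end FlowTime

end

/-! Describe the requests by the multiset of their remaining numbers of chunks: a download lowers
one entry by one, and a completed request is an entry zero. Call `r` ahead of `r'` (`Dom`) if the
sum of (θ - y)⁺ over the entries y is at least as large for `r`, at every threshold θ. Lowering the
smallest positive entry of the state that is ahead keeps it ahead of any decrement of the other
(`Dom.step_decrement`), and the state that is ahead has at most as many positive entries. Hence the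
ideal system that makes such steps at the full rate L μ is a lower bound for every online policy:
the expectation of a monotone function after a Poisson number of ideal steps can only grow on
average along the policy (`lintegral_load_ge`), since L threads never download at a rate above L μ.

Without preemption SEDPT-R cannot follow the ideal system, but its virtual state `virt` does. There
every thread is credited in advance with one useful download: α is replaced by (α - δ)⁺, and for
each thread whose next download is not needed by its request, or which is idle, a shortest-first
step is made. Assigning a thread to the request with the least α - δ only turns a step of the second
kind into one of the first kind, so `virt` does not change (`virt_assign`); a download is exactly
one step of `virt` (`virt_download`). The assumption on the codes gives every unfinished request an
available chunk whenever a thread is idle, so all L threads are busy and the steps come at rate L μ.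
An arrival leaves `virt` ahead of the old state with the new request added (`virt_arrival`). By
induction over the arrivals, the expected number of virtually unfinished requests is at most the
expected number of unfinished requests under any other policy (`lintegral_virt_le_load`).

What remains is the number of requests that are unfinished but virtually finished. The `potential`
falls by at least this number at each download and rises by at most L at each arrival. As downloads
come at rate L μ, the time integral of the expected number is at most N L / (L μ) = N / μ
(`lintegral_meanHidden_le`). Total flow time is the integral of the expected number of unfinished
requests (`sum_flowTime`), so the average loses at most 1 / μ.

Probability enters through the compensator formula `lintegral_finish`: a chunk under service is
downloaded at rate μ, also when weighted by an integrand that depends only on the past. It follows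
by redrawing a single downloading time. -/

noncomputable section

namespace Srpt

/-! ### Shortest-remaining-first steps and the dominance order on multisets -/

section

/-- `m` is a smallest positive entry of `r`. -/
def IsMinPos (r : Multiset ℕ) (m : ℕ) : Prop := m ∈ r ∧ 0 < m ∧ ∀ y ∈ r, 0 < y → m ≤ y

open Classical in
/-- Decrement a smallest positive entry of `r`, if there is one. -/
def step (r : Multiset ℕ) : Multiset ℕ :=
  if h : ∃ m, IsMinPos r m then (h.choose - 1) ::ₘ r.erase h.choose else r

lemma IsMinPos.eq {r : Multiset ℕ} {m m' : ℕ} (h : IsMinPos r m) (h' : IsMinPos r m') : m = m' :=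
  le_antisymm (h.2.2 _ h'.1 h'.2.1) (h'.2.2 _ h.1 h.2.1)

lemma step_of_isMinPos {r : Multiset ℕ} {m : ℕ} (h : IsMinPos r m) :
    step r = (m - 1) ::ₘ r.erase m := by
  have hex : ∃ m, IsMinPos r m := ⟨m, h⟩
  rw [step, dif_pos hex, hex.choose_spec.eq h]

lemma exists_isMinPos {r : Multiset ℕ} {y : ℕ} (hy : y ∈ r) (h0 : 0 < y) : ∃ m, IsMinPos r m := by
  classical
  have hex : ∃ m, m ∈ r ∧ 0 < m := ⟨y, hy, h0⟩
  exact ⟨Nat.find hex, (Nat.find_spec hex).1, (Nat.find_spec hex).2,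
    fun z hz hz0 => Nat.find_min' hex ⟨hz, hz0⟩⟩

lemma step_of_forall_zero {r : Multiset ℕ} (h : ∀ y ∈ r, y = 0) : step r = r := by
  rw [step, dif_neg]
  rintro ⟨m, hm⟩
  exact hm.2.1.ne' (h m hm.1)

lemma step_cases (r : Multiset ℕ) :
    ((∀ y ∈ r, y = 0) ∧ step r = r) ∨
      ∃ m, IsMinPos r m ∧ step r = (m - 1) ::ₘ r.erase m := by
  by_cases h : ∀ y ∈ r, y = 0
  · exact Or.inl ⟨h, step_of_forall_zero h⟩
  · push Not at h
    obtain ⟨y, hy, h0⟩ := h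
    obtain ⟨m, hm⟩ := exists_isMinPos hy (Nat.pos_of_ne_zero h0)
    exact Or.inr ⟨m, hm, step_of_isMinPos hm⟩

/-- The shortfall of the entries of `r` below the threshold `θ`. -/
def shortfall (θ : ℕ) (r : Multiset ℕ) : ℕ := (r.map fun y => θ - y).sum

/-- The number of positive entries. -/
def posCount (r : Multiset ℕ) : ℕ := r.countP (0 < ·)

@[simp] lemma shortfall_cons (θ y : ℕ) (r : Multiset ℕ) :
    shortfall θ (y ::ₘ r) = (θ - y) + shortfall θ r := by
  simp [shortfall]

lemma shortfall_of_mem {r : Multiset ℕ} {m : ℕ} (h : m ∈ r) (θ : ℕ) :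
    shortfall θ r = (θ - m) + shortfall θ (r.erase m) := by
  conv_lhs => rw [← Multiset.cons_erase h]
  simp

lemma shortfall_succ (θ : ℕ) (r : Multiset ℕ) :
    shortfall (θ + 1) r = shortfall θ r + r.countP (· ≤ θ) := by
  induction r using Multiset.induction_on with
  | empty => simp [shortfall]
  | cons y r ih =>
    rw [shortfall_cons, shortfall_cons, ih, Multiset.countP_cons]
    split_ifs <;> omega

/-- At threshold 1 the shortfall counts the zeros. This is how dominance controls the number of
unfinished requests. -/
lemma shortfall_one_add_posCount (r : Multiset ℕ) : shortfall 1 r + posCount r = r.card := by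
  induction r using Multiset.induction_on with
  | empty => simp [shortfall, posCount]
  | cons y r ih =>
    rw [shortfall_cons, posCount, Multiset.countP_cons, Multiset.card_cons]
    rw [posCount] at ih
    split_ifs <;> omega

/-- `r` is at least as advanced as `r'` for shortest-remaining-first service. -/
def Dom (r r' : Multiset ℕ) : Prop := r.card = r'.card ∧ ∀ θ, shortfall θ r' ≤ shortfall θ r

lemma Dom.refl (r : Multiset ℕ) : Dom r r := ⟨rfl, fun _ => le_rfl⟩

lemma Dom.trans {r r' r'' : Multiset ℕ} (h : Dom r r') (h' : Dom r' r'') : Dom r r'' :=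
  ⟨h.1.trans h'.1, fun θ => (h'.2 θ).trans (h.2 θ)⟩

lemma Dom.cons {r r' : Multiset ℕ} (h : Dom r r') (y : ℕ) : Dom (y ::ₘ r) (y ::ₘ r') :=
  ⟨by simp [h.1], fun θ => by simpa using h.2 θ⟩

lemma Dom.posCount_le {r r' : Multiset ℕ} (h : Dom r r') : posCount r ≤ posCount r' := by
  have h1 := shortfall_one_add_posCount r
  have h2 := shortfall_one_add_posCount r'
  have h3 := h.2 1
  have h4 := h.1
  omega

lemma card_decrement {r : Multiset ℕ} {m : ℕ} (h : m ∈ r) :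
    ((m - 1) ::ₘ r.erase m).card = r.card := by
  rw [Multiset.card_cons, Multiset.card_erase_add_one h]

lemma card_step (r : Multiset ℕ) : (step r).card = r.card := by
  rcases step_cases r with ⟨-, h⟩ | ⟨m, hm, h⟩
  · rw [h]
  · rw [h, card_decrement hm.1]

lemma card_step_iterate (n : ℕ) (r : Multiset ℕ) : (step^[n] r).card = r.card := by
  induction n with
  | zero => rfl
  | succ n ih => rw [Function.iterate_succ_apply', card_step, ih]

lemma dom_decrement {r : Multiset ℕ} {m : ℕ} (h : m ∈ r) : Dom ((m - 1) ::ₘ r.erase m) r := by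
  refine ⟨card_decrement h, fun θ => ?_⟩
  rw [shortfall_of_mem h, shortfall_cons]
  omega

lemma dom_step_self (r : Multiset ℕ) : Dom (step r) r := by
  rcases step_cases r with ⟨-, h⟩ | ⟨m, hm, h⟩
  · rw [h]; exact Dom.refl r
  · rw [h]; exact dom_decrement hm.1

/-- Up to the smallest positive entry only the zeros fall short, each by the whole of θ. -/
lemma shortfall_of_lt_min {r : Multiset ℕ} {m : ℕ} (hm : ∀ y ∈ r, 0 < y → m ≤ y) {θ : ℕ}
    (hθ : θ ≤ m) : shortfall θ r = θ * r.countP (· ≤ 0) := by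
  induction r using Multiset.induction_on with
  | empty => simp [shortfall]
  | cons y r ih =>
    rw [shortfall_cons, Multiset.countP_cons, ih fun z hz => hm z (Multiset.mem_cons_of_mem hz)]
    have hy := hm y (Multiset.mem_cons_self y r)
    by_cases h0 : y ≤ 0
    · have : y = 0 := by omega
      subst this
      simp
      ring
    · rw [if_neg h0]
      have := hy (by omega)
      have : θ - y = 0 := by omega
      rw [this]
      ring

lemma shortfall_of_forall_zero {r : Multiset ℕ} (h : ∀ y ∈ r, y = 0) (θ : ℕ) :
    shortfall θ r = θ * r.card := by
  rw [Multiset.eq_replicate_card.2 h]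
  simp [shortfall, mul_comm]

lemma shortfall_le (r : Multiset ℕ) (θ : ℕ) : shortfall θ r ≤ θ * r.card := by
  induction r using Multiset.induction_on with
  | empty => simp [shortfall]
  | cons y r ih =>
    rw [shortfall_cons, Multiset.card_cons, mul_add]
    omega

lemma shortfall_le_mul_countP (r : Multiset ℕ) (θ : ℕ) :
    shortfall θ r ≤ θ * r.countP (· ≤ θ) := by
  induction r using Multiset.induction_on with
  | empty => simp [shortfall]
  | cons y r ih =>
    rw [shortfall_cons, Multiset.countP_cons]
    split_ifs
    · rw [mul_add]; omega
    · have : θ - y = 0 := by omega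
      simpa [this] using ih

/-- Each entry that is at most θ contributes at most θ, and the entry `m` contributes only θ - m. -/
lemma shortfall_add_le_mul_countP {r : Multiset ℕ} {m θ : ℕ} (hm : m ∈ r) (hmθ : m ≤ θ) :
    shortfall θ r + m ≤ θ * r.countP (· ≤ θ) := by
  conv_rhs => rw [← Multiset.cons_erase hm]
  rw [shortfall_of_mem hm, Multiset.countP_cons, if_pos hmθ, mul_add]
  have := shortfall_le_mul_countP (r.erase m) θ
  omega

/-- One step of shortest-remaining-first service is at least as good as any other decrement. -/
lemma Dom.step_decrement {r r' : Multiset ℕ} (h : Dom r r') {m : ℕ} (hm : m ∈ r') (h0 : 0 < m) :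
    Dom (step r) ((m - 1) ::ₘ r'.erase m) := by
  refine ⟨by rw [card_step, card_decrement hm, h.1], fun θ => ?_⟩
  rcases step_cases r with ⟨hz, hs⟩ | ⟨p, hp, hs⟩
  · rw [hs, shortfall_of_forall_zero hz, h.1, ← card_decrement hm]
    exact shortfall_le _ _
  · have e1 := shortfall_of_mem hm θ
    have e2 := shortfall_of_mem hp.1 θ
    have e3 := h.2 θ
    have hp0 := hp.2.1
    rw [hs, shortfall_cons, shortfall_cons]
    -- If p ≤ θ, the step raises the left shortfall by exactly one and the decrement raises the
    -- right one by at most one.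
    by_cases hθ : p ≤ θ
    · omega
    -- For m ≤ θ < p only the right side gains, so one unit of slack is needed at θ. Let z be the
    -- number of zeros of `r` and c the number of entries of `r'` up to θ. If z < c, dominance at θ
    -- + 1 gives the slack; if c ≤ z, the right shortfall is at most θ c - m, and m is positive.
    · by_cases hmθ : m ≤ θ
      · have a1 := shortfall_of_lt_min hp.2.2 (θ := θ) (by omega)
        have a2 := shortfall_of_lt_min hp.2.2 (θ := θ + 1) (by omega)
        have a3 := h.2 (θ + 1)
        rw [shortfall_succ, a2] at a3
        have a4 := shortfall_add_le_mul_countP hm hmθ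
        set z := r.countP (· ≤ 0)
        set c := r'.countP (· ≤ θ)
        rcases Nat.lt_or_ge z c with hzc | hzc
        · have : (θ + 1) * z = θ * z + z := by ring
          omega
        · have := Nat.mul_le_mul_left θ hzc
          omega
      · omega

lemma Dom.step_right {r r' : Multiset ℕ} (h : Dom r r') : Dom (step r) r' :=
  (dom_step_self r).trans h

lemma Dom.step {r r' : Multiset ℕ} (h : Dom r r') : Dom (step r) (step r') := by
  rcases step_cases r' with ⟨-, hs⟩ | ⟨m, hm, hs⟩
  · rw [hs]; exact h.step_right
  · rw [hs]; exact h.step_decrement hm.1 hm.2.1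

lemma Dom.step_iterate {r r' : Multiset ℕ} (h : Dom r r') (n : ℕ) :
    Dom (Srpt.step^[n] r) (Srpt.step^[n] r') := by
  induction n with
  | zero => exact h
  | succ n ih => rw [Function.iterate_succ_apply', Function.iterate_succ_apply']; exact ih.step

/-- Steps that ignore the entry `k` are particular decrements of the enlarged state, so steps that
take it into account do at least as well. -/
lemma dom_step_iterate_cons (n k : ℕ) (r : Multiset ℕ) :
    Dom (step^[n] (k ::ₘ r)) (k ::ₘ step^[n] r) := by
  induction n with
  | zero => exact Dom.refl _
  | succ n ih =>
    rw [Function.iterate_succ_apply', Function.iterate_succ_apply']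
    rcases step_cases (step^[n] r) with ⟨-, hs⟩ | ⟨m, hm, hs⟩
    · rw [hs]; exact ih.step_right
    · rw [hs]
      have := ih.step_decrement (Multiset.mem_cons_of_mem hm.1) hm.2.1
      refine this.trans ?_
      refine ⟨?_, fun θ => ?_⟩
      · rw [card_decrement (Multiset.mem_cons_of_mem hm.1), Multiset.card_cons, Multiset.card_cons,
          card_decrement hm.1]
      have e1 := shortfall_of_mem hm.1 θ
      have e2 := shortfall_of_mem (r := k ::ₘ step^[n] r) (Multiset.mem_cons_of_mem hm.1) θ
      simp only [shortfall_cons] at e2 ⊢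
      omega

lemma posCount_cons_le (k : ℕ) (r : Multiset ℕ) : posCount (k ::ₘ r) ≤ posCount r + 1 := by
  rw [posCount, Multiset.countP_cons, posCount]
  split_ifs <;> omega

lemma posCount_step_iterate_cons_le (n k : ℕ) (r : Multiset ℕ) :
    posCount (step^[n] (k ::ₘ r)) ≤ posCount (step^[n] r) + 1 :=
  (dom_step_iterate_cons n k r).posCount_le.trans (posCount_cons_le _ _)

lemma sum_step (r : Multiset ℕ) : (step r).sum = r.sum - 1 := by
  rcases step_cases r with ⟨hz, hs⟩ | ⟨m, hm, hs⟩
  · rw [hs, Multiset.sum_eq_zero hz, Nat.zero_sub]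
  · rw [hs]
    conv_rhs => rw [← Multiset.cons_erase hm.1]
    have := hm.2.1
    simp only [Multiset.sum_cons]
    omega

lemma sum_step_iterate (n : ℕ) (r : Multiset ℕ) : (step^[n] r).sum = r.sum - n := by
  induction n with
  | zero => rfl
  | succ n ih => rw [Function.iterate_succ_apply', sum_step, ih]; omega

/-- Each step uses up one unit of the sum until nothing is left. This makes the truncation of the
Poisson sums exact. -/
lemma step_iterate_succ_of_sum_le {r : Multiset ℕ} {K : ℕ} (h : r.sum ≤ K) :
    step^[K + 1] r = step^[K] r := by
  rw [Function.iterate_succ_apply']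
  refine step_of_forall_zero fun y hy => ?_
  have h1 := sum_step_iterate K r
  have h2 := Multiset.le_sum_of_mem hy
  omega

lemma posCount_le_card (r : Multiset ℕ) : posCount r ≤ r.card := Multiset.countP_le_card _ _

end

/-! ### A Poisson number of ideal steps -/

section

/-- The Poisson probabilities. -/
def poissonWeight (n : ℕ) (y : ℝ) : ℝ := Real.exp (-y) * (y ^ n / n.factorial)

lemma poissonWeight_nonneg (n : ℕ) {y : ℝ} (hy : 0 ≤ y) : 0 ≤ poissonWeight n y := by
  unfold poissonWeight; positivity

lemma sum_poissonWeight_le (K : ℕ) {y : ℝ} (hy : 0 ≤ y) :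
    ∑ n ∈ Finset.range K, poissonWeight n y ≤ 1 := by
  simp only [poissonWeight, ← Finset.mul_sum]
  have h := Real.sum_le_exp_of_nonneg hy K
  calc Real.exp (-y) * ∑ i ∈ Finset.range K, y ^ i / (i.factorial : ℝ)
      ≤ Real.exp (-y) * Real.exp y := by gcongr
    _ = 1 := by rw [← Real.exp_add]; simp

lemma hasDerivAt_poissonWeight_zero (y : ℝ) :
    HasDerivAt (poissonWeight 0) (-poissonWeight 0 y) y := by
  have : poissonWeight 0 = fun y => Real.exp (-y) := by ext; simp [poissonWeight]
  rw [this]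
  exact (hasDerivAt_neg y).exp.congr_deriv (by simp)

lemma hasDerivAt_poissonWeight_succ (n : ℕ) (y : ℝ) :
    HasDerivAt (poissonWeight (n + 1)) (poissonWeight n y - poissonWeight (n + 1) y) y := by
  have h1 : HasDerivAt (fun y : ℝ => Real.exp (-y)) (-Real.exp (-y)) y :=
    (hasDerivAt_neg y).exp.congr_deriv (by simp)
  have h2 : HasDerivAt (fun y : ℝ => y ^ (n + 1) / ((n + 1).factorial : ℝ))
      (y ^ n / (n.factorial : ℝ)) y := by
    have h := (hasDerivAt_pow (n + 1) y).div_const ((n + 1).factorial : ℝ)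
    refine h.congr_deriv ?_
    have : (n.factorial : ℝ) ≠ 0 := by positivity
    rw [Nat.factorial_succ]
    push_cast
    field_simp
  refine (h1.mul h2).congr_deriv ?_
  simp only [poissonWeight]
  ring

/-- The derivatives telescope: mass leaves the first K + 1 values only through the last one. -/
lemma hasDerivAt_sum_poissonWeight (K : ℕ) (y : ℝ) :
    HasDerivAt (fun y => ∑ n ∈ Finset.range (K + 1), poissonWeight n y)
      (-poissonWeight K y) y := by
  induction K with
  | zero => simpa using hasDerivAt_poissonWeight_zero y
  | succ K ih =>
    simp only [Finset.sum_range_succ _ (K + 1)]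
    exact (ih.add (hasDerivAt_poissonWeight_succ K y)).congr_deriv (by ring)

/-- The expected value of `v` after a Poisson number, with mean `y`, of steps of
shortest-remaining-first service, truncated at `K + 1` steps. -/
def poissonStep (K : ℕ) (v : Multiset ℕ → ℝ) (y : ℝ) (r : Multiset ℕ) : ℝ :=
  ∑ n ∈ Finset.range (K + 1), poissonWeight n y * v (step^[n] r) +
    (1 - ∑ n ∈ Finset.range (K + 1), poissonWeight n y) * v (step^[K + 1] r)

/-- Bounded functions that increase when the service state gets worse. -/
structure Monot (B : ℝ) (v : Multiset ℕ → ℝ) : Prop where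
  nonneg : ∀ r, 0 ≤ v r
  le : ∀ r, v r ≤ B
  mono : ∀ {r r'}, Dom r r' → v r ≤ v r'

lemma Monot.cons {B : ℝ} {v : Multiset ℕ → ℝ} (h : Monot B v) (k : ℕ) :
    Monot B fun r => v (k ::ₘ r) :=
  ⟨fun _ => h.nonneg _, fun _ => h.le _, fun hd => h.mono (hd.cons k)⟩

lemma Monot.poissonStep {B : ℝ} {v : Multiset ℕ → ℝ} (h : Monot B v) (K : ℕ) {y : ℝ}
    (hy : 0 ≤ y) : Monot B (poissonStep K v y) where
  nonneg r := by
    have h1 := sum_poissonWeight_le (K + 1) hy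
    have h2 : ∀ n ∈ Finset.range (K + 1), 0 ≤ poissonWeight n y * v (step^[n] r) := fun n _ =>
      mul_nonneg (poissonWeight_nonneg n hy) (h.nonneg _)
    exact add_nonneg (Finset.sum_nonneg h2) (mul_nonneg (by linarith) (h.nonneg _))
  le r := by
    have h1 := sum_poissonWeight_le (K + 1) hy
    have h2 : ∑ n ∈ Finset.range (K + 1), poissonWeight n y * v (step^[n] r) ≤
        ∑ n ∈ Finset.range (K + 1), poissonWeight n y * B := Finset.sum_le_sum fun n _ =>
      mul_le_mul_of_nonneg_left (h.le _) (poissonWeight_nonneg n hy)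
    have h3 : (1 - ∑ n ∈ Finset.range (K + 1), poissonWeight n y) * v (step^[K + 1] r) ≤
        (1 - ∑ n ∈ Finset.range (K + 1), poissonWeight n y) * B :=
      mul_le_mul_of_nonneg_left (h.le _) (by linarith)
    rw [← Finset.sum_mul] at h2
    unfold Srpt.poissonStep
    linarith
  mono hd := by
    have h1 := sum_poissonWeight_le (K + 1) hy
    exact add_le_add (Finset.sum_le_sum fun n _ => mul_le_mul_of_nonneg_left
      (h.mono (hd.step_iterate n)) (poissonWeight_nonneg n hy))
      (mul_le_mul_of_nonneg_left (h.mono (hd.step_iterate _)) (by linarith))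

lemma poissonStep_zero (K : ℕ) (v : Multiset ℕ → ℝ) (r : Multiset ℕ) :
    poissonStep K v 0 r = v r := by
  have h : ∀ n, poissonWeight n 0 = if n = 0 then 1 else 0 := by
    intro n
    by_cases hn : n = 0 <;> simp [poissonWeight, hn]
  simp [poissonStep, h]

/-- An additional step at the start shifts the Poisson index by one. The shifted sum closes up
because all iterates from the K-th on coincide. -/
lemma poissonStep_step (K : ℕ) (v : Multiset ℕ → ℝ) (y : ℝ) {r : Multiset ℕ} (hr : r.sum ≤ K) :
    poissonStep K v y (step r) - poissonStep K v y r =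
      -poissonWeight 0 y * v r +
        ∑ n ∈ Finset.range K, (poissonWeight n y - poissonWeight (n + 1) y) * v (step^[n + 1] r) +
        poissonWeight K y * v (step^[K + 1] r) := by
  have e : step^[K + 1] (step r) = step^[K + 1] r := by
    rw [← Function.iterate_succ_apply, Function.iterate_succ_apply',
      step_iterate_succ_of_sum_le hr, ← Function.iterate_succ_apply' step,
      step_iterate_succ_of_sum_le hr]
  unfold poissonStep
  rw [e, Finset.sum_range_succ (fun n => poissonWeight n y * v (step^[n] (step r))),
    Finset.sum_range_succ' (fun n => poissonWeight n y * v (step^[n] r))]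
  simp only [← Function.iterate_succ_apply, sub_mul, Finset.sum_sub_distrib]
  simp
  ring

/-- Kolmogorov's backward equation of the ideal system, with the Poisson mean as time. -/
lemma hasDerivAt_poissonStep (K : ℕ) (v : Multiset ℕ → ℝ) (y : ℝ) {r : Multiset ℕ}
    (hr : r.sum ≤ K) :
    HasDerivAt (fun y => poissonStep K v y r)
      (poissonStep K v y (step r) - poissonStep K v y r) y := by
  rw [poissonStep_step K v y hr]
  have h1 : HasDerivAt (fun y => ∑ n ∈ Finset.range K, poissonWeight (n + 1) y * v (step^[n + 1] r))
      (∑ n ∈ Finset.range K, (poissonWeight n y - poissonWeight (n + 1) y) * v (step^[n + 1] r))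
      y := HasDerivAt.fun_sum fun n _ => (hasDerivAt_poissonWeight_succ n y).mul_const _
  have h2 := (hasDerivAt_poissonWeight_zero y).mul_const (v r)
  have h3 := ((hasDerivAt_sum_poissonWeight K y).const_sub 1).mul_const (v (step^[K + 1] r))
  have h4 := (h1.add h2).add h3
  have e : (fun y => poissonStep K v y r) = ((fun y => ∑ n ∈ Finset.range K,
      poissonWeight (n + 1) y * v (step^[n + 1] r)) + fun y => poissonWeight 0 y * v r) +
      fun y => (1 - ∑ n ∈ Finset.range (K + 1), poissonWeight n y) * v (step^[K + 1] r) := by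
    ext y
    simp only [poissonStep, Pi.add_apply]
    rw [Finset.sum_range_succ' (fun n => poissonWeight n y * v (step^[n] r))]
    simp
  rw [e]
  exact h4.congr_deriv (by ring)

lemma continuous_poissonStep (K : ℕ) (v : Multiset ℕ → ℝ) (r : Multiset ℕ) :
    Continuous fun y => poissonStep K v y r := by
  unfold poissonStep poissonWeight
  fun_prop

end

/-! ### The virtual state and the potential -/

section

/-- The remaining numbers of chunks `α` of the first `q` requests. -/
def load (q : ℕ) (α : ℕ → ℕ) : Multiset ℕ := (Multiset.range q).map α

/-- The differential backlogs `(α - δ)⁺` of the first `q` requests. -/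
def backlog (q : ℕ) (α δ : ℕ → ℕ) : Multiset ℕ := load q fun j => α j - δ j

/-- The number of threads whose next download is not needed by the request that they serve. -/
def excess (L q : ℕ) (α δ : ℕ → ℕ) : ℕ := L - ∑ j ∈ Finset.range q, min (α j) (δ j)

/-- The virtual state, in which each of the `L` threads has already done one useful download. -/
def virt (L q : ℕ) (α δ : ℕ → ℕ) : Multiset ℕ := step^[excess L q α δ] (backlog q α δ)

/-- A potential that bounds the future number of downloads that are seen by the requests that are
unfinished but virtually finished. -/
def potential (L q : ℕ) (α δ : ℕ → ℕ) : ℕ :=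
  (L - excess L q α δ) * posCount (load q α) +
    ∑ n ∈ Finset.range (excess L q α δ), posCount (step^[n] (backlog q α δ))

lemma load_congr {q : ℕ} {α α' : ℕ → ℕ} (h : ∀ j < q, α j = α' j) : load q α = load q α' :=
  Multiset.map_congr rfl fun j hj => h j (Multiset.mem_range.1 hj)

lemma load_succ (q : ℕ) (α : ℕ → ℕ) : load (q + 1) α = α q ::ₘ load q α := by
  simp [load, Multiset.range_succ]

lemma card_load (q : ℕ) (α : ℕ → ℕ) : (load q α).card = q := by simp [load]

lemma mem_load {q i : ℕ} (α : ℕ → ℕ) (h : i < q) : α i ∈ load q α :=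
  Multiset.mem_map_of_mem _ (Multiset.mem_range.2 h)

lemma sum_load (q : ℕ) (α : ℕ → ℕ) : (load q α).sum = ∑ j ∈ Finset.range q, α j := rfl

lemma posCount_load (q : ℕ) (α : ℕ → ℕ) :
    posCount (load q α) = ((Finset.range q).filter fun j => 0 < α j).card := by
  rw [posCount, load, Multiset.countP_map]
  rfl

lemma load_decrement {q i : ℕ} (hi : i < q) {α α' : ℕ → ℕ} (h : α' i = α i - 1)
    (h' : ∀ j, j ≠ i → α' j = α j) : load q α' = (α i - 1) ::ₘ (load q α).erase (α i) := by
  have key : ∀ f : ℕ → ℕ, load q f = f i ::ₘ ((Multiset.range q).erase i).map f := fun f => by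
    rw [load, ← Multiset.map_cons, Multiset.cons_erase (Multiset.mem_range.2 hi)]
  rw [key α, key α', Multiset.erase_cons_head, h]
  congr 1
  refine Multiset.map_congr rfl fun j hj => h' j ?_
  exact ((Multiset.Nodup.mem_erase_iff (Multiset.nodup_range q)).1 hj).1

lemma virt_congr {L q : ℕ} {α α' δ δ' : ℕ → ℕ} (hα : ∀ j < q, α j = α' j)
    (hδ : ∀ j < q, δ j = δ' j) :
    virt L q α δ = virt L q α' δ' ∧ potential L q α δ = potential L q α' δ' := by
  have h1 : backlog q α δ = backlog q α' δ' := load_congr fun j hj => by rw [hα j hj, hδ j hj]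
  have h2 : excess L q α δ = excess L q α' δ' := by
    unfold excess
    rw [Finset.sum_congr rfl fun j hj => ?_]
    rw [hα j (Finset.mem_range.1 hj), hδ j (Finset.mem_range.1 hj)]
  simp only [virt, potential, h1, h2, load_congr hα, and_self]

lemma card_virt (L q : ℕ) (α δ : ℕ → ℕ) : (virt L q α δ).card = q := by
  rw [virt, card_step_iterate, backlog, card_load]

lemma sum_virt_le (L q : ℕ) (α δ : ℕ → ℕ) :
    (virt L q α δ).sum ≤ ∑ j ∈ Finset.range q, α j := by
  rw [virt, sum_step_iterate, backlog, sum_load]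
  exact (Nat.sub_le _ _).trans (Finset.sum_le_sum fun j _ => Nat.sub_le _ _)

lemma posCount_le_of_le {q : ℕ} {α α' : ℕ → ℕ} (h : ∀ j, α j ≤ α' j) :
    posCount (load q α) ≤ posCount (load q α') := by
  rw [posCount_load, posCount_load]
  refine Finset.card_le_card fun j hj => ?_
  rw [Finset.mem_filter] at hj ⊢
  exact ⟨hj.1, hj.2.trans_le (h j)⟩

/-- The virtual state is ahead of the real one, as its downloads are credited in advance. -/
lemma posCount_virt_le (L q : ℕ) (α δ : ℕ → ℕ) : posCount (virt L q α δ) ≤ posCount (load q α) := by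
  have h : ∀ n r, Dom (step^[n] r) r := fun n r => by
    induction n with
    | zero => exact Dom.refl r
    | succ n ih => rw [Function.iterate_succ_apply']; exact ih.step_right
  exact (h _ _).posCount_le.trans (posCount_le_of_le fun j => Nat.sub_le _ _)

lemma sum_min_le_sum (q : ℕ) (α δ : ℕ → ℕ) :
    ∑ j ∈ Finset.range q, min (α j) (δ j) ≤ ∑ j ∈ Finset.range q, δ j :=
  Finset.sum_le_sum fun _ _ => min_le_right _ _

lemma sum_range_eq_of_eq_add {q i c : ℕ} (hi : i < q) {f f' : ℕ → ℕ} (h : f' i = f i + c)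
    (h' : ∀ j, j ≠ i → f' j = f j) :
    ∑ j ∈ Finset.range q, f' j = ∑ j ∈ Finset.range q, f j + c := by
  rw [← Finset.add_sum_erase _ f (Finset.mem_range.2 hi),
    ← Finset.add_sum_erase _ f' (Finset.mem_range.2 hi), h,
    Finset.sum_congr rfl fun j hj => h' j (Finset.ne_of_mem_erase hj)]
  ring

/-- Assigning an idle thread to a request with the smallest differential backlog changes neither the
virtual state nor the potential. -/
lemma virt_assign {L q i : ℕ} {α δ δ' : ℕ → ℕ} (hi : i < q) (hαi : 0 < α i)
    (hmin : ∀ j < q, 0 < α j → (α i : ℤ) - δ i ≤ α j - δ j)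
    (hcap : ∑ j ∈ Finset.range q, δ j < L) (h : δ' i = δ i + 1) (h' : ∀ j, j ≠ i → δ' j = δ j) :
    virt L q α δ' = virt L q α δ ∧ potential L q α δ' = potential L q α δ := by
  have hs := sum_min_le_sum q α δ
  rcases Nat.lt_or_ge (δ i) (α i) with hlt | hle
  -- The next download of the new thread is useful. By minimality the assignment is a shortest-first
  -- step of the backlog, and the excess falls by one, so the number of steps made in total is the
  -- same.
  · have hb : backlog q α δ' = (α i - δ i - 1) ::ₘ (backlog q α δ).erase (α i - δ i) := by
      refine load_decrement (α := fun j => α j - δ j) hi ?_ fun j hj => ?_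
      · omega
      · rw [h' j hj]
    have hm : IsMinPos (backlog q α δ) (α i - δ i) := by
      refine ⟨mem_load (fun j => α j - δ j) hi, by omega, fun y hy hy0 => ?_⟩
      rw [backlog, load] at hy
      obtain ⟨j, hj, rfl⟩ := Multiset.mem_map.1 hy
      have := hmin j (Multiset.mem_range.1 hj) (by omega)
      omega
    rw [← step_of_isMinPos hm] at hb
    have he : excess L q α δ = excess L q α δ' + 1 := by
      have := sum_range_eq_of_eq_add (c := 1) hi (f := fun j => min (α j) (δ j))
        (f' := fun j => min (α j) (δ' j)) (by simp only [h]; omega)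
        fun j hj => by simp only [h' j hj]
      unfold excess
      omega
    -- The least difference is positive, so every unfinished request has a positive backlog. Hence
    -- the term n = 0 of the sum in the potential equals the term that is added to the product.
    have hp : posCount (backlog q α δ) = posCount (load q α) := by
      rw [backlog, posCount_load, posCount_load]
      congr 1
      refine Finset.filter_congr fun j hj => ?_
      have := hmin j (Finset.mem_range.1 hj)
      omega
    have hL : L - excess L q α δ' = L - excess L q α δ + 1 := by
      have : excess L q α δ ≤ L := Nat.sub_le _ _
      omega
    constructor
    · rw [virt, virt, he, hb, Function.iterate_succ_apply]
    · rw [potential, potential, hL, he, hb, Finset.sum_range_succ']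
      simp only [← Function.iterate_succ_apply]
      rw [Function.iterate_zero_apply, hp]
      ring
  -- Request `i` already has enough threads, so the new one counts as excess, just as an idle thread
  -- does.
  · have hb : backlog q α δ' = backlog q α δ := load_congr fun j _ => by
      rcases eq_or_ne j i with rfl | hj
      · omega
      · rw [h' j hj]
    have he : excess L q α δ' = excess L q α δ := by
      unfold excess
      rw [Finset.sum_congr rfl fun j hj => ?_]
      rcases eq_or_ne j i with rfl | hj
      · omega
      · rw [h' j hj]
    simp only [virt, potential, hb, he, and_self]

/-- The assignments of one instant are made one at a time, with δ updated in between, as in the rule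
of SEDPT-R. -/
lemma virt_assign_list {L q : ℕ} {α : ℕ → ℕ} : ∀ (l : List ℕ) (δ : ℕ → ℕ),
    (∀ i ∈ l, i < q ∧ 0 < α i) → ∑ j ∈ Finset.range q, δ j + l.length ≤ L →
    (∀ p i p', l = p ++ i :: p' → ∀ j < q, 0 < α j →
      (α i : ℤ) - (δ i + p.count i : ℕ) ≤ α j - (δ j + p.count j : ℕ)) →
    virt L q α (fun i => δ i + l.count i) = virt L q α δ ∧
      potential L q α (fun i => δ i + l.count i) = potential L q α δ := by
  intro l
  induction l with
  | nil => intro δ _ _ _; simp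
  | cons i l ih =>
    intro δ hl hcap hmin
    obtain ⟨hi, hαi⟩ := hl i List.mem_cons_self
    rw [List.length_cons] at hcap
    have h1 := virt_assign (L := L) (δ := δ) (δ' := fun j => δ j + if j = i then 1 else 0) hi hαi
      (fun j hj hαj => by simpa using hmin [] i l rfl j hj hαj) (by omega) (by simp)
      fun j hj => by simp [hj]
    have h2 := ih (fun j => δ j + if j = i then 1 else 0)
      (fun j hj => hl j (List.mem_cons_of_mem i hj)) (by
        have := sum_range_eq_of_eq_add (c := 1) hi (f := δ)
          (f' := fun j => δ j + if j = i then 1 else 0) (by simp) fun j hj => by simp [hj]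
        omega) (by
        intro p i' p' hp j hj hαj
        have := hmin (i :: p) i' p' (by rw [hp]; rfl) j hj hαj
        simp only [List.count_cons] at this
        have e : ∀ a : ℕ, (δ a + (p.count a + if (i == a) = true then 1 else 0)) =
            δ a + (if a = i then 1 else 0) + p.count a := fun a => by
          simp only [beq_iff_eq, eq_comm (a := i)]; ring
        rw [e, e] at this
        exact this)
    have e : (fun j => δ j + (i :: l).count j) =
        fun j => (δ j + if j = i then 1 else 0) + l.count j := by
      ext a
      simp only [List.count_cons, beq_iff_eq, eq_comm (a := i)]; ring
    rw [e]
    exact ⟨h2.1.trans h1.1, h2.2.trans h1.2⟩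

/-- A download is a step of shortest-remaining-first service of the virtual state. -/
lemma virt_download {L q i : ℕ} {α α' δ δ' : ℕ → ℕ} (hi : i < q) (hαi : 0 < α i) (hδi : 0 < δ i)
    (hcap : ∑ j ∈ Finset.range q, δ j ≤ L) (hα : α' i = α i - 1)
    (hα' : ∀ j, j ≠ i → α' j = α j) (hδ : δ' i = if α i = 1 then 0 else δ i - 1)
    (hδ' : ∀ j, j ≠ i → δ' j = δ j) :
    virt L q α' δ' = step (virt L q α δ) ∧
      potential L q α' δ' + posCount (load q α) ≤
        potential L q α δ + posCount (virt L q α δ) := by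
  have hs := sum_min_le_sum q α δ
  have hb : backlog q α' δ' = backlog q α δ := load_congr fun j _ => by
    -- Both α and δ fall by one. At a completion δ falls to zero, but then the backlog was already
    -- zero because δ was positive.
    rcases eq_or_ne j i with rfl | hj
    · rw [hδ, hα]; split_ifs <;> omega
    · rw [hα' j hj, hδ' j hj]
  have hsum := sum_range_eq_of_eq_add (c := 1) hi (f := fun j => min (α' j) (δ' j))
    (f' := fun j => min (α j) (δ j)) (by simp only [hδ, hα]; split_ifs <;> omega)
    fun j hj => by simp only [hα' j hj, hδ' j hj]
  have he : excess L q α' δ' = excess L q α δ + 1 := by unfold excess; omega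
  have hL : L - excess L q α δ = L - excess L q α' δ' + 1 := by unfold excess; omega
  have hp : posCount (load q α') ≤ posCount (load q α) := posCount_le_of_le fun j => by
    rcases eq_or_ne j i with rfl | hj
    · omega
    · exact (hα' j hj).le
  constructor
  · rw [virt, virt, he, hb, Function.iterate_succ_apply']
  -- One copy of the real count leaves the product, and the sum gains the term n = `excess`, which
  -- is the count in the virtual state.
  · rw [potential, potential, hL, he, hb, Finset.sum_range_succ, virt]
    have := Nat.mul_le_mul_left (L - (excess L q α δ + 1)) hp
    rw [add_mul]
    omega

/-- No thread serves the new request yet, so it only adds an entry to the backlog. The potential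
consists of L counts, each of which grows by at most one. -/
lemma virt_arrival {L q : ℕ} {α δ : ℕ → ℕ} (hδ : δ q = 0) :
    Dom (virt L (q + 1) α δ) (α q ::ₘ virt L q α δ) ∧
      potential L (q + 1) α δ ≤ potential L q α δ + L := by
  have hb : backlog (q + 1) α δ = α q ::ₘ backlog q α δ := by
    rw [backlog, load_succ, hδ]; rfl
  have he : excess L (q + 1) α δ = excess L q α δ := by
    rw [excess, Finset.sum_range_succ, hδ]; simp [excess]
  have hL : excess L q α δ ≤ L := Nat.sub_le _ _
  refine ⟨?_, ?_⟩
  · rw [virt, he, hb]; exact dom_step_iterate_cons _ _ _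
  · rw [potential, potential, he, hb]
    have h1 : posCount (load (q + 1) α) ≤ posCount (load q α) + 1 := by
      rw [load_succ]; exact posCount_cons_le _ _
    have h2 := Nat.mul_le_mul_left (L - excess L q α δ) h1
    have h3 : ∑ n ∈ Finset.range (excess L q α δ), posCount (step^[n] (α q ::ₘ backlog q α δ)) ≤
        ∑ n ∈ Finset.range (excess L q α δ), (posCount (step^[n] (backlog q α δ)) + 1) :=
      Finset.sum_le_sum fun n _ => posCount_step_iterate_cons_le n _ _
    rw [Finset.sum_add_distrib] at h3
    simp only [Finset.sum_const, Finset.card_range, smul_eq_mul, mul_one] at h3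
    rw [mul_add] at h2
    omega

end

/-! ### States along a sample path -/

section

section Path

variable (R : RequestSeq) (x : Chunk → ℝ) (s : Schedule)

/-- The number of chunks of request `i` that are downloaded before time `τ`. -/
def downloadedLt (τ : ℝ≥0∞) (i : ℕ) : ℕ :=
  ((Finset.range (R.n i)).filter fun c => finish x s (i, c) < τ).card

/-- The number of chunks that remain to be downloaded for completing request `i` at time `τ`. -/
def rem (τ : ℝ≥0∞) (i : ℕ) : ℕ := R.k i - downloaded R x s i τ

/-- The left limit of `rem`. -/
def remLeft (τ : ℝ≥0∞) (i : ℕ) : ℕ := R.k i - downloadedLt R x s τ i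

/-- The number of threads serving request `i` at time `τ`, before the assignments of time `τ`. -/
def svc (τ : ℝ≥0∞) (i : ℕ) : ℕ :=
  ((Finset.range (R.n i)).filter fun c =>
    s (i, c) < τ ∧ τ < finish x s (i, c) ∧ downloaded R x s i τ < R.k i).card

/-- The number of threads serving request `i` at time `τ`, after the assignments of time `τ`. -/
def svcAfter (τ : ℝ≥0∞) (i : ℕ) : ℕ :=
  ((Finset.range (R.n i)).filter fun c =>
    s (i, c) ≤ τ ∧ τ < finish x s (i, c) ∧ downloaded R x s i τ < R.k i).card

/-- The left limit of `svcAfter`. -/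
def svcLeft (τ : ℝ≥0∞) (i : ℕ) : ℕ :=
  ((Finset.range (R.n i)).filter fun c =>
    s (i, c) < τ ∧ τ ≤ finish x s (i, c) ∧ downloadedLt R x s τ i < R.k i).card

end Path

section PathLemmas

variable {R : RequestSeq} {N L q : ℕ} {x : Chunk → ℝ} {s : Schedule}

lemma downloadedLt_le (i : ℕ) (τ : ℝ≥0∞) : downloadedLt R x s τ i ≤ downloaded R x s i τ :=
  Finset.card_le_card (Finset.monotone_filter_right _ fun _ _ hc => le_of_lt hc)

/-- The infimum is attained because there are finitely many finish times: if too few chunks are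
downloaded by τ, this remains so until the next finish time, and that exists since `k i ≤ n i`. -/
lemma completion_le_iff {i : ℕ} {τ : ℝ≥0∞} :
    completion R x s i ≤ τ ↔ R.k i ≤ downloaded R x s i τ := by
  refine ⟨fun h => ?_, fun h => sInf_le h⟩
  by_contra hlt
  push Not at hlt
  have hne : ((Finset.range (R.n i)).filter fun c => τ < finish x s (i, c)).Nonempty := by
    by_contra hemp
    rw [Finset.not_nonempty_iff_eq_empty, Finset.filter_eq_empty_iff] at hemp
    have : downloaded R x s i τ = R.n i := by
      rw [downloaded, Finset.filter_true_of_mem fun c hc => not_lt.1 (hemp hc), Finset.card_range]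
    have := R.k_le_n i
    omega
  obtain ⟨c, hc, hmin⟩ := Finset.exists_min_image _ (fun c => finish x s (i, c)) hne
  rw [Finset.mem_filter] at hc
  refine absurd h (not_le.2 (hc.2.trans_le (le_sInf fun t ht => ?_)))
  by_contra htlt
  push Not at htlt
  refine absurd (show R.k i ≤ downloaded R x s i t from ht) (not_le.2 (lt_of_le_of_lt ?_ hlt))
  refine Finset.card_le_card fun c' hc' => ?_
  rw [Finset.mem_filter] at hc' ⊢
  refine ⟨hc'.1, ?_⟩
  by_contra hτ
  push Not at hτ
  exact absurd (hmin c' (Finset.mem_filter.2 ⟨hc'.1, hτ⟩)) (not_le.2 (hc'.2.trans_lt htlt))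

lemma lt_completion_iff {i : ℕ} {τ : ℝ≥0∞} :
    τ < completion R x s i ↔ downloaded R x s i τ < R.k i := by
  rw [← not_le, completion_le_iff, not_le]

lemma rem_pos_iff {i : ℕ} {τ : ℝ≥0∞} : 0 < rem R x s τ i ↔ τ < completion R x s i := by
  rw [lt_completion_iff, rem]; omega

lemma inService_eq (t : ℝ≥0) (i : ℕ) : inService R x s t i = svcAfter R x s t i := by
  simp only [inService, svcAfter, lt_completion_iff]

lemma inServiceBefore_eq (t : ℝ≥0) (i : ℕ) : inServiceBefore R x s t i = svc R x s t i := by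
  simp only [inServiceBefore, svc, lt_completion_iff]

lemma start_lt_finish (hx : ∀ c, 0 < x c) {c : Chunk} (h : s c ≠ ∞) : s c < finish x s c :=
  ENNReal.lt_add_right h (by simpa using hx c)

lemma start_le_finish (c : Chunk) : s c ≤ finish x s c := le_self_add

section Feasible

variable (hs : Feasible R N x s L) (hx : ∀ c, 0 < x c)
include hs

lemma svcAfter_eq_zero {i : ℕ} {t : ℝ≥0} (h : i < N → t < R.a i) : svcAfter R x s t i = 0 := by
  rw [svcAfter, Finset.card_eq_zero, Finset.filter_eq_empty_iff]
  rintro c - ⟨hc, -⟩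
  have := hs.exists_of_start i c (ne_top_of_le_ne_top ENNReal.coe_ne_top hc)
  exact absurd ((hs.arrival_le i c).trans hc) (not_le.2 (by exact_mod_cast h this.1))

lemma svc_eq_zero {i : ℕ} {t : ℝ≥0} (h : i < N → t ≤ R.a i) : svc R x s t i = 0 := by
  rw [svc, Finset.card_eq_zero, Finset.filter_eq_empty_iff]
  rintro c - ⟨hc, -⟩
  have := hs.exists_of_start i c (ne_top_of_lt hc)
  exact absurd ((hs.arrival_le i c).trans_lt hc) (not_lt.2 (by exact_mod_cast h this.1))

include hx in
lemma rem_eq_of_le_arrival {i : ℕ} {t : ℝ≥0} (h : i < N → t ≤ R.a i) : rem R x s t i = R.k i := by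
  rw [rem, downloaded, Finset.filter_false_of_mem, Finset.card_empty, Nat.sub_zero]
  intro c _ hc
  have hne : s (i, c) ≠ ∞ := ne_top_of_le_ne_top ENNReal.coe_ne_top ((start_le_finish _).trans hc)
  have h1 := hs.exists_of_start i c hne
  have h2 := ((hs.arrival_le i c).trans_lt (start_lt_finish hx hne)).trans_le hc
  exact absurd h2 (not_lt.2 (by exact_mod_cast h h1.1))

include hx in
lemma svcAfter_eq_add (t : ℝ≥0) (i : ℕ) :
    svcAfter R x s t i = svc R x s t i + startedAt R s t i := by
  rw [svcAfter, svc, startedAt, ← Finset.card_union_of_disjoint, ← Finset.filter_or]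
  · congr 1
    refine Finset.filter_congr fun c _ => ⟨fun h => ?_, ?_⟩
    · rcases h.1.lt_or_eq with hlt | heq
      · exact Or.inl ⟨hlt, h.2⟩
      · exact Or.inr heq
    · rintro (h | h)
      · exact ⟨h.1.le, h.2⟩
      · have hne : s (i, c) ≠ ∞ := by rw [h]; exact ENNReal.coe_ne_top
        exact ⟨h.le, h ▸ start_lt_finish hx hne, lt_completion_iff.1 (h ▸ hs.lt_completion i c hne)⟩
  · rw [Finset.disjoint_filter]
    rintro c - h h'
    exact h.1.ne h'

lemma sum_svcAfter_eq {t : ℝ≥0} (hq : q ≤ N) (h : ∀ j, q ≤ j → j < N → t < R.a j) :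
    ∑ i ∈ Finset.range q, svcAfter R x s t i = ∑ i ∈ Finset.range N, inService R x s t i := by
  simp only [inService_eq]
  refine Finset.sum_subset (Finset.range_mono hq) fun j hj hj' => ?_
  refine svcAfter_eq_zero hs fun hjN => h j (by simpa using hj') hjN

lemma sum_svcAfter_le {t : ℝ≥0} (hq : q ≤ N) :
    ∑ i ∈ Finset.range q, svcAfter R x s t i ≤ L := by
  refine le_trans ?_ (hs.capacity t)
  simp only [inService_eq]
  exact Finset.sum_le_sum_of_subset (Finset.range_mono hq)

omit hs in
-- In an unfinished request no chunk has been terminated, so a started one is downloaded or still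
-- under service.
lemma startedBefore_le {t : ℝ≥0} {i : ℕ} (hi : downloaded R x s i t < R.k i) :
    startedBefore R s t i ≤ downloaded R x s i t + svc R x s t i := by
  rw [startedBefore, downloaded, svc]
  refine le_trans (Finset.card_le_card ?_) (Finset.card_union_le _ _)
  intro c hc
  rw [Finset.mem_filter] at hc
  rw [Finset.mem_union, Finset.mem_filter, Finset.mem_filter]
  rcases le_or_gt (finish x s (i, c)) t with h | h
  · exact Or.inl ⟨hc.1, h⟩
  · exact Or.inr ⟨hc.1, hc.2, h, hi⟩

include hx in
/-- The assignments of SEDPT-R do not change the virtual state and the potential. -/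
lemma virt_svcAfter {t : ℝ≥0} (hd : ∀ i < N, L ≤ R.d i) (hq : q ≤ N) (ha : ∀ j < q, R.a j ≤ t)
    (ha' : ∀ j, q ≤ j → j < N → t < R.a j) (hS : SEDPTAssignment R N x s L t) :
    virt L q (rem R x s t) (svcAfter R x s t) = virt L q (rem R x s t) (svc R x s t) ∧
    potential L q (rem R x s t) (svcAfter R x s t) =
      potential L q (rem R x s t) (svc R x s t) := by
  obtain ⟨⟨l, hl, hmin⟩, -⟩ := hS
  have hA : svcAfter R x s t = fun i => svc R x s t i + l.count i := by
    ext i; rw [svcAfter_eq_add hs hx, hl]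
  have hmem : ∀ i ∈ l, i < q ∧ 0 < rem R x s t i := by
    intro i hi
    have h0 : 0 < startedAt R s t i := by rw [hl]; exact List.count_pos_iff.2 hi
    obtain ⟨c, hc⟩ := Finset.card_pos.1 h0
    have hc := (Finset.mem_filter.1 hc).2
    have hne : s (i, c) ≠ ∞ := by rw [hc]; exact ENNReal.coe_ne_top
    have h1 := hs.exists_of_start i c hne
    have h2 := hs.arrival_le i c
    rw [hc] at h2
    refine ⟨?_, rem_pos_iff.2 (hc ▸ hs.lt_completion i c hne)⟩
    by_contra hqi
    exact absurd (ha' i (not_lt.1 hqi) h1.1) (not_lt.2 (by exact_mod_cast h2))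
  have hcap : ∑ j ∈ Finset.range q, svc R x s t j + l.length ≤ L := by
    have h1 : ∑ j ∈ Finset.range q, l.count j = l.length := by
      have := Multiset.sum_count_eq_card (s := Finset.range q) (m := (l : Multiset ℕ))
        fun a ha => Finset.mem_range.2 (hmem a (by simpa using ha)).1
      simpa using this
    rw [← h1, ← Finset.sum_add_distrib]
    have := sum_svcAfter_le hs (t := t) hq
    rwa [hA] at this
  rw [hA]
  refine virt_assign_list l _ hmem hcap fun p i p' hp j hj hj0 => ?_
  have hun : Unfinished R N x s t j := ⟨hj.trans_le hq, ha j hj, rem_pos_iff.1 hj0⟩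
  have hdl := lt_completion_iff.1 hun.2.2
  -- The distance condition makes every unfinished `j` a candidate: at most k - 1 of its chunks are
  -- downloaded, and at most L - 1 are under service because one more thread is about to be
  -- assigned. That leaves an unstarted chunk, as n ≥ k + L - 1.
  have := hmin p i p' hp j hun (by
    have h1 := startedBefore_le hdl
    have h2 := Finset.single_le_sum (f := svc R x s t) (fun _ _ => Nat.zero_le _)
      (Finset.mem_range.2 hj)
    have h3 : p.count j ≤ p.length := List.count_le_length
    have h4 : l.length = p.length + (p'.length + 1) := by rw [hp]; simp
    have h5 := hd j (hj.trans_le hq)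
    have h6 := R.k_le_n j
    unfold RequestSeq.d at h5
    omega)
  simp only [inServiceBefore_eq] at this
  exact this

/-- Under SEDPT-R all threads are busy when there are unfinished requests. -/
lemma sum_svcAfter_eq_of_pos {t : ℝ≥0} (hd : ∀ i < N, L ≤ R.d i) (hq : q ≤ N)
    (ha : ∀ j < q, R.a j ≤ t) (ha' : ∀ j, q ≤ j → j < N → t < R.a j)
    (hS : SEDPTAssignment R N x s L t) {j : ℕ} (hj : j < q) (hj0 : 0 < rem R x s t j) :
    ∑ i ∈ Finset.range q, svcAfter R x s t i = L := by
  refine le_antisymm (sum_svcAfter_le hs hq) ?_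
  rcases hS.2 with h | h
  · rw [sum_svcAfter_eq hs hq ha', h]
  · have hun : Unfinished R N x s t j := ⟨hj.trans_le hq, ha j hj, rem_pos_iff.1 hj0⟩
    have hdl := lt_completion_iff.1 hun.2.2
    -- If no chunk of `j` is available, at least n - k + 1 ≥ L of its chunks are under service, so
    -- all threads are busy anyway.
    have h1 : R.n j ≤ downloaded R x s j t + svcAfter R x s t j := by
      rw [downloaded, svcAfter]
      conv_lhs => rw [← Finset.card_range (R.n j)]
      refine le_trans (Finset.card_le_card ?_) (Finset.card_union_le _ _)
      intro c hc
      rw [Finset.mem_union, Finset.mem_filter, Finset.mem_filter]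
      rcases le_or_gt (finish x s (j, c)) t with h' | h'
      · exact Or.inl ⟨hc, h'⟩
      · exact Or.inr ⟨hc, h j hun c (Finset.mem_range.1 hc), h', hdl⟩
    have h2 := Finset.single_le_sum (f := svcAfter R x s t) (fun _ _ => Nat.zero_le _)
      (Finset.mem_range.2 hj)
    have h5 := hd j (hj.trans_le hq)
    have h6 := R.k_le_n j
    unfold RequestSeq.d at h5
    omega

end Feasible

lemma downloadedLt_eq {p t : ℝ≥0∞} (hpt : p < t)
    (hF : ∀ c, ¬(p < finish x s c ∧ finish x s c < t)) (i : ℕ) :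
    downloadedLt R x s t i = downloaded R x s i p := by
  rw [downloadedLt, downloaded]
  congr 1
  refine Finset.filter_congr fun c _ => ⟨fun h => ?_, fun h => h.trans_lt hpt⟩
  by_contra h'
  exact hF (i, c) ⟨not_le.1 h', h⟩

lemma remLeft_eq {p t : ℝ≥0∞} (hpt : p < t)
    (hF : ∀ c, ¬(p < finish x s c ∧ finish x s c < t)) : remLeft R x s t = rem R x s p := by
  ext i; rw [remLeft, rem, downloadedLt_eq hpt hF]

lemma svcLeft_eq {p t : ℝ≥0∞} (hpt : p < t)
    (hF : ∀ c, ¬(p < finish x s c ∧ finish x s c < t)) (hst : ∀ c, s c ≤ p ∨ t ≤ s c) :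
    svcLeft R x s t = svcAfter R x s p := by
  ext i
  rw [svcLeft, svcAfter, downloadedLt_eq hpt hF]
  congr 1
  refine Finset.filter_congr fun c _ => and_congr ⟨fun h => ?_, fun h => h.trans_lt hpt⟩
    (and_congr_left fun _ => ⟨fun h => hpt.trans_le h, fun h => ?_⟩)
  · exact (hst (i, c)).resolve_right (not_le.2 h)
  · by_contra h'
    exact hF (i, c) ⟨h, not_le.1 h'⟩

/-- Under SEDPT-R no chunk is started between two successive arrivals or downloads. -/
lemma no_start_between (hs : Feasible R N x s L) (hx : ∀ c, 0 < x c) {p t : ℝ≥0}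
    (hd : ∀ i < N, L ≤ R.d i) (hq : q ≤ N) (ha : ∀ j < q, R.a j ≤ p)
    (ha' : ∀ j, q ≤ j → j < N → t ≤ R.a j) (hS : SEDPTAssignment R N x s L p)
    (hF : ∀ c, ¬((p : ℝ≥0∞) < finish x s c ∧ finish x s c < t)) (c : Chunk) :
    s c ≤ p ∨ t ≤ s c := by
  by_contra hcon
  push Not at hcon
  obtain ⟨h1, h2⟩ := hcon
  obtain ⟨i, c⟩ := c
  have hne : s (i, c) ≠ ∞ := ne_top_of_lt h2
  lift s (i, c) to ℝ≥0 using hne with p' hp'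
  have hne : s (i, c) ≠ ∞ := by rw [← hp']; exact ENNReal.coe_ne_top
  obtain ⟨hiN, hin⟩ := hs.exists_of_start i c hne
  have hpp' : p < p' := by exact_mod_cast h1
  have hp't : p' < t := by exact_mod_cast h2
  have hai : R.a i ≤ p' := by
    have := hs.arrival_le i c
    rw [← hp'] at this
    exact_mod_cast this
  have hiq : i < q := by
    by_contra hqi
    exact absurd (ha' i (not_lt.1 hqi) hiN) (not_le.2 (hai.trans_lt hp't))
  have hdl : ∀ j, downloaded R x s j p' = downloaded R x s j p := fun j => by
    rw [downloaded, downloaded]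
    congr 1
    refine Finset.filter_congr fun c' _ => ⟨fun h => ?_, fun h => h.trans h1.le⟩
    by_contra h'
    exact hF (j, c') ⟨not_le.1 h', h.trans_lt h2⟩
  have hrem : downloaded R x s i p' < R.k i :=
    lt_completion_iff.1 (hp' ▸ hs.lt_completion i c hne)
  have hpa' : ∀ j, q ≤ j → j < N → p < R.a j := fun j hj hjN =>
    (hpp'.trans hp't).trans_le (ha' j hj hjN)
  -- All threads are busy just after `p`, and without a download none is released before `p'`. A
  -- start at `p'` would therefore occupy more than L threads.
  have hbusy := sum_svcAfter_eq_of_pos hs hd hq ha hpa' hS hiq (by rw [rem, ← hdl]; omega)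
  have hsub : ∀ j, ((Finset.range (R.n j)).filter fun c => s (j, c) ≤ p ∧
      (p : ℝ≥0∞) < finish x s (j, c) ∧ downloaded R x s j p < R.k j) ⊆
      ((Finset.range (R.n j)).filter fun c => s (j, c) ≤ p' ∧
      (p' : ℝ≥0∞) < finish x s (j, c) ∧ downloaded R x s j p' < R.k j) := fun j c' hc' => by
    rw [Finset.mem_filter] at hc' ⊢
    refine ⟨hc'.1, hc'.2.1.trans h1.le, ?_, (hdl j).trans_lt hc'.2.2.2⟩
    by_contra h'
    exact hF (j, c') ⟨hc'.2.2.1, (not_lt.1 h').trans_lt h2⟩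
  have hlt : ∑ j ∈ Finset.range q, svcAfter R x s p j < ∑ j ∈ Finset.range q, svcAfter R x s p' j :=
    Finset.sum_lt_sum (fun j _ => Finset.card_le_card (hsub j))
      ⟨i, Finset.mem_range.2 hiq, Finset.card_lt_card ⟨hsub i, fun h => by
        have hc : c ∈ (Finset.range (R.n i)).filter fun c => s (i, c) ≤ p' ∧
            (p' : ℝ≥0∞) < finish x s (i, c) ∧ downloaded R x s i p' < R.k i :=
          Finset.mem_filter.2
            ⟨Finset.mem_range.2 hin, hp'.ge, hp' ▸ start_lt_finish hx hne, hrem⟩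
        exact absurd (Finset.mem_filter.1 (h hc)).2.1 (not_le.2 (hp' ▸ h1))⟩⟩
  have := sum_svcAfter_le hs (t := p') hq
  omega

/-- The left limit state satisfies the capacity constraint. -/
lemma sum_svcLeft_le (hs : Feasible R N x s L) (hq : q ≤ N) {t : ℝ≥0} (ht : 0 < t) :
    ∑ i ∈ Finset.range q, svcLeft R x s t i ≤ L := by
  classical
  -- The capacity constraint holds at `p`, the last start or finish before `t` (or 0 if there is
  -- none), and nothing changes between `p` and `t`.
  let A : Finset ℝ≥0∞ := (Finset.range q).biUnion fun i => (Finset.range (R.n i)).biUnion fun c =>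
    {s (i, c), finish x s (i, c)}
  obtain ⟨p, hpt, hp⟩ : ∃ p : ℝ≥0, p < t ∧ ∀ y ∈ A, y < t → y ≤ p := by
    rcases (A.filter (· < (t : ℝ≥0∞))).eq_empty_or_nonempty with h | h
    · refine ⟨0, ht, fun y hy hyt => ?_⟩
      exact absurd hyt (Finset.filter_eq_empty_iff.1 h hy)
    · obtain ⟨y, hy, hmax⟩ := Finset.exists_max_image _ id h
      have hyt := (Finset.mem_filter.1 hy).2
      lift y to ℝ≥0 using ne_top_of_lt hyt
      exact ⟨y, by exact_mod_cast hyt, fun z hz hzt => hmax z (Finset.mem_filter.2 ⟨hz, hzt⟩)⟩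
  have hpt' : (p : ℝ≥0∞) < t := by exact_mod_cast hpt
  refine le_trans (Finset.sum_le_sum fun i hi => ?_) (sum_svcAfter_le hs (t := p) hq)
  have hAs : ∀ c ∈ Finset.range (R.n i), s (i, c) ∈ A ∧ finish x s (i, c) ∈ A := fun c hc => by
    simp only [A, Finset.mem_biUnion, Finset.mem_insert, Finset.mem_singleton]
    exact ⟨⟨i, hi, c, hc, Or.inl rfl⟩, ⟨i, hi, c, hc, Or.inr rfl⟩⟩
  have hdl : downloadedLt R x s t i = downloaded R x s i p := by
    rw [downloadedLt, downloaded]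
    congr 1
    exact Finset.filter_congr fun c hc => ⟨fun h => hp _ (hAs c hc).2 h, fun h => h.trans_lt hpt'⟩
  rw [svcLeft, svcAfter, hdl]
  refine Finset.card_le_card fun c hc => ?_
  rw [Finset.mem_filter] at hc ⊢
  exact ⟨hc.1, hp _ (hAs c hc.1).1 hc.2.1, hpt'.trans_le hc.2.2.1, hc.2.2.2⟩

lemma state_eq_of_forall_ne {τ : ℝ≥0∞} {i : ℕ} (h : ∀ c < R.n i, finish x s (i, c) ≠ τ) :
    rem R x s τ i = remLeft R x s τ i ∧ svc R x s τ i = svcLeft R x s τ i := by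
  have hdl : downloadedLt R x s τ i = downloaded R x s i τ := by
    rw [downloadedLt, downloaded]
    congr 1
    exact Finset.filter_congr fun c hc =>
      ⟨le_of_lt, fun h' => lt_of_le_of_ne h' (h c (Finset.mem_range.1 hc))⟩
  refine ⟨by rw [rem, remLeft, hdl], ?_⟩
  rw [svc, svcLeft, hdl]
  congr 1
  refine Finset.filter_congr fun c hc => and_congr_right fun _ => and_congr_left fun _ =>
    ⟨le_of_lt, fun h' => lt_of_le_of_ne h' (h c (Finset.mem_range.1 hc)).symm⟩

/-- The change of the state when chunk `(i, c)` is downloaded at time `τ`. -/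
lemma state_download (hx : ∀ c, 0 < x c) {i c : ℕ} (hc : c < R.n i) (hne : s (i, c) ≠ ∞)
    {τ : ℝ≥0∞} (hτ : finish x s (i, c) = τ)
    (hu : ∀ c' < R.n i, c' ≠ c → finish x s (i, c') ≠ τ) (hk : downloadedLt R x s τ i < R.k i) :
    0 < remLeft R x s τ i ∧ 0 < svcLeft R x s τ i ∧ rem R x s τ i = remLeft R x s τ i - 1 ∧
      svc R x s τ i = if remLeft R x s τ i = 1 then 0 else svcLeft R x s τ i - 1 := by
  classical
  have hcr := Finset.mem_range.2 hc
  have hdl : downloaded R x s i τ = downloadedLt R x s τ i + 1 := by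
    rw [downloadedLt, downloaded, ← Finset.card_insert_of_notMem (a := c) (by simp [hτ])]
    congr 1
    ext c'
    simp only [Finset.mem_filter, Finset.mem_insert]
    refine ⟨fun h => ?_, ?_⟩
    · rcases eq_or_ne c' c with rfl | hcc
      · exact Or.inl rfl
      · exact Or.inr ⟨h.1, lt_of_le_of_ne h.2 (hu c' (Finset.mem_range.1 h.1) hcc)⟩
    · rintro (rfl | h)
      · exact ⟨hcr, hτ.le⟩
      · exact ⟨h.1, h.2.le⟩
  have hmem : c ∈ (Finset.range (R.n i)).filter fun c =>
      s (i, c) < τ ∧ τ ≤ finish x s (i, c) ∧ downloadedLt R x s τ i < R.k i :=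
    Finset.mem_filter.2 ⟨hcr, hτ ▸ start_lt_finish hx hne, hτ.ge, hk⟩
  refine ⟨by rw [remLeft]; omega, Finset.card_pos.2 ⟨c, hmem⟩, by rw [rem, remLeft, hdl]; omega, ?_⟩
  split_ifs with h1
  · rw [svc, Finset.card_eq_zero, Finset.filter_eq_empty_iff]
    rintro c' - ⟨-, -, h⟩
    rw [remLeft] at h1
    omega
  · rw [svc, svcLeft, ← Finset.card_erase_of_mem hmem]
    congr 1
    ext c'
    rw [remLeft] at h1
    simp only [Finset.mem_filter, Finset.mem_erase, ne_eq]
    refine ⟨fun h => ⟨?_, h.1, h.2.1, h.2.2.1.le, hk⟩,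
      fun h => ⟨h.2.1, h.2.2.1, lt_of_le_of_ne h.2.2.2.1 ?_, by omega⟩⟩
    · rintro rfl
      exact absurd h.2.2.1 (by rw [hτ]; exact lt_irrefl _)
    · exact (hu c' (Finset.mem_range.1 h.2.1) h.1).symm

/-- `finish` is also defined for a chunk that is terminated by the completion of its request. Such
nominal finish times must not change the state. -/
lemma state_of_completed {i : ℕ} {τ : ℝ≥0∞} (hk : R.k i ≤ downloadedLt R x s τ i) :
    rem R x s τ i = remLeft R x s τ i ∧ svc R x s τ i = svcLeft R x s τ i := by
  have h := downloadedLt_le (R := R) (x := x) (s := s) i τ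
  refine ⟨by rw [rem, remLeft]; omega, ?_⟩
  rw [svc, svcLeft, Finset.filter_false_of_mem, Finset.filter_false_of_mem]
  · rintro c - ⟨-, -, h'⟩; omega
  · rintro c - ⟨-, -, h'⟩; omega

end PathLemmas

end

section

/-! ### Exponential downloading times -/

section Exponential

lemma lintegral_expMeasure (μ : ℝ) {f : ℝ → ℝ≥0∞} (hf : Measurable f) :
    ∫⁻ z, f z ∂expMeasure μ =
      ∫⁻ z in Set.Ioi 0, ENNReal.ofReal (μ * Real.exp (-(μ * z))) * f z := by
  have hm : Measurable (exponentialPDF μ) := (measurable_exponentialPDFReal μ).ennreal_ofReal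
  have e : expMeasure μ = volume.withDensity (exponentialPDF μ) := rfl
  rw [e, lintegral_withDensity_eq_lintegral_mul _ hm hf,
    ← lintegral_add_compl _ (measurableSet_Ioi (a := (0 : ℝ)))]
  have h0 : ∫⁻ z in (Set.Ioi (0 : ℝ))ᶜ, (exponentialPDF μ * f) z = 0 := by
    rw [Set.compl_Ioi, setLIntegral_congr Iio_ae_eq_Iic.symm]
    rw [setLIntegral_congr_fun measurableSet_Iio (g := fun _ => 0), lintegral_zero]
    intro z hz
    simp [exponentialPDF_of_neg hz]
  rw [h0, add_zero]
  refine setLIntegral_congr_fun measurableSet_Ioi fun z hz => ?_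
  simp [exponentialPDF_of_nonneg (le_of_lt hz)]

lemma lintegral_exp_tail {μ : ℝ} (hμ : 0 < μ) (z : ℝ) :
    ∫⁻ y in Set.Ioi z, ENNReal.ofReal (μ * Real.exp (-(μ * y))) =
      ENNReal.ofReal (Real.exp (-(μ * z))) := by
  have e : ∀ y, μ * Real.exp (-(μ * y)) = μ * Real.exp (-μ * y) := fun y => by rw [neg_mul]
  simp only [e]
  rw [← ofReal_integral_eq_lintegral_ofReal]
  · congr 1
    rw [integral_const_mul, integral_exp_mul_Ioi (neg_neg_of_pos hμ)]
    field_simp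
  · exact (integrableOn_exp_mul_Ioi (neg_neg_of_pos hμ) z).const_mul μ
  · exact Eventually.of_forall fun y => by positivity

lemma expMeasure_Iic_zero (μ : ℝ) : expMeasure μ (Set.Iic 0) = 0 := by
  rw [← lintegral_indicator_one measurableSet_Iic,
    lintegral_expMeasure μ (measurable_one.indicator measurableSet_Iic)]
  rw [setLIntegral_congr_fun measurableSet_Ioi (g := fun _ => 0), lintegral_zero]
  intro z hz
  simp only [Set.mem_Ioi] at hz
  simp [hz]

lemma ae_pos_expMeasure (μ : ℝ) : ∀ᵐ z ∂expMeasure μ, 0 < z := by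
  rw [ae_iff]
  simpa [Set.Iic] using expMeasure_Iic_zero μ

lemma expMeasure_subsingleton (μ : ℝ) {A : Set ℝ} (hA : A.Subsingleton) : expMeasure μ A = 0 := by
  have e : expMeasure μ = volume.withDensity (exponentialPDF μ) := rfl
  rw [e]
  exact withDensity_absolutelyContinuous _ _ (hA.measure_zero volume)

end Exponential

/-! ### Redrawing one downloading time -/

section Resampling

variable {𝒰 : Type*} [MeasurableSpace 𝒰]

/-- Under `Q`, every downloading time is exponential and independent of all the rest. -/
def Resample (μ : ℝ) (Q : Measure (𝒰 × (Chunk → ℝ))) : Prop :=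
  ∀ (c : Chunk) (F : 𝒰 × (Chunk → ℝ) → ℝ≥0∞), Measurable F →
    ∫⁻ p, F p ∂Q = ∫⁻ p, ∫⁻ z, F (p.1, Function.update p.2 c z) ∂expMeasure μ ∂Q

lemma measurable_resample (c : Chunk) :
    Measurable fun y : (𝒰 × (Chunk → ℝ)) × ℝ => (y.1.1, Function.update y.1.2 c y.2) := by
  refine measurable_fst.fst.prodMk ?_
  refine measurable_pi_lambda _ fun c' => ?_
  by_cases h : c' = c
  · subst h; simpa using measurable_snd
  · simp only [Function.update_of_ne h]; fun_prop

lemma resample_map {Ω : Type*} [MeasurableSpace Ω] (P : Measure Ω) [IsProbabilityMeasure P]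
    {μ : ℝ} (hμ : 0 < μ) {X : Chunk → Ω → ℝ} (hX : ∀ c, Measurable (X c)) (hXindep : iIndepFun X P)
    (hXexp : ∀ c, P.map (X c) = expMeasure μ) {U : Ω → 𝒰} (hU : Measurable U)
    (hUindep : IndepFun U (fun ω c => X c ω) P) :
    Resample μ (P.map fun ω => (U ω, fun c => X c ω)) := by
  intro c F hF
  have hX' : Measurable fun ω c => X c ω := measurable_pi_lambda _ hX
  have := isProbabilityMeasure_expMeasure hμ
  have hFm : Measurable fun y : (𝒰 × (Chunk → ℝ)) × ℝ =>
      F (y.1.1, Function.update y.1.2 c y.2) := hF.comp (measurable_resample c)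
  have hG : Measurable fun p : 𝒰 × (Chunk → ℝ) =>
      ∫⁻ z, F (p.1, Function.update p.2 c z) ∂expMeasure μ := hFm.lintegral_prod_right'
  have key : ∀ f : (Chunk → ℝ) → ℝ≥0∞, Measurable f →
      ∫⁻ ω, f (fun c => X c ω) ∂P =
        ∫⁻ ω, ∫⁻ z, f (Function.update (fun c => X c ω) c z) ∂expMeasure μ ∂P := by
    intro f hf
    -- Freezing coordinate `c` gives a function of the other coordinates, hence independent of `X
    -- c`.
    set X' : Ω → Chunk → ℝ := fun ω => Function.update (fun c => X c ω) c 0 with hX'_def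
    have hind : IndepFun X' (X c) P := by
      have h1 := indep_iSup_of_disjoint (fun i => (hX i).comap_le) hXindep
        (S := {c}ᶜ) (T := {c}) disjoint_compl_left
      refine indep_of_indep_of_le_right (indep_of_indep_of_le_left h1 ?_) ?_
      · rw [← measurable_iff_comap_le]
        refine (@measurable_pi_iff Ω Chunk (fun _ => ℝ) (_) _ X').2 fun c' => ?_
        by_cases h : c' = c
        · subst h
          simp only [hX'_def, Function.update_self]
          exact measurable_const
        · simp only [hX'_def, Function.update_of_ne h]
          refine Measurable.mono (comap_measurable (X c')) ?_ le_rfl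
          exact le_iSup₂_of_le c' h le_rfl
      · exact le_iSup₂_of_le c rfl le_rfl
    have hX'm : Measurable X' := measurable_pi_lambda _ fun c' => by
      by_cases h : c' = c
      · subst h; simp [hX'_def]
      · simp only [hX'_def, Function.update_of_ne h]; exact hX c'
    have hup : Measurable fun y : (Chunk → ℝ) × ℝ => f (Function.update y.1 c y.2) := by
      refine hf.comp (measurable_pi_lambda _ fun c' => ?_)
      by_cases h : c' = c
      · subst h; simpa using measurable_snd
      · simp only [Function.update_of_ne h]; fun_prop
    calc ∫⁻ ω, f (fun c => X c ω) ∂P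
        = ∫⁻ ω, f (Function.update (X' ω) c (X c ω)) ∂P := by
          simp [hX'_def]
      _ = ∫⁻ y, f (Function.update y.1 c y.2) ∂(P.map fun ω => (X' ω, X c ω)) := by
          rw [lintegral_map hup (hX'm.prodMk (hX c))]
      _ = ∫⁻ y, ∫⁻ z, f (Function.update y c z) ∂expMeasure μ ∂P.map X' := by
          rw [hind.map_prod_eq_prod_map_map hX'm.aemeasurable (hX c).aemeasurable, hXexp,
            lintegral_prod _ hup.aemeasurable]
      _ = _ := by
          rw [lintegral_map (hup.lintegral_prod_right') hX'm]
          simp [hX'_def]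
  rw [hUindep.map_prod_eq_prod_map_map hU.aemeasurable hX'.aemeasurable]
  have := Measure.isProbabilityMeasure_map (μ := P) hU.aemeasurable
  have := Measure.isProbabilityMeasure_map (μ := P) hX'.aemeasurable
  rw [lintegral_prod _ hF.aemeasurable, lintegral_prod _ hG.aemeasurable]
  refine lintegral_congr fun u => ?_
  have h1 := lintegral_map (μ := P) (hF.comp (measurable_prodMk_left (x := u))) hX'
  have h2 := lintegral_map (μ := P) (hG.comp (measurable_prodMk_left (x := u))) hX'
  refine h1.trans (Eq.trans ?_ h2.symm)
  exact key _ (hF.comp measurable_prodMk_left)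

variable {μ : ℝ} {Q : Measure (𝒰 × (Chunk → ℝ))}

lemma Resample.ae_of_forall (hQ : Resample μ Q) (c : Chunk) {A : Set (𝒰 × (Chunk → ℝ))}
    (hA : MeasurableSet A)
    (h : ∀ᵐ p ∂Q, ∀ᵐ z ∂expMeasure μ, (p.1, Function.update p.2 c z) ∈ A) : ∀ᵐ p ∂Q, p ∈ A := by
  have h1 := hQ c (Aᶜ.indicator 1) (measurable_one.indicator hA.compl)
  rw [lintegral_indicator_one hA.compl] at h1
  rw [ae_iff]
  change Q Aᶜ = 0
  rw [h1]
  rw [lintegral_congr_ae (g := fun _ => 0), lintegral_zero]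
  filter_upwards [h] with p hp
  rw [lintegral_congr_ae (g := fun _ => 0), lintegral_zero]
  filter_upwards [hp] with z hz
  simp [hz]

lemma Resample.ae_pos (hQ : Resample μ Q) : ∀ᵐ p ∂Q, ∀ c, 0 < p.2 c := by
  rw [ae_all_iff]
  intro c
  refine hQ.ae_of_forall c (A := {p | 0 < p.2 c}) (measurableSet_lt (by fun_prop) (by fun_prop)) ?_
  refine Eventually.of_forall fun p => ?_
  filter_upwards [ae_pos_expMeasure μ] with z hz
  simpa using hz

end Resampling

/-! ### Consequences of being online -/

section Online

variable {𝒰 : Type*} [MeasurableSpace 𝒰]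

/-- The schedules of an online policy for a fixed system. -/
structure OnlineSchedule (R : RequestSeq) (N L : ℕ) (S : 𝒰 × (Chunk → ℝ) → Schedule) : Prop where
  measurable : ∀ c, Measurable fun p => S p c
  feasible : ∀ u x, (∀ c, 0 < x c) → Feasible R N x (S (u, x)) L
  online : ∀ u x x' (t : ℝ≥0), (∀ c, 0 < x c) → (∀ c, 0 < x' c) →
    SameObservations R x (S (u, x)) x' t →
    ∀ c, S (u, x) c ≤ t ∨ S (u, x') c ≤ t → S (u, x) c = S (u, x') c

lemma _root_.Policy.onlineSchedule {L : ℕ} (π : Policy L 𝒰) (R : RequestSeq) (N : ℕ) :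
    OnlineSchedule R N L fun p => π.start R N p.1 p.2 where
  measurable c := π.measurable_start R N c
  feasible u x hx := π.feasible R N u x hx
  online u x x' t hx hx' h := π.online R N R N u x x' t hx hx'
    (fun _ => ⟨Iff.rfl, fun _ => ⟨rfl, rfl, rfl⟩⟩) h

variable {R : RequestSeq} {N L : ℕ} {S : 𝒰 × (Chunk → ℝ) → Schedule} (hS : OnlineSchedule R N L S)

/-- Before time `t`, the same happens for the downloading times `x` and `x'`. -/
def SameBefore (S : 𝒰 × (Chunk → ℝ) → Schedule) (u : 𝒰) (x x' : Chunk → ℝ) (t : ℝ≥0∞) : Prop :=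
  ∀ c, (S (u, x) c < t ↔ S (u, x') c < t) ∧
    (finish x (S (u, x)) c < t ↔ finish x' (S (u, x')) c < t)

include hS

/-- Only the time of `c` differs, and as `c` is not downloaded before `t` in either case, no
observation before `t` reveals the difference. -/
lemma start_eq_of_update {u : 𝒰} {x x' : Chunk → ℝ} (hx : ∀ c, 0 < x c) (hx' : ∀ c, 0 < x' c)
    {c : Chunk} (hxx : ∀ c', c' ≠ c → x' c' = x c') {t : ℝ≥0} (h1 : t ≤ finish x (S (u, x)) c)
    (h2 : t ≤ S (u, x) c + ENNReal.ofReal (x' c)) {c' : Chunk}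
    (hc' : S (u, x) c' < t ∨ S (u, x') c' < t) : S (u, x) c' = S (u, x') c' := by
  obtain ⟨τ, hτ, hτc⟩ : ∃ τ : ℝ≥0, τ < t ∧ (S (u, x) c' ≤ τ ∨ S (u, x') c' ≤ τ) := by
    rcases hc' with h | h
    · exact ⟨(S (u, x) c').toNNReal, by
        rwa [← ENNReal.coe_lt_coe, ENNReal.coe_toNNReal (ne_top_of_lt h)],
        Or.inl (by rw [ENNReal.coe_toNNReal (ne_top_of_lt h)])⟩
    · exact ⟨(S (u, x') c').toNNReal, by
        rwa [← ENNReal.coe_lt_coe, ENNReal.coe_toNNReal (ne_top_of_lt h)],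
        Or.inr (by rw [ENNReal.coe_toNNReal (ne_top_of_lt h)])⟩
  have hτ' : (τ : ℝ≥0∞) < t := by exact_mod_cast hτ
  refine hS.online u x x' τ hx hx' (fun i d _ => ?_) c' hτc
  by_cases hd : (i, d) = c
  · rw [hd]
    refine ⟨fun h => absurd (h.trans (min_le_left _ _)) (not_le.2 (hτ'.trans_le h1)), fun _ => ?_⟩
    exact ((min_le_left _ _).trans_lt hτ').trans_le h2
  · refine ⟨fun _ => hxx _ hd, fun h => ?_⟩
    rwa [finish, hxx _ hd]

lemma sameBefore_of_update {u : 𝒰} {x x' : Chunk → ℝ} (hx : ∀ c, 0 < x c) (hx' : ∀ c, 0 < x' c)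
    {c : Chunk} (hxx : ∀ c', c' ≠ c → x' c' = x c') {t : ℝ≥0} (h0 : S (u, x) c < t)
    (h1 : t ≤ finish x (S (u, x)) c) (h2 : t ≤ S (u, x) c + ENNReal.ofReal (x' c)) :
    SameBefore S u x x' t := by
  intro c'
  by_cases hc' : S (u, x) c' < t ∨ S (u, x') c' < t
  · have he := start_eq_of_update hS hx hx' hxx h1 h2 hc'
    rw [← he]
    refine ⟨Iff.rfl, ?_⟩
    by_cases hcc : c' = c
    · subst hcc
      rw [finish, finish, ← he]
      exact iff_of_false (not_lt.2 h1) (not_lt.2 h2)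
    · rw [finish, finish, ← he, hxx _ hcc]
  · push Not at hc'
    exact ⟨iff_of_false (not_lt.2 hc'.1) (not_lt.2 hc'.2),
      iff_of_false (not_lt.2 (hc'.1.trans (start_le_finish _)))
        (not_lt.2 (hc'.2.trans (start_le_finish _)))⟩

/-- A chunk's own downloading time cannot influence its start. -/
lemma start_update_eq {u : 𝒰} {x x' : Chunk → ℝ} (hx : ∀ c, 0 < x c) (hx' : ∀ c, 0 < x' c)
    {c : Chunk} (hxx : ∀ c', c' ≠ c → x' c' = x c') : S (u, x) c = S (u, x') c := by
  have key : ∀ x x' : Chunk → ℝ, (∀ c, 0 < x c) → (∀ c, 0 < x' c) →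
      (∀ c', c' ≠ c → x' c' = x c') → S (u, x) c ≠ ∞ → S (u, x) c = S (u, x') c := by
    intro x x' hx hx' hxx hne
    have hm : 0 < min (x c) (x' c) := lt_min (hx c) (hx' c)
    -- This time is after the start of `c`, but not after the end of its download under either
    -- value.
    set t : ℝ≥0 := (S (u, x) c).toNNReal + (min (x c) (x' c)).toNNReal with ht
    have ht' : (t : ℝ≥0∞) = S (u, x) c + ENNReal.ofReal (min (x c) (x' c)) := by
      rw [ht, ENNReal.coe_add, ENNReal.coe_toNNReal hne]; rfl
    refine start_eq_of_update hS hx hx' hxx (t := t) ?_ ?_ (Or.inl ?_)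
    · rw [ht', finish]
      gcongr
      exact min_le_left _ _
    · rw [ht']
      gcongr
      exact min_le_right _ _
    · rw [ht']
      exact ENNReal.lt_add_right hne (by simpa using hm)
  by_cases h : S (u, x) c = ∞
  · by_cases h' : S (u, x') c = ∞
    · rw [h, h']
    · exact (key x' x hx' hx (fun c' hc' => (hxx c' hc').symm) h').symm
  · exact key x x' hx hx' hxx h

end Online

/-! ### The compensator formula and the absence of ties -/

section Compensator

variable {𝒰 : Type*} [MeasurableSpace 𝒰] {R : RequestSeq} {N L : ℕ}
  {S : 𝒰 × (Chunk → ℝ) → Schedule}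

/-- What `G` says about time `t` depends only on what happens before `t`. -/
def Predictable {β : Type*} (S : 𝒰 × (Chunk → ℝ) → Schedule)
    (G : (𝒰 × (Chunk → ℝ)) × ℝ → β) : Prop :=
  ∀ u x x' t, SameBefore S u x x' (ENNReal.ofReal t) → G ((u, x), t) = G ((u, x'), t)

lemma measurable_finish (hS : OnlineSchedule R N L S) (c : Chunk) :
    Measurable fun p : 𝒰 × (Chunk → ℝ) => finish p.2 (S p) c :=
  (hS.measurable c).add
    (ENNReal.measurable_ofReal.comp ((measurable_pi_apply c).comp measurable_snd))

/-- The compensator formula: a chunk is downloaded at rate `μ` while it is under service. -/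
lemma lintegral_finish (hS : OnlineSchedule R N L S) {μ : ℝ} (hμ : 0 < μ)
    {Q : Measure (𝒰 × (Chunk → ℝ))} (hQ : Resample μ Q) (c : Chunk)
    {G : (𝒰 × (Chunk → ℝ)) × ℝ → ℝ≥0∞} (hG : Measurable G) (hGp : Predictable S G) :
    ∫⁻ p, (if S p c ≠ ∞ then G (p, (finish p.2 (S p) c).toReal) else 0) ∂Q =
      ENNReal.ofReal μ * ∫⁻ p, (∫⁻ t in Set.Ioi (0 : ℝ),
        if S p c < ENNReal.ofReal t ∧ ENNReal.ofReal t ≤ finish p.2 (S p) c then G (p, t) else 0)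
        ∂Q := by
  have hfin := measurable_finish hS c
  have hm1 : Measurable fun p => if S p c ≠ ∞ then G (p, (finish p.2 (S p) c).toReal) else 0 :=
    Measurable.ite ((hS.measurable c) (measurableSet_singleton _).compl)
      (hG.comp (measurable_id.prodMk hfin.ennreal_toReal)) measurable_const
  have hm2 : Measurable fun y : (𝒰 × (Chunk → ℝ)) × ℝ =>
      if S y.1 c < ENNReal.ofReal y.2 ∧ ENNReal.ofReal y.2 ≤ finish y.1.2 (S y.1) c
        then G (y.1, y.2) else 0 :=
    Measurable.ite ((measurableSet_lt ((hS.measurable c).comp measurable_fst)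
      (ENNReal.measurable_ofReal.comp measurable_snd)).inter
      (measurableSet_le (ENNReal.measurable_ofReal.comp measurable_snd)
      (hfin.comp measurable_fst))) hG measurable_const
  have hm2' := hm2.lintegral_prod_right' (ν := volume.restrict (Set.Ioi 0))
  -- The time z of `c` is redrawn on both sides; it then suffices to compare the integrals over z
  -- with all else fixed.
  rw [hQ c _ hm1, hQ c _ hm2', ← lintegral_const_mul']
  swap; · exact ENNReal.ofReal_ne_top
  refine lintegral_congr_ae ?_
  filter_upwards [hQ.ae_pos] with p hp
  obtain ⟨u, x⟩ := p
  have hup : Measurable fun z : ℝ => (u, Function.update x c z) :=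
    (measurable_resample (𝒰 := 𝒰) c).comp (measurable_prodMk_left (x := (u, x)))
  have hpos : ∀ z, 0 < z → ∀ c', 0 < Function.update x c z c' := fun z hz c' => by
    by_cases h : c' = c
    · subst h; simpa using hz
    · simpa [h] using hp c'
  have hst : ∀ z, 0 < z → S (u, Function.update x c z) c = S (u, x) c := fun z hz =>
    (start_update_eq hS hp (hpos z hz) fun c' hc' => by simp [hc']).symm
  refine (lintegral_expMeasure μ (hm1.comp hup)).trans (Eq.trans ?_
    (congrArg (ENNReal.ofReal μ * ·) (lintegral_expMeasure μ (hm2'.comp hup)).symm))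
  simp only [Function.comp_apply]
  by_cases htop : S (u, x) c = ∞
  · rw [setLIntegral_congr_fun measurableSet_Ioi (g := fun _ => 0), lintegral_zero]
    · rw [setLIntegral_congr_fun measurableSet_Ioi (g := fun _ => 0), lintegral_zero, mul_zero]
      intro z hz
      simp [hst z hz, htop]
    · intro z hz
      simp [hst z hz, htop]
  · set σ := (S (u, x) c).toReal with hσ
    have hσ0 : 0 ≤ σ := ENNReal.toReal_nonneg
    have hSσ : S (u, x) c = ENNReal.ofReal σ := (ENNReal.ofReal_toReal htop).symm
    -- With start σ, the left side integrates g(z) against the exponential density, and the right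
    -- side integrates the integral of g over (0, z].
    set g : ℝ → ℝ≥0∞ := fun z => G ((u, Function.update x c z), σ + z) with hg
    have hgm : Measurable g := hG.comp (hup.prodMk (measurable_id.const_add σ))
    have hL : ∀ z ∈ Set.Ioi (0 : ℝ), ENNReal.ofReal (μ * Real.exp (-(μ * z))) *
        (if S (u, Function.update x c z) c ≠ ∞ then G ((u, Function.update x c z),
          (finish (Function.update x c z) (S (u, Function.update x c z)) c).toReal) else 0) =
        ENNReal.ofReal (μ * Real.exp (-(μ * z))) * g z := by
      intro z hz
      have hz : 0 < z := hz
      rw [hst z hz, if_pos htop, finish, hst z hz, Function.update_self, hSσ,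
        ← ENNReal.ofReal_add hσ0 hz.le, ENNReal.toReal_ofReal (by positivity)]
    have hRin : ∀ z ∈ Set.Ioi (0 : ℝ), ENNReal.ofReal (μ * Real.exp (-(μ * z))) *
        (∫⁻ t in Set.Ioi (0 : ℝ), if S (u, Function.update x c z) c < ENNReal.ofReal t ∧
          ENNReal.ofReal t ≤ finish (Function.update x c z) (S (u, Function.update x c z)) c
          then G ((u, Function.update x c z), t) else 0) =
        ∫⁻ y, ENNReal.ofReal (μ * Real.exp (-(μ * z))) * (Set.Ioc 0 z).indicator g y := by
      intro z hz
      have hz : 0 < z := hz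
      rw [lintegral_const_mul' _ _ ENNReal.ofReal_ne_top]
      congr 1
      rw [← lintegral_sub_right_eq_self (fun y => (Set.Ioc 0 z).indicator g y) σ, ← lintegral_indicator measurableSet_Ioi]
      refine lintegral_congr fun t => ?_
      rw [hst z hz, finish, hst z hz, Function.update_self, hSσ, ← ENNReal.ofReal_add hσ0 hz.le]
      by_cases ht : σ < t ∧ t ≤ σ + z
      · have ht0 : 0 < t := hσ0.trans_lt ht.1
        rw [Set.indicator_of_mem (by exact ht0), if_pos
          ⟨(ENNReal.ofReal_lt_ofReal_iff ht0).2 ht.1, ENNReal.ofReal_le_ofReal ht.2⟩,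
          Set.indicator_of_mem (by constructor <;> linarith [ht.1, ht.2])]
        simp only [hg, add_sub_cancel]
        have hts : 0 < t - σ := by linarith [ht.1]
        -- At t ≤ σ + z the chunk has not been downloaded before `t`, so by predictability z may be
        -- replaced by t - σ.
        refine hGp u _ _ t (sameBefore_of_update hS (c := c) (t := t.toNNReal) (hpos z hz)
          (hpos _ hts) (fun c' hc' => by simp [hc']) ?_ ?_ ?_)
        · rw [hst z hz, hSσ]; exact (ENNReal.ofReal_lt_ofReal_iff ht0).2 ht.1
        · rw [finish, hst z hz, hSσ, Function.update_self, ← ENNReal.ofReal_add hσ0 hz.le]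
          exact ENNReal.ofReal_le_ofReal ht.2
        · rw [hst z hz, hSσ, Function.update_self, ← ENNReal.ofReal_add hσ0 hts.le]
          exact ENNReal.ofReal_le_ofReal (by linarith)
      · rw [Set.indicator_of_notMem (s := Set.Ioc 0 z) fun h => ht ⟨by linarith [h.1], by
          linarith [h.2]⟩]
        by_cases ht0 : 0 < t
        · rw [Set.indicator_of_mem (by exact ht0), if_neg]
          rintro ⟨h1, h2⟩
          exact ht ⟨(ENNReal.ofReal_lt_ofReal_iff ht0).1 h1,
            (ENNReal.ofReal_le_ofReal_iff (by positivity)).1 h2⟩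
        · exact Set.indicator_of_notMem (by exact ht0) _
    rw [setLIntegral_congr_fun measurableSet_Ioi hL, setLIntegral_congr_fun measurableSet_Ioi hRin]
    have hjm : Measurable fun y : ℝ × ℝ =>
        ENNReal.ofReal (μ * Real.exp (-(μ * y.1))) * (Set.Ioc 0 y.1).indicator g y.2 := by
      refine Measurable.mul (by fun_prop) ?_
      have : (fun y : ℝ × ℝ => (Set.Ioc 0 y.1).indicator g y.2) =
          fun y => if 0 < y.2 ∧ y.2 ≤ y.1 then g y.2 else 0 := by
        ext y; simp [Set.indicator]
      rw [this]
      exact Measurable.ite ((measurableSet_lt measurable_const measurable_snd).inter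
        (measurableSet_le measurable_snd measurable_fst)) (hgm.comp measurable_snd) measurable_const
    -- After the exchange of integrals the density is integrated over z ≥ y. Its tail exp(-μ y),
    -- times μ, is the density again.
    rw [lintegral_lintegral_swap hjm.aemeasurable, ← lintegral_const_mul' _ _ ENNReal.ofReal_ne_top,
      ← lintegral_indicator measurableSet_Ioi]
    refine lintegral_congr fun y => ?_
    by_cases hy : 0 < y
    · rw [Set.indicator_of_mem (by exact hy)]
      have : ∫⁻ z in Set.Ioi (0 : ℝ), ENNReal.ofReal (μ * Real.exp (-(μ * z))) *
          (Set.Ioc 0 z).indicator g y =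
          ∫⁻ z in Set.Ioi y, ENNReal.ofReal (μ * Real.exp (-(μ * z))) * g y := by
        rw [← lintegral_indicator measurableSet_Ioi, setLIntegral_congr Ioi_ae_eq_Ici,
          ← lintegral_indicator measurableSet_Ici]
        refine lintegral_congr fun z => ?_
        by_cases hz : y ≤ z
        · rw [Set.indicator_of_mem (s := Set.Ioi 0) (by exact hy.trans_le hz),
            Set.indicator_of_mem (s := Set.Ici y) (by exact hz),
            Set.indicator_of_mem (s := Set.Ioc 0 z) (by exact ⟨hy, hz⟩)]
        · rw [Set.indicator_of_notMem (s := Set.Ici y) (by exact hz)]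
          simp only [Set.indicator, Set.mem_Ioi, Set.mem_Ioc, hz, and_false, if_false, mul_zero,
            ite_self]
      rw [this, lintegral_mul_const _ (by fun_prop), lintegral_exp_tail hμ, ← mul_assoc,
        ← ENNReal.ofReal_mul hμ.le]
    · rw [Set.indicator_of_notMem (by exact hy)]
      have : ∀ z, (Set.Ioc 0 z).indicator g y = 0 := fun z =>
        Set.indicator_of_notMem (fun h => hy h.1) _
      simp [this]

/-- Almost surely no two chunks are downloaded at the same time. -/
lemma ae_finish_ne (hS : OnlineSchedule R N L S) {μ : ℝ}
    {Q : Measure (𝒰 × (Chunk → ℝ))} (hQ : Resample μ Q) :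
    ∀ᵐ p ∂Q, ∀ c c', c ≠ c' → S p c ≠ ∞ → finish p.2 (S p) c ≠ finish p.2 (S p) c' := by
  rw [ae_all_iff]
  intro c
  rw [ae_all_iff]
  intro c'
  by_cases hcc : c = c'
  · simp [hcc]
  simp only [ne_eq, hcc, not_false_eq_true, true_imp_iff]
  have hms : MeasurableSet {p : 𝒰 × (Chunk → ℝ) |
      ¬S p c = ∞ → ¬finish p.2 (S p) c = finish p.2 (S p) c'} := by
    have h1 : MeasurableSet {p | S p c = ∞} := (hS.measurable c) (measurableSet_singleton _)
    have h2 := measurableSet_eq_fun (measurable_finish hS c) (measurable_finish hS c')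
    convert h1.union h2.compl using 1
    ext p
    simp only [Set.mem_ofPred_eq, Set.mem_union, Set.mem_compl_iff]
    tauto
  refine hQ.ae_of_forall c hms ?_
  filter_upwards [hQ.ae_pos] with p hp
  obtain ⟨u, x⟩ := p
  have hpos : ∀ z, 0 < z → ∀ c', 0 < Function.update x c z c' := fun z hz c' => by
    by_cases h : c' = c
    · subst h; simpa using hz
    · simpa [h] using hp c'
  set A : Set ℝ := {z | 0 < z ∧ S (u, Function.update x c z) c ≠ ∞ ∧
    finish (Function.update x c z) (S (u, Function.update x c z)) c =
      finish (Function.update x c z) (S (u, Function.update x c z)) c'} with hA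
  -- Suppose z < z' both give a tie. Chunk `c'` starts before the tie for z and so starts and
  -- finishes at the same times for z', whereas `c` finishes strictly later.
  have hsub : A.Subsingleton := by
    have key : ∀ z ∈ A, ∀ z' ∈ A, ¬z < z' := by
      rintro z ⟨hz, hzt, hze⟩ z' ⟨hz', -, hze'⟩ hlt
      have hxx : ∀ d, d ≠ c → Function.update x c z' d = Function.update x c z d :=
        fun d hd => by simp [hd]
      have hc := start_update_eq hS (u := u) (hpos z hz) (hpos z' hz') hxx
      have hft : finish (Function.update x c z) (S (u, Function.update x c z)) c ≠ ∞ := by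
        simp [finish, hzt]
      have hct : S (u, Function.update x c z) c' ≠ ∞ :=
        ne_top_of_le_ne_top (hze ▸ hft) (start_le_finish c')
      have ht : ((finish (Function.update x c z) (S (u, Function.update x c z)) c).toNNReal : ℝ≥0∞) =
        finish (Function.update x c z) (S (u, Function.update x c z)) c := ENNReal.coe_toNNReal hft
      have hlt' : finish (Function.update x c z) (S (u, Function.update x c z)) c <
          finish (Function.update x c z') (S (u, Function.update x c z')) c := by
        rw [finish, finish, ← hc, Function.update_self, Function.update_self]
        exact ENNReal.add_lt_add_left hzt ((ENNReal.ofReal_lt_ofReal_iff hz').2 hlt)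
      have hc' := start_eq_of_update hS (u := u) (hpos z hz) (hpos z' hz') hxx
        (t := (finish (Function.update x c z) (S (u, Function.update x c z)) c).toNNReal) (c' := c')
        ht.le (by
          rw [ht, hc]
          exact hlt'.le)
        (Or.inl (by rw [ht, hze]; exact start_lt_finish (hpos z hz) hct))
      rw [hze'] at hlt'
      refine absurd hlt' (not_lt.2 (le_of_eq ?_))
      rw [hze, finish, finish, ← hc', hxx c' (Ne.symm hcc)]
    exact fun z hz z' hz' => le_antisymm (not_lt.1 (key z' hz' z hz)) (not_lt.1 (key z hz z' hz'))
  have h0 := expMeasure_subsingleton μ hsub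
  filter_upwards [ae_pos_expMeasure μ, measure_eq_zero_iff_ae_notMem.1 h0] with z hz hzA hzt hze
  exact hzA ⟨hz, hzt, hze⟩

end Compensator

end

section

/-! ### Calculus along piecewise constant trajectories -/

section Jumps

variable {σ : Type*} {f f' : ℝ → σ → ℝ} {l r : ℝ → σ} {a : ℝ}

/-- The fundamental theorem of calculus along a piecewise constant trajectory, up to the left limit
at the endpoint; `l` gives the left limits of the trajectory `r`. -/
lemma integral_jumps_left {F : Finset ℝ} : ∀ {b : ℝ}, a < b → (∀ d ∈ F, a < d ∧ d < b) →
    (∀ p t, a ≤ p → p < t → t ≤ b → (∀ d ∈ F, ¬(p < d ∧ d < t)) → l t = r p) →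
    (∀ τ, a < τ → τ ≤ b → ∀ t, HasDerivAt (fun t => f t (l τ)) (f' t (l τ)) t) →
    (∀ τ, a < τ → τ ≤ b → Continuous fun t => f' t (l τ)) →
    IntervalIntegrable (fun t => f' t (l t)) volume a b ∧
      f b (l b) + ∑ d ∈ F, (f d (l d) - f d (r d)) = f a (r a) + ∫ t in a..b, f' t (l t) := by
  have base : ∀ {p b : ℝ}, p < b → (∀ t, p < t → t ≤ b → l t = r p) →
      (∀ τ, p < τ → τ ≤ b → ∀ t, HasDerivAt (fun t => f t (l τ)) (f' t (l τ)) t) →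
      (∀ τ, p < τ → τ ≤ b → Continuous fun t => f' t (l τ)) →
      IntervalIntegrable (fun t => f' t (l t)) volume p b ∧
        f b (l b) = f p (r p) + ∫ t in p..b, f' t (l t) := by
    intro p b hpb hl hd hc
    have hb := hl b hpb le_rfl
    have hd := hd b hpb le_rfl
    have hc := hc b hpb le_rfl
    rw [hb] at hd hc
    have hcongr : Set.EqOn (fun t => f' t (r p)) (fun t => f' t (l t)) (Set.uIoc p b) := by
      intro t ht
      rw [Set.uIoc_of_le hpb.le] at ht
      simp only [hl t ht.1 ht.2]
    refine ⟨(hc.intervalIntegrable p b).congr hcongr, ?_⟩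
    have hcongr' : ∫ t in p..b, f' t (l t) = ∫ t in p..b, f' t (r p) := by
      refine intervalIntegral.integral_congr_ae (Eventually.of_forall fun t ht => ?_)
      exact (hcongr ht).symm
    rw [hcongr', intervalIntegral.integral_eq_sub_of_hasDerivAt (fun t _ => hd t)
      (hc.intervalIntegrable p b), hb]
    ring
  -- The interval is split at the last jump; there are no jumps after it.
  induction F using Finset.induction_on_max with
  | empty =>
    intro b hab _ hl hd hc
    have := base hab (fun t h1 h2 => hl a t le_rfl h1 h2 (by simp)) hd hc
    simpa using this
  | insert m F hm ih =>
    intro b hab hF hl hd hc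
    obtain ⟨ham, hmb⟩ := hF m (Finset.mem_insert_self m F)
    have h1 := ih ham (fun d hd => ⟨(hF d (Finset.mem_insert_of_mem hd)).1, hm d hd⟩)
      (fun p t hp hpt ht hFt => hl p t hp hpt (ht.trans hmb.le) fun d hd => by
        rcases Finset.mem_insert.1 hd with rfl | hd
        · exact fun h => absurd h.2 (not_lt.2 ht)
        · exact hFt d hd)
      (fun τ h h' => hd τ h (h'.trans hmb.le)) (fun τ h h' => hc τ h (h'.trans hmb.le))
    have h2 := base hmb (fun t h h' => hl m t ham.le h h' fun d hd => by
        rcases Finset.mem_insert.1 hd with rfl | hd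
        · exact fun h => absurd h.1 (lt_irrefl _)
        · exact fun h => absurd h.1 (not_lt.2 (hm d hd).le))
      (fun τ h h' => hd τ (ham.trans h) h') (fun τ h h' => hc τ (ham.trans h) h')
    refine ⟨h1.1.trans h2.1, ?_⟩
    rw [Finset.sum_insert fun h => lt_irrefl _ (hm m h),
      ← intervalIntegral.integral_add_adjacent_intervals h1.1 h2.1, h2.2]
    linarith [h1.2]

/-- A jump at the endpoint `b` itself accounts for the difference between `r b` and its left limit.
-/
lemma integral_jumps {F : Finset ℝ} {b : ℝ} (hab : a ≤ b) (hF : ∀ d ∈ F, a < d ∧ d ≤ b)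
    (hl : ∀ p t, a ≤ p → p < t → t ≤ b → (∀ d ∈ F, ¬(p < d ∧ d < t)) → l t = r p)
    (hr : ∀ t, a < t → t ≤ b → t ∉ F → r t = l t)
    (hd : ∀ τ, a < τ → τ ≤ b → ∀ t, HasDerivAt (fun t => f t (l τ)) (f' t (l τ)) t)
    (hc : ∀ τ, a < τ → τ ≤ b → Continuous fun t => f' t (l τ)) :
    IntervalIntegrable (fun t => f' t (l t)) volume a b ∧
      f b (r b) + ∑ d ∈ F, (f d (l d) - f d (r d)) = f a (r a) + ∫ t in a..b, f' t (l t) := by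
  rcases hab.eq_or_lt with rfl | hab
  · have : F = ∅ := Finset.eq_empty_of_forall_notMem fun d hd =>
      absurd (hF d hd).1 (not_lt.2 (hF d hd).2)
    simp [this]
  · have h := integral_jumps_left (F := F.erase b) hab
      (fun d hd => ⟨(hF d (Finset.mem_of_mem_erase hd)).1,
        lt_of_le_of_ne (hF d (Finset.mem_of_mem_erase hd)).2 (Finset.ne_of_mem_erase hd)⟩)
      (fun p t hp hpt ht hFt => hl p t hp hpt ht fun d hd hh => hFt d
        (Finset.mem_erase.2 ⟨(hh.2.trans_le ht).ne, hd⟩) hh) hd hc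
    refine ⟨h.1, ?_⟩
    by_cases hb : b ∈ F
    · rw [← Finset.add_sum_erase _ _ hb]
      linarith [h.2]
    · rw [hr b hab le_rfl hb]
      rw [Finset.erase_eq_of_notMem hb] at h
      exact h.2

end Jumps

section PathIdentity

/-- During the interval `[a, b]`, the requests that have arrived are the first `q` requests. -/
structure Stage (R : RequestSeq) (N q : ℕ) (a b : ℝ) : Prop where
  le : q ≤ N
  nonneg : 0 ≤ a
  le' : a ≤ b
  arrived : ∀ j < q, (R.a j : ℝ) ≤ a
  not_arrived : ∀ j, q ≤ j → j < N → b ≤ R.a j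

variable {R : RequestSeq} {N L q : ℕ} {x : Chunk → ℝ} {s : Schedule} {a b : ℝ}

/-- Requests beyond the first `q` arrive no earlier than `b`, so none of their chunks finishes
before `t`. -/
lemma Stage.no_finish (h : Stage R N q a b) (hs : Feasible R N x s L) {p t : ℝ} (ht : t ≤ b)
    (hF : ∀ i < q, ∀ c < R.n i, s (i, c) ≠ ∞ →
      ¬(p < (finish x s (i, c)).toReal ∧ (finish x s (i, c)).toReal < t)) (hp : 0 ≤ p)
    (c : Chunk) : ¬(ENNReal.ofReal p < finish x s c ∧ finish x s c < ENNReal.ofReal t) := by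
  rintro ⟨h1, h2⟩
  obtain ⟨i, c⟩ := c
  have hne : finish x s (i, c) ≠ ∞ := ne_top_of_lt h2
  have hne' : s (i, c) ≠ ∞ := ne_top_of_le_ne_top hne (start_le_finish _)
  obtain ⟨hi, hc⟩ := hs.exists_of_start i c hne'
  have h1' : p < (finish x s (i, c)).toReal := (ENNReal.ofReal_lt_iff_lt_toReal hp hne).1 h1
  have h2' : (finish x s (i, c)).toReal < t :=
    (ENNReal.lt_ofReal_iff_toReal_lt hne).1 h2
  by_cases hiq : i < q
  · exact hF i hiq c hc hne' ⟨h1', h2'⟩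
  · have h3 := h.not_arrived i (not_lt.1 hiq) hi
    have h4 := (hs.arrival_le i c).trans (start_le_finish (x := x) (i, c))
    have h5 := ENNReal.toReal_mono hne h4
    rw [ENNReal.coe_toReal] at h5
    linarith

/-- The change of a function along a trajectory, as an integral minus the sum over the chunks that
are downloaded. -/
lemma path_identity {σ : Type*} {f f' : ℝ → σ → ℝ} {l r : ℝ → σ} (h : Stage R N q a b)
    (hties : ∀ c c', c ≠ c' → s c ≠ ∞ → finish x s c ≠ finish x s c')
    (hl : ∀ p t, a ≤ p → p < t → t ≤ b → (∀ i < q, ∀ c < R.n i, s (i, c) ≠ ∞ →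
      ¬(p < (finish x s (i, c)).toReal ∧ (finish x s (i, c)).toReal < t)) → l t = r p)
    (hr : ∀ t, a < t → t ≤ b → (∀ i < q, ∀ c < R.n i, s (i, c) ≠ ∞ →
      (finish x s (i, c)).toReal ≠ t) → r t = l t)
    (hd : ∀ τ, a < τ → τ ≤ b → ∀ t, HasDerivAt (fun t => f t (l τ)) (f' t (l τ)) t)
    (hc : ∀ τ, a < τ → τ ≤ b → Continuous fun t => f' t (l τ)) :
    IntervalIntegrable (fun t => f' t (l t)) volume a b ∧
      f b (r b) + ∑ i ∈ Finset.range q, ∑ c ∈ Finset.range (R.n i),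
        (if s (i, c) ≠ ∞ ∧ a < (finish x s (i, c)).toReal ∧ (finish x s (i, c)).toReal ≤ b then
          f (finish x s (i, c)).toReal (l (finish x s (i, c)).toReal) -
            f (finish x s (i, c)).toReal (r (finish x s (i, c)).toReal) else 0) =
        f a (r a) + ∫ t in a..b, f' t (l t) := by
  classical
  set C : Finset Chunk := ((Finset.range q).sigma fun i => Finset.range (R.n i)).image
    fun y => (y.1, y.2) with hC
  have hCmem : ∀ i c, (i, c) ∈ C ↔ i < q ∧ c < R.n i := by
    intro i c
    simp only [hC, Finset.mem_image, Finset.mem_sigma, Finset.mem_range, Prod.mk.injEq]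
    constructor
    · rintro ⟨⟨i', c'⟩, ⟨h1, h2⟩, rfl, rfl⟩
      exact ⟨h1, h2⟩
    · exact fun h => ⟨⟨i, c⟩, h, rfl, rfl⟩
  have hCsum : ∀ g : Chunk → ℝ, ∑ c ∈ C, g c =
      ∑ i ∈ Finset.range q, ∑ c ∈ Finset.range (R.n i), g (i, c) := by
    intro g
    rw [Finset.sum_sigma', hC, Finset.sum_image]
    rintro ⟨i, c⟩ - ⟨i', c'⟩ - hh
    simp only [Prod.mk.injEq] at hh
    obtain ⟨rfl, rfl⟩ := hh
    rfl
  set C' := C.filter fun c => s c ≠ ∞ ∧ a < (finish x s c).toReal ∧ (finish x s c).toReal ≤ b with hC'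
  set F := C'.image fun c => (finish x s c).toReal with hF
  have hFmem : ∀ i < q, ∀ c < R.n i, s (i, c) ≠ ∞ → a < (finish x s (i, c)).toReal →
      (finish x s (i, c)).toReal ≤ b → (finish x s (i, c)).toReal ∈ F := fun i hi c hc h1 h2 h3 =>
    Finset.mem_image_of_mem _ (Finset.mem_filter.2 ⟨(hCmem i c).2 ⟨hi, hc⟩, h1, h2, h3⟩)
  have key := integral_jumps (f := f) (f' := f') (l := l) (r := r) (F := F) h.le' (fun d hd => by
      obtain ⟨c, hc, rfl⟩ := Finset.mem_image.1 hd
      exact (Finset.mem_filter.1 hc).2.2) (fun p t hp hpt ht hFt => hl p t hp hpt ht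
      fun i hi c hc hne hh => hFt _ (hFmem i hi c hc hne (hp.trans_lt hh.1)
        (hh.2.le.trans ht)) hh)
    (fun t hat htb htF => hr t hat htb fun i hi c hc hne he => htF
      (he ▸ hFmem i hi c hc hne (he ▸ hat) (he ▸ htb))) hd hc
  refine ⟨key.1, ?_⟩
  -- The sum over jump times becomes a sum over chunks because distinct chunks have distinct finish
  -- times.
  rw [← key.2, hF, Finset.sum_image, hC', Finset.sum_filter, hCsum]
  intro c hc c' hc' he
  by_contra hcc
  have h1 := (Finset.mem_filter.1 hc).2.1
  have h2 := (Finset.mem_filter.1 hc').2.1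
  have hf : ∀ c, s c ≠ ∞ → finish x s c ≠ ∞ := fun c hc => by simp [finish, hc]
  exact hties c c' hcc h1 ((ENNReal.toReal_eq_toReal_iff' (hf c h1) (hf c' h2)).1 he)

end PathIdentity

/-! ### Measurability of the states -/

section Measurability

/-- There are countably many multisets, so every function of the state is measurable, and joint
measurability with time can be checked state by state. -/
instance : MeasurableSpace (Multiset ℕ) := ⊤

instance : DiscreteMeasurableSpace (Multiset ℕ) := ⟨fun _ => trivial⟩

variable {β : Type*} [MeasurableSpace β]

lemma measurable_load (q : ℕ) {α : β → ℕ → ℕ} (h : ∀ j, Measurable fun y => α y j) :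
    Measurable fun y => load q (α y) := by
  induction q with
  | zero => exact (measurable_const : Measurable fun _ : β => (0 : Multiset ℕ))
  | succ q ih =>
    simp only [load_succ]
    exact (Measurable.of_discrete (f := fun z : ℕ × Multiset ℕ => z.1 ::ₘ z.2)).comp
      ((h q).prodMk ih)

lemma measurable_excess (L q : ℕ) {α δ : β → ℕ → ℕ} (h : ∀ j, Measurable fun y => α y j)
    (h' : ∀ j, Measurable fun y => δ y j) : Measurable fun y => excess L q (α y) (δ y) := by
  have : Measurable fun y => ∑ j ∈ Finset.range q, min (α y j) (δ y j) :=
    Finset.measurable_sum _ fun j _ => (h j).min (h' j)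
  exact (Measurable.of_discrete (f := fun n : ℕ => L - n)).comp this

lemma measurable_backlog (q : ℕ) {α δ : β → ℕ → ℕ} (h : ∀ j, Measurable fun y => α y j)
    (h' : ∀ j, Measurable fun y => δ y j) : Measurable fun y => backlog q (α y) (δ y) :=
  measurable_load q fun j => (Measurable.of_discrete (f := fun z : ℕ × ℕ => z.1 - z.2)).comp
    ((h j).prodMk (h' j))

lemma measurable_virt (L q : ℕ) {α δ : β → ℕ → ℕ} (h : ∀ j, Measurable fun y => α y j)
    (h' : ∀ j, Measurable fun y => δ y j) : Measurable fun y => virt L q (α y) (δ y) :=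
  (Measurable.of_discrete (f := fun z : ℕ × Multiset ℕ => step^[z.1] z.2)).comp
    ((measurable_excess L q h h').prodMk (measurable_backlog q h h'))

lemma measurable_comp_multiset {f : ℝ → Multiset ℕ → ℝ} (hf : ∀ r, Measurable fun t => f t r)
    {T : β → ℝ} (hT : Measurable T) {m : β → Multiset ℕ} (hm : Measurable m) :
    Measurable fun y => f (T y) (m y) := by
  have : Measurable fun z : ℝ × Multiset ℕ => f z.1 z.2 := measurable_from_prod_countable_left hf
  exact this.comp (hT.prodMk hm)

lemma measurable_card_filter {n : ℕ} {p : β → ℕ → Prop} [∀ y, DecidablePred (p y)]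
    (h : ∀ c, MeasurableSet {y | p y c}) :
    Measurable fun y => ((Finset.range n).filter (p y)).card := by
  simp only [Finset.card_filter]
  exact Finset.measurable_sum _ fun c _ => Measurable.ite (h c) measurable_const measurable_const

end Measurability

end

/-! ### Expected sums over downloads -/

section

variable {𝒰 : Type*} [MeasurableSpace 𝒰] {R : RequestSeq} {N L q : ℕ}
  {S : 𝒰 × (Chunk → ℝ) → Schedule}

section LeftState

variable (hS : OnlineSchedule R N L S)
include hS

lemma measurable_start_fst (c : Chunk) :
    Measurable fun y : (𝒰 × (Chunk → ℝ)) × ℝ => S y.1 c :=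
  (hS.measurable c).comp measurable_fst

lemma measurable_finish_fst (c : Chunk) :
    Measurable fun y : (𝒰 × (Chunk → ℝ)) × ℝ => finish y.1.2 (S y.1) c :=
  (measurable_finish hS c).comp measurable_fst

omit [MeasurableSpace 𝒰] hS in
lemma measurable_time [MeasurableSpace 𝒰] :
    Measurable fun y : (𝒰 × (Chunk → ℝ)) × ℝ => ENNReal.ofReal y.2 :=
  ENNReal.measurable_ofReal.comp measurable_snd

lemma measurable_downloaded (i : ℕ) : Measurable fun y : (𝒰 × (Chunk → ℝ)) × ℝ =>
    downloaded R y.1.2 (S y.1) i (ENNReal.ofReal y.2) :=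
  measurable_card_filter fun c =>
    measurableSet_le (measurable_finish_fst hS (i, c)) measurable_time

lemma measurable_downloadedLt (i : ℕ) : Measurable fun y : (𝒰 × (Chunk → ℝ)) × ℝ =>
    downloadedLt R y.1.2 (S y.1) (ENNReal.ofReal y.2) i :=
  measurable_card_filter fun c =>
    measurableSet_lt (measurable_finish_fst hS (i, c)) measurable_time

lemma measurable_rem (i : ℕ) : Measurable fun y : (𝒰 × (Chunk → ℝ)) × ℝ =>
    rem R y.1.2 (S y.1) (ENNReal.ofReal y.2) i :=
  (Measurable.of_discrete (f := fun n : ℕ => R.k i - n)).comp (measurable_downloaded hS i)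

lemma measurable_remLeft (i : ℕ) : Measurable fun y : (𝒰 × (Chunk → ℝ)) × ℝ =>
    remLeft R y.1.2 (S y.1) (ENNReal.ofReal y.2) i :=
  (Measurable.of_discrete (f := fun n : ℕ => R.k i - n)).comp (measurable_downloadedLt hS i)

lemma measurable_svc (i : ℕ) : Measurable fun y : (𝒰 × (Chunk → ℝ)) × ℝ =>
    svc R y.1.2 (S y.1) (ENNReal.ofReal y.2) i :=
  measurable_card_filter fun c =>
    (measurableSet_lt (measurable_start_fst hS (i, c)) measurable_time).inter
      ((measurableSet_lt measurable_time (measurable_finish_fst hS (i, c))).inter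
        (measurableSet_lt (measurable_downloaded hS i) measurable_const))

lemma measurable_svcLeft (i : ℕ) : Measurable fun y : (𝒰 × (Chunk → ℝ)) × ℝ =>
    svcLeft R y.1.2 (S y.1) (ENNReal.ofReal y.2) i :=
  measurable_card_filter fun c =>
    (measurableSet_lt (measurable_start_fst hS (i, c)) measurable_time).inter
      ((measurableSet_le measurable_time (measurable_finish_fst hS (i, c))).inter
        (measurableSet_lt (measurable_downloadedLt hS i) measurable_const))

end LeftState

section Predictable

-- Left limits are the states that depend only on the strict past, so they are admissible in the
-- compensator formula.
omit [MeasurableSpace 𝒰] in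
lemma predictable_downloadedLt : Predictable S fun y =>
    downloadedLt R y.1.2 (S y.1) (ENNReal.ofReal y.2) := by
  intro u x x' t h
  ext i
  simp only [downloadedLt]
  congr 1
  exact Finset.filter_congr fun c _ => (h (i, c)).2

omit [MeasurableSpace 𝒰] in
lemma predictable_remLeft : Predictable S fun y =>
    remLeft R y.1.2 (S y.1) (ENNReal.ofReal y.2) := by
  intro u x x' t h
  ext i
  exact congrArg (R.k i - ·) (congrFun (predictable_downloadedLt (R := R) u x x' t h) i)

omit [MeasurableSpace 𝒰] in
lemma predictable_svcLeft : Predictable S fun y =>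
    svcLeft R y.1.2 (S y.1) (ENNReal.ofReal y.2) := by
  intro u x x' t h
  ext i
  simp only [svcLeft]
  have e := congrFun (predictable_downloadedLt (R := R) u x x' t h) i
  simp only at e
  rw [e]
  congr 1
  exact Finset.filter_congr fun c _ => and_congr (h (i, c)).1
    (and_congr_left fun _ => not_lt.symm.trans ((not_congr (h (i, c)).2).trans not_lt))

end Predictable

/-- The sum of `g i`, at the time of the download, over the downloads during `(a, b]` of chunks of
the first `q` requests `i`. -/
def downloadSum (R : RequestSeq) (S : 𝒰 × (Chunk → ℝ) → Schedule) (q : ℕ) (a b : ℝ)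
    (g : ℕ → (𝒰 × (Chunk → ℝ)) × ℝ → ℝ≥0∞) (p : 𝒰 × (Chunk → ℝ)) : ℝ≥0∞ :=
  ∑ i ∈ Finset.range q, ∑ c ∈ Finset.range (R.n i),
    if S p (i, c) ≠ ∞ then
      (if a < (finish p.2 (S p) (i, c)).toReal ∧ (finish p.2 (S p) (i, c)).toReal ≤ b ∧
        downloadedLt R p.2 (S p) (ENNReal.ofReal (finish p.2 (S p) (i, c)).toReal) i < R.k i then
        g i (p, (finish p.2 (S p) (i, c)).toReal) else 0) else 0

lemma measurable_downloadSum_term (hS : OnlineSchedule R N L S) (a b : ℝ)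
    {g : ℕ → (𝒰 × (Chunk → ℝ)) × ℝ → ℝ≥0∞} (hg : ∀ i, Measurable (g i)) (i : ℕ) :
    Measurable fun y : (𝒰 × (Chunk → ℝ)) × ℝ => if a < y.2 ∧ y.2 ≤ b ∧
      downloadedLt R y.1.2 (S y.1) (ENNReal.ofReal y.2) i < R.k i then g i y else 0 :=
  Measurable.ite ((measurableSet_lt measurable_const measurable_snd).inter
    ((measurableSet_le measurable_snd measurable_const).inter
      (measurableSet_lt (measurable_downloadedLt hS i) measurable_const))) (hg i) measurable_const

lemma measurable_downloadSum_summand (hS : OnlineSchedule R N L S) (a b : ℝ)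
    {g : ℕ → (𝒰 × (Chunk → ℝ)) × ℝ → ℝ≥0∞} (hg : ∀ i, Measurable (g i)) (i c : ℕ) :
    Measurable fun p : 𝒰 × (Chunk → ℝ) => if S p (i, c) ≠ ∞ then
      (if a < (finish p.2 (S p) (i, c)).toReal ∧ (finish p.2 (S p) (i, c)).toReal ≤ b ∧
        downloadedLt R p.2 (S p) (ENNReal.ofReal (finish p.2 (S p) (i, c)).toReal) i < R.k i then
        g i (p, (finish p.2 (S p) (i, c)).toReal) else 0) else 0 :=
  Measurable.ite ((hS.measurable _) (measurableSet_singleton _).compl)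
    ((measurable_downloadSum_term hS a b hg i).comp
      (measurable_id.prodMk (measurable_finish hS (i, c)).ennreal_toReal)) measurable_const

lemma measurable_downloadSum (hS : OnlineSchedule R N L S) (q : ℕ) (a b : ℝ)
    {g : ℕ → (𝒰 × (Chunk → ℝ)) × ℝ → ℝ≥0∞} (hg : ∀ i, Measurable (g i)) :
    Measurable (downloadSum R S q a b g) :=
  Finset.measurable_sum _ fun i _ => Finset.measurable_sum _ fun c _ =>
    measurable_downloadSum_summand hS a b hg i c

/-- The compensator formula summed over chunks. The condition that the request was unfinished just
before discards nominal finishes and turns the sum of indicators into `svcLeft`. -/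
lemma lintegral_downloadSum (hS : OnlineSchedule R N L S) {μ : ℝ} (hμ : 0 < μ)
    {Q : Measure (𝒰 × (Chunk → ℝ))} (hQ : Resample μ Q) (q : ℕ) {a b : ℝ} (ha : 0 ≤ a)
    {g : ℕ → (𝒰 × (Chunk → ℝ)) × ℝ → ℝ≥0∞} (hg : ∀ i, Measurable (g i))
    (hgp : ∀ i, Predictable S (g i)) :
    ∫⁻ p, downloadSum R S q a b g p ∂Q = ENNReal.ofReal μ * ∫⁻ p, (∫⁻ t in Set.Ioc a b,
      ∑ i ∈ Finset.range q, svcLeft R p.2 (S p) (ENNReal.ofReal t) i * g i (p, t)) ∂Q := by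
  have hterm := fun i => measurable_downloadSum_term hS a b hg i
  have hind : ∀ i c, Measurable fun y : (𝒰 × (Chunk → ℝ)) × ℝ =>
      if S y.1 (i, c) < ENNReal.ofReal y.2 ∧ ENNReal.ofReal y.2 ≤ finish y.1.2 (S y.1) (i, c)
        then (if a < y.2 ∧ y.2 ≤ b ∧ downloadedLt R y.1.2 (S y.1) (ENNReal.ofReal y.2) i < R.k i
          then g i y else 0) else 0 := fun i c =>
    Measurable.ite ((measurableSet_lt (measurable_start_fst hS (i, c)) measurable_time).inter
      (measurableSet_le measurable_time (measurable_finish_fst hS (i, c)))) (hterm i)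
      measurable_const
  simp only [downloadSum]
  rw [lintegral_finsetSum _ fun i _ => Finset.measurable_sum _ fun c _ =>
    measurable_downloadSum_summand hS a b hg i c]
  have h1 : ∀ i ∈ Finset.range q, ∀ c ∈ Finset.range (R.n i), _ := fun i _ c _ =>
    lintegral_finish hS hμ hQ (i, c) (hterm i) (by
      intro u x x' t h
      have e1 := congrFun (predictable_downloadedLt (R := R) u x x' t h) i
      have e2 := hgp i u x x' t h
      simp only at e1 ⊢
      rw [e1, e2])
  have h2 : ∀ i ∈ Finset.range q, ∫⁻ p, ∑ c ∈ Finset.range (R.n i), (if S p (i, c) ≠ ∞ then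
      (if a < (finish p.2 (S p) (i, c)).toReal ∧ (finish p.2 (S p) (i, c)).toReal ≤ b ∧
        downloadedLt R p.2 (S p) (ENNReal.ofReal (finish p.2 (S p) (i, c)).toReal) i < R.k i then
        g i (p, (finish p.2 (S p) (i, c)).toReal) else 0) else 0) ∂Q = _ := fun i hi =>
    (lintegral_finsetSum _ fun c _ => measurable_downloadSum_summand hS a b hg i c).trans
      (Finset.sum_congr rfl (h1 i hi))
  rw [Finset.sum_congr rfl h2]
  simp only [← Finset.mul_sum]
  congr 1
  simp only [← lintegral_finsetSum _ fun c _ => (hind _ c).lintegral_prod_right']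
  rw [← lintegral_finsetSum _ fun i _ => Finset.measurable_sum _ fun c _ =>
    (hind i c).lintegral_prod_right']
  refine lintegral_congr fun p => ?_
  have hsec : ∀ i c, Measurable fun t : ℝ =>
      if S p (i, c) < ENNReal.ofReal t ∧ ENNReal.ofReal t ≤ finish p.2 (S p) (i, c)
        then (if a < t ∧ t ≤ b ∧ downloadedLt R p.2 (S p) (ENNReal.ofReal t) i < R.k i
          then g i (p, t) else 0) else 0 := fun i c => (hind i c).comp measurable_prodMk_left
  simp only [← lintegral_finsetSum _ fun c _ => hsec _ c]
  rw [← lintegral_finsetSum _ fun i _ => Finset.measurable_sum _ fun c _ => hsec i c,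
    ← lintegral_indicator measurableSet_Ioi, ← lintegral_indicator measurableSet_Ioc]
  refine lintegral_congr fun t => ?_
  by_cases ht : t ∈ Set.Ioc a b
  · rw [Set.indicator_of_mem ht, Set.indicator_of_mem (show t ∈ Set.Ioi (0 : ℝ) from
      ha.trans_lt ht.1)]
    refine Finset.sum_congr rfl fun i _ => ?_
    rw [svcLeft, Finset.card_filter, Nat.cast_sum, Finset.sum_mul]
    refine Finset.sum_congr rfl fun c _ => ?_
    by_cases h1 : S p (i, c) < ENNReal.ofReal t ∧ ENNReal.ofReal t ≤ finish p.2 (S p) (i, c)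
    · by_cases h2 : downloadedLt R p.2 (S p) (ENNReal.ofReal t) i < R.k i
      · rw [if_pos h1, if_pos ⟨ht.1, ht.2, h2⟩, if_pos ⟨h1.1, h1.2, h2⟩]
        simp
      · rw [if_pos h1, if_neg fun h => h2 h.2.2, if_neg fun h => h2 h.2.2]
        simp
    · rw [if_neg h1, if_neg fun h => h1 ⟨h.1, h.2.1⟩]
      simp
  · rw [Set.indicator_of_notMem ht]
    by_cases ht0 : t ∈ Set.Ioi (0 : ℝ)
    · rw [Set.indicator_of_mem ht0]
      refine Finset.sum_eq_zero fun i _ => Finset.sum_eq_zero fun c _ => ?_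
      rw [if_neg (c := a < t ∧ _) fun h => ht ⟨h.1, h.2.1⟩]
      simp
    · rw [Set.indicator_of_notMem ht0]

end

/-! ### Trajectories within a stage -/

section

section PathStates

variable {R : RequestSeq} {N L q : ℕ} {x : Chunk → ℝ} {s : Schedule} {a b : ℝ}

lemma finish_ne_top {c : Chunk} (h : s c ≠ ∞) : finish x s c ≠ ∞ := by simp [finish, h]

/-- The change of the state at the end of the service of chunk `(i, c)`. -/
lemma state_at_finish (hx : ∀ c, 0 < x c)
    (hties : ∀ c c', c ≠ c' → s c ≠ ∞ → finish x s c ≠ finish x s c') {i c : ℕ} (hc : c < R.n i)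
    (hne : s (i, c) ≠ ∞) {τ : ℝ≥0∞} (hτ : finish x s (i, c) = τ) :
    (downloadedLt R x s τ i < R.k i → 0 < remLeft R x s τ i ∧ 0 < svcLeft R x s τ i ∧
      rem R x s τ i = remLeft R x s τ i - 1 ∧
      svc R x s τ i = (if remLeft R x s τ i = 1 then 0 else svcLeft R x s τ i - 1)) ∧
    (¬downloadedLt R x s τ i < R.k i → rem R x s τ i = remLeft R x s τ i ∧
      svc R x s τ i = svcLeft R x s τ i) ∧
    ∀ j, j ≠ i → rem R x s τ j = remLeft R x s τ j ∧ svc R x s τ j = svcLeft R x s τ j := by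
  refine ⟨fun h => ?_, fun h => state_of_completed (not_lt.1 h), fun j hj => ?_⟩
  · exact state_download hx hc hne hτ (fun c' _ hcc => hτ ▸ (hties _ _ (by simp [hcc.symm]) hne).symm)
      h
  · exact state_eq_of_forall_ne fun c' _ => hτ ▸ (hties _ _ (by simp [hj.symm]) hne).symm

lemma state_eq_of_ne {i : ℕ} {t : ℝ} (ht : 0 ≤ t) (h : ∀ c < R.n i, s (i, c) ≠ ∞ →
    (finish x s (i, c)).toReal ≠ t) :
    rem R x s (ENNReal.ofReal t) i = remLeft R x s (ENNReal.ofReal t) i ∧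
      svc R x s (ENNReal.ofReal t) i = svcLeft R x s (ENNReal.ofReal t) i := by
  refine state_eq_of_forall_ne fun c hc he => ?_
  by_cases hne : s (i, c) = ∞
  · have : finish x s (i, c) = ∞ := by simp [finish, hne]
    rw [this] at he
    exact ENNReal.ofReal_ne_top he.symm
  · exact h c hc hne (by rw [he, ENNReal.toReal_ofReal ht])

lemma Stage.remLeft_eq (h : Stage R N q a b) (hs : Feasible R N x s L) {p t : ℝ} (hp : a ≤ p)
    (hpt : p < t) (ht : t ≤ b) (hF : ∀ i < q, ∀ c < R.n i, s (i, c) ≠ ∞ →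
      ¬(p < (finish x s (i, c)).toReal ∧ (finish x s (i, c)).toReal < t)) :
    remLeft R x s (ENNReal.ofReal t) = rem R x s (ENNReal.ofReal p) := by
  have hp0 := h.nonneg.trans hp
  exact Srpt.remLeft_eq ((ENNReal.ofReal_lt_ofReal_iff (hp0.trans_lt hpt)).2 hpt)
    (h.no_finish hs ht hF hp0)

lemma Stage.svcLeft_eq (h : Stage R N q a b) (hs : Feasible R N x s L) (hx : ∀ c, 0 < x c)
    (hd : ∀ i < N, L ≤ R.d i) (hA : ∀ t, SEDPTAssignment R N x s L t) {p t : ℝ} (hp : a ≤ p)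
    (hpt : p < t) (ht : t ≤ b) (hF : ∀ i < q, ∀ c < R.n i, s (i, c) ≠ ∞ →
      ¬(p < (finish x s (i, c)).toReal ∧ (finish x s (i, c)).toReal < t)) :
    svcLeft R x s (ENNReal.ofReal t) = svcAfter R x s (ENNReal.ofReal p) := by
  have hp0 := h.nonneg.trans hp
  have hnf := h.no_finish hs ht hF hp0
  refine Srpt.svcLeft_eq ((ENNReal.ofReal_lt_ofReal_iff (hp0.trans_lt hpt)).2 hpt) hnf
    (no_start_between (p := p.toNNReal) (t := t.toNNReal) hs hx hd h.le (fun j hj => ?_)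
      (fun j hj hjN => ?_) (hA _) hnf)
  · exact (Real.le_toNNReal_iff_coe_le hp0).2 ((h.arrived j hj).trans hp)
  · exact Real.toNNReal_le_iff_le_coe.2 (ht.trans (h.not_arrived j hj hjN))

lemma Stage.arrived' (h : Stage R N q a b) {p : ℝ} (hp : a ≤ p) :
    ∀ j < q, R.a j ≤ p.toNNReal := fun j hj =>
  (Real.le_toNNReal_iff_coe_le (h.nonneg.trans hp)).2 ((h.arrived j hj).trans hp)

lemma Stage.not_arrived' (h : Stage R N q a b) {p : ℝ} (hp : a ≤ p) (hpb : p < b) :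
    ∀ j, q ≤ j → j < N → p.toNNReal < R.a j := fun j hj hjN =>
  (Real.toNNReal_lt_iff_lt_coe (h.nonneg.trans hp)).2 (hpb.trans_le (h.not_arrived j hj hjN))

/-- Between downloads, the virtual state and the potential do not change under SEDPT-R. -/
lemma Stage.virt_left_eq (h : Stage R N q a b) (hs : Feasible R N x s L) (hx : ∀ c, 0 < x c)
    (hd : ∀ i < N, L ≤ R.d i) (hA : ∀ t, SEDPTAssignment R N x s L t) {p t : ℝ} (hp : a ≤ p)
    (hpt : p < t) (ht : t ≤ b) (hF : ∀ i < q, ∀ c < R.n i, s (i, c) ≠ ∞ →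
      ¬(p < (finish x s (i, c)).toReal ∧ (finish x s (i, c)).toReal < t)) :
    virt L q (remLeft R x s (ENNReal.ofReal t)) (svcLeft R x s (ENNReal.ofReal t)) =
        virt L q (rem R x s (ENNReal.ofReal p)) (svc R x s (ENNReal.ofReal p)) ∧
      potential L q (remLeft R x s (ENNReal.ofReal t)) (svcLeft R x s (ENNReal.ofReal t)) =
        potential L q (rem R x s (ENNReal.ofReal p)) (svc R x s (ENNReal.ofReal p)) := by
  rw [h.remLeft_eq hs hp hpt ht hF, h.svcLeft_eq hs hx hd hA hp hpt ht hF]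
  exact virt_svcAfter (t := p.toNNReal) hs hx hd h.le (h.arrived' hp)
    (h.not_arrived' hp (hpt.trans_le ht)) (hA _)

/-- Under SEDPT-R all threads are busy when there are unfinished requests. -/
lemma Stage.sum_svcLeft_eq (h : Stage R N q a b) (hs : Feasible R N x s L) (hx : ∀ c, 0 < x c)
    (hd : ∀ i < N, L ≤ R.d i) (hA : ∀ t, SEDPTAssignment R N x s L t) {t : ℝ} (hat : a < t)
    (ht : t ≤ b) {j : ℕ} (hj : j < q) (hj0 : 0 < remLeft R x s (ENNReal.ofReal t) j) :
    ∑ i ∈ Finset.range q, svcLeft R x s (ENNReal.ofReal t) i = L := by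
  classical
  -- Its maximum `p` is the last finish before `t` within the stage, or `a`; the left limit at `t`
  -- is the state just after `p`.
  let A : Finset ℝ := insert a (((Finset.range q).biUnion fun i => (Finset.range (R.n i)).image
    fun c => (finish x s (i, c)).toReal).filter fun d => a < d ∧ d < t)
  have hne : A.Nonempty := Finset.insert_nonempty _ _
  set p := A.max' hne with hp_def
  have hpA : p ∈ A := A.max'_mem hne
  have hap : a ≤ p := A.le_max' a (Finset.mem_insert_self _ _)
  have hpt : p < t := by
    rcases Finset.mem_insert.1 hpA with hp | hp
    · rw [hp]; exact hat
    · exact (Finset.mem_filter.1 hp).2.2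
  have hF : ∀ i < q, ∀ c < R.n i, s (i, c) ≠ ∞ →
      ¬(p < (finish x s (i, c)).toReal ∧ (finish x s (i, c)).toReal < t) := by
    rintro i hi c hc - ⟨h1, h2⟩
    refine absurd (A.le_max' _ (Finset.mem_insert_of_mem (Finset.mem_filter.2
      ⟨Finset.mem_biUnion.2 ⟨i, Finset.mem_range.2 hi, Finset.mem_image_of_mem _
        (Finset.mem_range.2 hc)⟩, hap.trans_lt h1, h2⟩))) (not_le.2 h1)
  rw [h.remLeft_eq hs hap hpt ht hF] at hj0
  rw [h.svcLeft_eq hs hx hd hA hap hpt ht hF]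
  exact sum_svcAfter_eq_of_pos (t := p.toNNReal) hs hd h.le (h.arrived' hap)
    (h.not_arrived' hap (hpt.trans_le ht)) (hA _) hj hj0

end PathStates

section Ennreal

variable {𝒰 : Type*} {R : RequestSeq} {N L q : ℕ}
  {S : 𝒰 × (Chunk → ℝ) → Schedule} {p : 𝒰 × (Chunk → ℝ)} {a b : ℝ} {σ : Type*} {f f' : ℝ → σ → ℝ}
  {l r : ℝ → σ} {G : ℕ → ℝ → ℝ} {g : ℕ → (𝒰 × (Chunk → ℝ)) × ℝ → ℝ≥0∞}

/-- The trajectory `r`, with left limits `l`, is constant between downloads. -/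
structure Trajectory (R : RequestSeq) (x : Chunk → ℝ) (s : Schedule) (q : ℕ) (a b : ℝ)
    (l r : ℝ → σ) : Prop where
  ties : ∀ c c', c ≠ c' → s c ≠ ∞ → finish x s c ≠ finish x s c'
  left : ∀ p t, a ≤ p → p < t → t ≤ b → (∀ i < q, ∀ c < R.n i, s (i, c) ≠ ∞ →
      ¬(p < (finish x s (i, c)).toReal ∧ (finish x s (i, c)).toReal < t)) → l t = r p
  right : ∀ t, a < t → t ≤ b → (∀ i < q, ∀ c < R.n i, s (i, c) ≠ ∞ →
      (finish x s (i, c)).toReal ≠ t) → r t = l t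

/-- `f'` is the time derivative of `f` along the trajectory. -/
structure TimeDeriv (f f' : ℝ → σ → ℝ) (l : ℝ → σ) (a b : ℝ) : Prop where
  deriv : ∀ τ, a < τ → τ ≤ b → ∀ t, HasDerivAt (fun t => f t (l τ)) (f' t (l τ)) t
  cont : ∀ τ, a < τ → τ ≤ b → Continuous fun t => f' t (l τ)
  nonneg : ∀ t, a < t → t ≤ b → 0 ≤ f' t (l t)

lemma ofReal_integral_Ioc (hab : a ≤ b) {F : ℝ → ℝ} (hF : IntervalIntegrable F volume a b)
    (h0 : ∀ t, a < t → t ≤ b → 0 ≤ F t) :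
    ENNReal.ofReal (∫ t in a..b, F t) = ∫⁻ t in Set.Ioc a b, ENNReal.ofReal (F t) := by
  rw [intervalIntegral.integral_of_le hab]
  refine ofReal_integral_eq_lintegral_ofReal ((intervalIntegrable_iff_integrableOn_Ioc_of_le hab).1
    hF) ?_
  filter_upwards [ae_restrict_mem measurableSet_Ioc] with t ht
  exact h0 t ht.1 ht.2

lemma downloadSum_eq (hg : ∀ i t, g i (p, t) = ENNReal.ofReal (G i t))
    (hG : ∀ i < q, ∀ t, a < t → t ≤ b → 0 ≤ G i t) :
    downloadSum R S q a b g p = ENNReal.ofReal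
      (∑ i ∈ Finset.range q, ∑ c ∈ Finset.range (R.n i),
        if S p (i, c) ≠ ∞ ∧ a < (finish p.2 (S p) (i, c)).toReal ∧
            (finish p.2 (S p) (i, c)).toReal ≤ b then
          if downloadedLt R p.2 (S p) (ENNReal.ofReal (finish p.2 (S p) (i, c)).toReal) i < R.k i
            then G i (finish p.2 (S p) (i, c)).toReal else 0 else 0) := by
  have h0 : ∀ i ∈ Finset.range q, ∀ c ∈ Finset.range (R.n i), 0 ≤
      (if S p (i, c) ≠ ∞ ∧ a < (finish p.2 (S p) (i, c)).toReal ∧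
            (finish p.2 (S p) (i, c)).toReal ≤ b then
          if downloadedLt R p.2 (S p) (ENNReal.ofReal (finish p.2 (S p) (i, c)).toReal) i < R.k i
            then G i (finish p.2 (S p) (i, c)).toReal else 0 else 0) := by
    intro i hi c _
    split_ifs with h1 h2
    · exact hG i (Finset.mem_range.1 hi) _ h1.2.1 h1.2.2
    · exact le_rfl
    · exact le_rfl
  rw [ENNReal.ofReal_sum_of_nonneg fun i hi => Finset.sum_nonneg (h0 i hi), downloadSum]
  refine Finset.sum_congr rfl fun i hi => ?_
  rw [ENNReal.ofReal_sum_of_nonneg (h0 i hi)]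
  refine Finset.sum_congr rfl fun c _ => ?_
  rw [hg]
  by_cases h1 : S p (i, c) ≠ ∞
  · by_cases h2 : a < (finish p.2 (S p) (i, c)).toReal ∧ (finish p.2 (S p) (i, c)).toReal ≤ b
    · by_cases h3 :
        downloadedLt R p.2 (S p) (ENNReal.ofReal (finish p.2 (S p) (i, c)).toReal) i < R.k i
      · rw [if_pos h1, if_pos ⟨h2.1, h2.2, h3⟩, if_pos ⟨h1, h2⟩, if_pos h3]
      · rw [if_pos h1, if_neg fun h => h3 h.2.2, if_pos ⟨h1, h2⟩, if_neg h3, ENNReal.ofReal_zero]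
    · rw [if_pos h1, if_neg fun h => h2 ⟨h.1, h.2.1⟩, if_neg fun h => h2 h.2, ENNReal.ofReal_zero]
  · rw [if_neg h1, if_neg fun h => h1 h.1, ENNReal.ofReal_zero]

/-- For `f` that drops by at least `G` at the real downloads and does not rise at nominal finishes.
`Trajectory.add_le` is the opposite bound. -/
lemma Trajectory.le_add (ht : Trajectory R p.2 (S p) q a b l r) (hst : Stage R N q a b)
    (hf : TimeDeriv f f' l a b) (hfb : 0 ≤ f b (r b))
    (hg : ∀ i t, g i (p, t) = ENNReal.ofReal (G i t))
    (hG : ∀ i < q, ∀ t, a < t → t ≤ b → 0 ≤ G i t)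
    (hjump : ∀ i < q, ∀ c < R.n i, S p (i, c) ≠ ∞ → ∀ t, a < t → t ≤ b →
      finish p.2 (S p) (i, c) = ENNReal.ofReal t →
      (if downloadedLt R p.2 (S p) (ENNReal.ofReal t) i < R.k i then G i t else 0) ≤
        f t (l t) - f t (r t)) :
    ENNReal.ofReal (f b (r b)) + downloadSum R S q a b g p ≤
      ENNReal.ofReal (f a (r a)) + ∫⁻ t in Set.Ioc a b, ENNReal.ofReal (f' t (l t)) := by
  obtain ⟨hint, key⟩ := path_identity hst ht.ties ht.left ht.right hf.deriv hf.cont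
  rw [downloadSum_eq hg hG, ← ofReal_integral_Ioc hst.le' hint hf.nonneg, ← ENNReal.ofReal_add hfb]
  · refine le_trans (ENNReal.ofReal_le_ofReal ?_) ENNReal.ofReal_add_le
    rw [← key]
    gcongr with i hi c hc
    split_ifs with h1 h2
    · have := hjump i (Finset.mem_range.1 hi) c (Finset.mem_range.1 hc) h1.1 _ h1.2.1 h1.2.2
        (ENNReal.ofReal_toReal (finish_ne_top h1.1)).symm
      rwa [if_pos h2] at this
    · have := hjump i (Finset.mem_range.1 hi) c (Finset.mem_range.1 hc) h1.1 _ h1.2.1 h1.2.2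
        (ENNReal.ofReal_toReal (finish_ne_top h1.1)).symm
      rwa [if_neg h2] at this
    · exact le_rfl
  · refine Finset.sum_nonneg fun i hi => Finset.sum_nonneg fun c _ => ?_
    split_ifs with h1 h2
    · exact hG i (Finset.mem_range.1 hi) _ h1.2.1 h1.2.2
    · exact le_rfl
    · exact le_rfl

lemma Trajectory.add_le (ht : Trajectory R p.2 (S p) q a b l r) (hst : Stage R N q a b)
    (hf : TimeDeriv f f' l a b) (hfa : 0 ≤ f a (r a))
    (hg : ∀ i t, g i (p, t) = ENNReal.ofReal (G i t))
    (hG : ∀ i < q, ∀ t, a < t → t ≤ b → 0 ≤ G i t)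
    (hjump : ∀ i < q, ∀ c < R.n i, S p (i, c) ≠ ∞ → ∀ t, a < t → t ≤ b →
      finish p.2 (S p) (i, c) = ENNReal.ofReal t →
      f t (l t) - f t (r t) ≤
        if downloadedLt R p.2 (S p) (ENNReal.ofReal t) i < R.k i then G i t else 0) :
    ENNReal.ofReal (f a (r a)) + ∫⁻ t in Set.Ioc a b, ENNReal.ofReal (f' t (l t)) ≤
      ENNReal.ofReal (f b (r b)) + downloadSum R S q a b g p := by
  obtain ⟨hint, key⟩ := path_identity hst ht.ties ht.left ht.right hf.deriv hf.cont
  rw [downloadSum_eq hg hG, ← ofReal_integral_Ioc hst.le' hint hf.nonneg, ← ENNReal.ofReal_add hfa]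
  · refine le_trans (ENNReal.ofReal_le_ofReal ?_) ENNReal.ofReal_add_le
    rw [← key]
    gcongr with i hi c hc
    split_ifs with h1 h2
    · have := hjump i (Finset.mem_range.1 hi) c (Finset.mem_range.1 hc) h1.1 _ h1.2.1 h1.2.2
        (ENNReal.ofReal_toReal (finish_ne_top h1.1)).symm
      rwa [if_pos h2] at this
    · have := hjump i (Finset.mem_range.1 hi) c (Finset.mem_range.1 hc) h1.1 _ h1.2.1 h1.2.2
        (ENNReal.ofReal_toReal (finish_ne_top h1.1)).symm
      rwa [if_neg h2] at this
    · exact le_rfl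
  · rw [intervalIntegral.integral_of_le hst.le']
    exact setIntegral_nonneg measurableSet_Ioc fun t ht => hf.nonneg t ht.1 ht.2

end Ennreal

end

/-! ### The lower bound for every online policy -/

section

variable {𝒰 : Type*} [MeasurableSpace 𝒰] {R : RequestSeq} {N L q K : ℕ} {μ B : ℝ}
  {S : 𝒰 × (Chunk → ℝ) → Schedule} {Q : Measure (𝒰 × (Chunk → ℝ))} {v : Multiset ℕ → ℝ} {a b : ℝ}

/-- The value at time `t` of the terminal reward `v` at time `b`, under shortest-remaining-first
service at rate `lam`. -/
def valueFn (K : ℕ) (v : Multiset ℕ → ℝ) (lam b t : ℝ) (r : Multiset ℕ) : ℝ :=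
  poissonStep K v (lam * (b - t)) r

/-- The rate of decrease of `valueFn` by a service step. -/
def valueRate (K : ℕ) (v : Multiset ℕ → ℝ) (lam b t : ℝ) (r : Multiset ℕ) : ℝ :=
  lam * (valueFn K v lam b t r - valueFn K v lam b t (step r))

lemma hasDerivAt_valueFn (lam b t : ℝ) {r : Multiset ℕ} (hr : r.sum ≤ K) :
    HasDerivAt (fun t => valueFn K v lam b t r) (valueRate K v lam b t r) t := by
  have h1 : HasDerivAt (fun t => lam * (b - t)) (lam * -1) t :=
    ((hasDerivAt_id t).const_sub b).const_mul lam
  have h2 := (hasDerivAt_poissonStep K v (lam * (b - t)) hr).comp t h1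
  refine h2.congr_deriv ?_
  unfold valueRate valueFn
  ring

lemma continuous_valueFn (lam b : ℝ) (r : Multiset ℕ) :
    Continuous fun t => valueFn K v lam b t r :=
  (continuous_poissonStep K v r).comp (by fun_prop)

lemma continuous_valueRate (lam b : ℝ) (r : Multiset ℕ) :
    Continuous fun t => valueRate K v lam b t r :=
  continuous_const.mul ((continuous_valueFn lam b r).sub (continuous_valueFn lam b _))

lemma valueFn_self (lam b : ℝ) (r : Multiset ℕ) : valueFn K v lam b b r = v r := by
  simp [valueFn, poissonStep_zero]

lemma Monot.valueFn (hv : Monot B v) {lam t : ℝ} (hlam : 0 ≤ lam) (ht : t ≤ b) :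
    Monot B (valueFn K v lam b t) :=
  hv.poissonStep K (mul_nonneg hlam (by linarith))

lemma Monot.valueRate_nonneg (hv : Monot B v) {lam t : ℝ} (hlam : 0 ≤ lam) (ht : t ≤ b)
    (r : Multiset ℕ) : 0 ≤ valueRate K v lam b t r :=
  mul_nonneg hlam (sub_nonneg.2 ((hv.valueFn hlam ht).mono (dom_step_self r)))

lemma Monot.valueRate_le (hv : Monot B v) {lam t : ℝ} (hlam : 0 ≤ lam) (ht : t ≤ b)
    (r : Multiset ℕ) : valueRate K v lam b t r ≤ lam * B := by
  have h := hv.valueFn (K := K) hlam ht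
  exact mul_le_mul_of_nonneg_left (by linarith [h.le r, h.nonneg (step r)]) hlam

lemma Monot.timeDeriv (hv : Monot B v) {lam : ℝ} (hlam : 0 ≤ lam) {l : ℝ → Multiset ℕ}
    (hl : ∀ t, (l t).sum ≤ K) : TimeDeriv (Srpt.valueFn K v lam b) (valueRate K v lam b) l a b where
  deriv τ _ _ t := hasDerivAt_valueFn lam b t (hl τ)
  cont _ _ _ := continuous_valueRate lam b _
  nonneg _ _ ht := hv.valueRate_nonneg hlam ht _

/-- The drift will appear on both sides in `ℝ≥0∞`; being finite, it can be cancelled. -/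
lemma lintegral_valueRate_ne_top [IsProbabilityMeasure Q] (hv : Monot B v) {lam : ℝ}
    (hlam : 0 ≤ lam) (l : 𝒰 × (Chunk → ℝ) → ℝ → Multiset ℕ) :
    ∫⁻ p, (∫⁻ t in Set.Ioc a b, ENNReal.ofReal (valueRate K v lam b t (l p t))) ∂Q ≠ ∞ := by
  have h1 : ∀ p, ∫⁻ t in Set.Ioc a b, ENNReal.ofReal (valueRate K v lam b t (l p t)) ≤
      ENNReal.ofReal (lam * B) * ENNReal.ofReal (b - a) := fun p => by
    calc _ ≤ ∫⁻ _ in Set.Ioc a b, ENNReal.ofReal (lam * B) :=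
          setLIntegral_mono measurable_const fun t ht =>
            ENNReal.ofReal_le_ofReal (hv.valueRate_le hlam ht.2 _)
      _ = _ := by rw [setLIntegral_const, Real.volume_Ioc]
  refine ne_top_of_le_ne_top ?_ (lintegral_mono h1)
  rw [lintegral_const, measure_univ, mul_one]
  exact ENNReal.mul_ne_top ENNReal.ofReal_ne_top ENNReal.ofReal_ne_top

lemma sum_rem_le {x : Chunk → ℝ} {s : Schedule} (hq : q ≤ N)
    (hK : ∑ j ∈ Finset.range N, R.k j ≤ K) (τ : ℝ≥0∞) :
    ∑ j ∈ Finset.range q, remLeft R x s τ j ≤ K :=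
  (Finset.sum_le_sum fun _ _ => Nat.sub_le _ _).trans
    ((Finset.sum_le_sum_of_subset (Finset.range_mono hq)).trans hK)

/-- Any online policy does at least as badly as shortest-remaining-first service at full rate. -/
lemma lintegral_load_ge [IsProbabilityMeasure Q] (hS : OnlineSchedule R N L S) (hμ : 0 < μ)
    (hQ : Resample μ Q) (hst : Stage R N q a b) (hv : Monot B v)
    (hK : ∑ j ∈ Finset.range N, R.k j ≤ K) :
    ∫⁻ p, ENNReal.ofReal (valueFn K v (L * μ) b a (load q (rem R p.2 (S p) (ENNReal.ofReal a)))) ∂Q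
      ≤ ∫⁻ p, ENNReal.ofReal (v (load q (rem R p.2 (S p) (ENNReal.ofReal b)))) ∂Q := by
  classical
  have hlam : 0 ≤ L * μ := by positivity
  set f := valueFn K v (L * μ) b with hf
  set l : 𝒰 × (Chunk → ℝ) → ℝ → Multiset ℕ :=
    fun p t => load q (remLeft R p.2 (S p) (ENNReal.ofReal t)) with hl
  set dec : ℕ → 𝒰 × (Chunk → ℝ) → ℝ → Multiset ℕ := fun i p t => load q fun j =>
    if j = i then remLeft R p.2 (S p) (ENNReal.ofReal t) j - 1
      else remLeft R p.2 (S p) (ENNReal.ofReal t) j with hdec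
  -- `dec i` is the state after a download for request `i`; the maximum makes the nonnegativity of
  -- the drop automatic.
  set G : ℕ → 𝒰 × (Chunk → ℝ) → ℝ → ℝ := fun i p t => max 0 (f t (l p t) - f t (dec i p t)) with hG
  set g : ℕ → (𝒰 × (Chunk → ℝ)) × ℝ → ℝ≥0∞ := fun i y => ENNReal.ofReal (G i y.1 y.2) with hg
  have hfm : ∀ r, Measurable fun t => f t r := fun r => (continuous_valueFn _ b r).measurable
  have hlm : Measurable fun y : (𝒰 × (Chunk → ℝ)) × ℝ => l y.1 y.2 :=
    measurable_load q fun j => measurable_remLeft hS j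
  have hdm : ∀ i, Measurable fun y : (𝒰 × (Chunk → ℝ)) × ℝ => dec i y.1 y.2 := fun i =>
    measurable_load q fun j => by
      by_cases h : j = i
      · simp only [h, if_true]
        exact (Measurable.of_discrete (f := fun n : ℕ => n - 1)).comp (measurable_remLeft hS i)
      · simp only [h, if_false]
        exact measurable_remLeft hS j
  have hgm : ∀ i, Measurable (g i) := fun i => ENNReal.measurable_ofReal.comp
    (measurable_const.max ((measurable_comp_multiset hfm measurable_snd hlm).sub
      (measurable_comp_multiset hfm measurable_snd (hdm i))))
  have hgp : ∀ i, Predictable S (g i) := fun i u x x' t h => by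
    have e := predictable_remLeft (R := R) u x x' t h
    simp only at e
    simp only [hg, hG, hl, hdec, e]
  have hJ := lintegral_downloadSum hS hμ hQ q hst.nonneg (b := b) hgm hgp
  -- No download lowers the value by more than a shortest-first step, and at most L threads are
  -- busy. So the expected drops are at most the expected growth of `f` in time.
  have hJI : ∫⁻ p, downloadSum R S q a b g p ∂Q ≤
      ∫⁻ p, (∫⁻ t in Set.Ioc a b, ENNReal.ofReal (valueRate K v (L * μ) b t (l p t))) ∂Q := by
    rw [hJ, ← lintegral_const_mul' _ _ ENNReal.ofReal_ne_top]
    refine lintegral_mono_ae ?_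
    filter_upwards [hQ.ae_pos] with p hp
    rw [← lintegral_const_mul' _ _ ENNReal.ofReal_ne_top]
    refine setLIntegral_mono' measurableSet_Ioc fun t ht => ?_
    have hfs := hS.feasible p.1 p.2 hp
    have hcap := sum_svcLeft_le (t := t.toNNReal) hfs hst.le
      (Real.toNNReal_pos.2 (hst.nonneg.trans_lt ht.1))
    have hmon := hv.valueFn (K := K) hlam ht.2
    have hD : 0 ≤ f t (l p t) - f t (step (l p t)) :=
      sub_nonneg.2 (hmon.mono (dom_step_self _))
    have hterm : ∀ i ∈ Finset.range q, (svcLeft R p.2 (S p) (ENNReal.ofReal t) i : ℝ≥0∞) * g i (p, t)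
        ≤ svcLeft R p.2 (S p) (ENNReal.ofReal t) i *
          ENNReal.ofReal (f t (l p t) - f t (step (l p t))) := by
      intro i hi
      by_cases h0 : svcLeft R p.2 (S p) (ENNReal.ofReal t) i = 0
      · simp [h0]
      · gcongr
        refine ENNReal.ofReal_le_ofReal (max_le hD (sub_le_sub_left (hmon.mono ?_) _))
        obtain ⟨c, hc⟩ := Finset.card_pos.1 (Nat.pos_of_ne_zero h0)
        have hk := (Finset.mem_filter.1 hc).2.2.2
        have hiq := Finset.mem_range.1 hi
        have : dec i p t = _ := load_decrement hiq (α := remLeft R p.2 (S p) (ENNReal.ofReal t))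
          (by simp) (fun j hj => by simp [hj])
        rw [this]
        exact (Dom.refl _).step_decrement (mem_load _ hiq) (by rw [remLeft]; omega)
    refine (mul_le_mul_right (Finset.sum_le_sum hterm) _).trans ?_
    rw [← Finset.sum_mul, valueRate, mul_assoc (L : ℝ), ENNReal.ofReal_mul (by positivity),
      ENNReal.ofReal_mul hμ.le, ENNReal.ofReal_natCast]
    rw [← mul_assoc, mul_comm (ENNReal.ofReal μ), mul_assoc]
    gcongr
    exact_mod_cast hcap
  have hpath : ∀ᵐ p ∂Q, ENNReal.ofReal (f a (load q (rem R p.2 (S p) (ENNReal.ofReal a)))) +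
      ∫⁻ t in Set.Ioc a b, ENNReal.ofReal (valueRate K v (L * μ) b t (l p t)) ≤
      ENNReal.ofReal (f b (load q (rem R p.2 (S p) (ENNReal.ofReal b)))) +
        downloadSum R S q a b g p := by
    filter_upwards [hQ.ae_pos, ae_finish_ne hS hQ] with p hp hties
    have hfs := hS.feasible p.1 p.2 hp
    have htr : Trajectory R p.2 (S p) q a b (l p)
        (fun t => load q (rem R p.2 (S p) (ENNReal.ofReal t))) :=
      { ties := hties
        left := fun p' t hp' hpt ht hF => by
          simp only [hl]
          rw [hst.remLeft_eq hfs hp' hpt ht hF]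
        right := fun t hat htb hF => load_congr fun i hi =>
          (state_eq_of_ne (hst.nonneg.trans hat.le) (hF i hi)).1 }
    refine htr.add_le hst (hv.timeDeriv hlam fun t => sum_rem_le hst.le hK _)
      ((hv.valueFn hlam hst.le').nonneg _) (G := fun i => G i p) (fun i t => rfl)
      (fun i _ t _ _ => le_max_left _ _) fun i hi c hc hne t hat htb hfin => ?_
    obtain ⟨h1, h2, h3⟩ := state_at_finish hp hties hc hne hfin
    split_ifs with hk
    · refine le_trans (le_of_eq ?_) (le_max_right _ _)
      congr 2
      refine load_congr fun j _ => ?_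
      by_cases hj : j = i
      · rw [if_pos hj, hj, (h1 hk).2.2.1]
      · rw [if_neg hj, (h3 j hj).1]
    · refine (sub_eq_zero.2 (congrArg _ (load_congr fun j _ => ?_))).le
      by_cases hj : j = i
      · rw [hj, (h2 hk).1]
      · rw [(h3 j hj).1]
  have hIm : AEMeasurable (fun p => ∫⁻ t in Set.Ioc a b,
      ENNReal.ofReal (valueRate K v (L * μ) b t (l p t))) Q := by
    refine (Measurable.lintegral_prod_right' (f := fun y : (𝒰 × (Chunk → ℝ)) × ℝ =>
      ENNReal.ofReal (valueRate K v (L * μ) b y.2 (l y.1 y.2))) ?_).aemeasurable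
    exact ENNReal.measurable_ofReal.comp (measurable_comp_multiset
      (fun r => (continuous_valueRate _ b r).measurable) measurable_snd hlm)
  have hint := lintegral_mono_ae hpath
  rw [lintegral_add_right' _ hIm, lintegral_add_right _ (measurable_downloadSum hS q a b hgm)]
    at hint
  have hne := lintegral_valueRate_ne_top (a := a) (b := b) (K := K) (Q := Q) hv hlam l
  have := hint.trans (add_le_add_right hJI _)
  simp only [hf, valueFn_self] at this
  exact ENNReal.le_of_add_le_add_right hne this

end

/-! ### SEDPT-R: the virtual state, the potential and the busy time -/

section

section

variable {R : RequestSeq} {N L q : ℕ} {x : Chunk → ℝ} {s : Schedule} {a b : ℝ}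

lemma posCount_load_eq_zero {α : ℕ → ℕ} (h : ∀ j < q, ¬0 < α j) : posCount (load q α) = 0 := by
  rw [posCount_load, Finset.card_eq_zero, Finset.filter_eq_empty_iff]
  exact fun j hj => h j (Finset.mem_range.1 hj)

lemma step_virt_of_forall {α δ : ℕ → ℕ} (h : ∀ j < q, ¬0 < α j) :
    step (virt L q α δ) = virt L q α δ := by
  refine step_of_forall_zero fun y hy => ?_
  have h1 := Multiset.le_sum_of_mem hy
  have h2 := sum_virt_le L q α δ
  have h3 : ∑ j ∈ Finset.range q, α j = 0 :=
    Finset.sum_eq_zero fun j hj => Nat.eq_zero_of_not_pos (h j (Finset.mem_range.1 hj))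
  omega

/-- The change of the virtual state and of the potential at the end of the service of a chunk. -/
lemma Stage.virt_jump (h : Stage R N q a b) (hs : Feasible R N x s L) (hx : ∀ c, 0 < x c)
    (hties : ∀ c c', c ≠ c' → s c ≠ ∞ → finish x s c ≠ finish x s c') {i c : ℕ} (hi : i < q)
    (hc : c < R.n i) (hne : s (i, c) ≠ ∞) {t : ℝ} (hat : a < t)
    (hfin : finish x s (i, c) = ENNReal.ofReal t) :
    (downloadedLt R x s (ENNReal.ofReal t) i < R.k i →
      virt L q (rem R x s (ENNReal.ofReal t)) (svc R x s (ENNReal.ofReal t)) =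
        step (virt L q (remLeft R x s (ENNReal.ofReal t)) (svcLeft R x s (ENNReal.ofReal t))) ∧
      potential L q (rem R x s (ENNReal.ofReal t)) (svc R x s (ENNReal.ofReal t)) +
        posCount (load q (remLeft R x s (ENNReal.ofReal t))) ≤
      potential L q (remLeft R x s (ENNReal.ofReal t)) (svcLeft R x s (ENNReal.ofReal t)) +
        posCount (virt L q (remLeft R x s (ENNReal.ofReal t))
          (svcLeft R x s (ENNReal.ofReal t)))) ∧
    (¬downloadedLt R x s (ENNReal.ofReal t) i < R.k i →
      virt L q (rem R x s (ENNReal.ofReal t)) (svc R x s (ENNReal.ofReal t)) =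
        virt L q (remLeft R x s (ENNReal.ofReal t)) (svcLeft R x s (ENNReal.ofReal t)) ∧
      potential L q (rem R x s (ENNReal.ofReal t)) (svc R x s (ENNReal.ofReal t)) =
        potential L q (remLeft R x s (ENNReal.ofReal t)) (svcLeft R x s (ENNReal.ofReal t))) := by
  obtain ⟨h1, h2, h3⟩ := state_at_finish hx hties hc hne hfin
  have hcap := sum_svcLeft_le (t := t.toNNReal) hs h.le
    (Real.toNNReal_pos.2 (h.nonneg.trans_lt hat))
  refine ⟨fun hk => ?_, fun hk => ?_⟩
  · obtain ⟨e1, e2, e3, e4⟩ := h1 hk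
    exact virt_download hi e1 e2 hcap e3 (fun j hj => (h3 j hj).1) e4 fun j hj => (h3 j hj).2
  · have e : ∀ j < q, rem R x s (ENNReal.ofReal t) j = remLeft R x s (ENNReal.ofReal t) j ∧
        svc R x s (ENNReal.ofReal t) j = svcLeft R x s (ENNReal.ofReal t) j := fun j _ => by
      by_cases hj : j = i
      · rw [hj]; exact h2 hk
      · exact h3 j hj
    exact virt_congr (fun j hj => (e j hj).1) fun j hj => (e j hj).2

/-- The trajectory of the virtual state and the potential under SEDPT-R. -/
lemma Stage.trajectory_virt (h : Stage R N q a b) (hs : Feasible R N x s L) (hx : ∀ c, 0 < x c)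
    (hd : ∀ i < N, L ≤ R.d i) (hA : ∀ t, SEDPTAssignment R N x s L t)
    (hties : ∀ c c', c ≠ c' → s c ≠ ∞ → finish x s c ≠ finish x s c') :
    Trajectory R x s q a b
      (fun t => virt L q (remLeft R x s (ENNReal.ofReal t)) (svcLeft R x s (ENNReal.ofReal t)))
      (fun t => virt L q (rem R x s (ENNReal.ofReal t)) (svc R x s (ENNReal.ofReal t))) ∧
    Trajectory R x s q a b
      (fun t => potential L q (remLeft R x s (ENNReal.ofReal t)) (svcLeft R x s (ENNReal.ofReal t)))
      (fun t => potential L q (rem R x s (ENNReal.ofReal t)) (svc R x s (ENNReal.ofReal t))) := by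
  have hr := fun t (hat : a < t) (hF : ∀ i < q, ∀ c < R.n i, s (i, c) ≠ ∞ →
      (finish x s (i, c)).toReal ≠ t) => virt_congr (L := L)
    (fun i hi => (state_eq_of_ne (h.nonneg.trans hat.le) (hF i hi)).1)
    (fun i hi => (state_eq_of_ne (h.nonneg.trans hat.le) (hF i hi)).2)
  exact ⟨⟨hties, fun p t hp hpt ht hF => (h.virt_left_eq hs hx hd hA hp hpt ht hF).1,
      fun t hat _ hF => (hr t hat hF).1⟩,
    ⟨hties, fun p t hp hpt ht hF => (h.virt_left_eq hs hx hd hA hp hpt ht hF).2,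
      fun t hat _ hF => (hr t hat hF).2⟩⟩

end

variable {𝒰 : Type*} [MeasurableSpace 𝒰] {R : RequestSeq} {N L q K : ℕ} {μ B : ℝ}
  {S : 𝒰 × (Chunk → ℝ) → Schedule} {Q : Measure (𝒰 × (Chunk → ℝ))} {v : Multiset ℕ → ℝ} {a b : ℝ}

/-- The schedules of a policy that follows SEDPT-R. -/
def IsSEDPT (R : RequestSeq) (N L : ℕ) (S : 𝒰 × (Chunk → ℝ) → Schedule) : Prop :=
  ∀ u x, (∀ c, 0 < x c) → ∀ t : ℝ≥0, SEDPTAssignment R N x (S (u, x)) L t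

/-- The virtual state of SEDPT-R follows shortest-remaining-first service at full rate. -/
lemma lintegral_virt_le [IsProbabilityMeasure Q] (hS : OnlineSchedule R N L S)
    (hA : IsSEDPT R N L S) (hd : ∀ i < N, L ≤ R.d i) (hμ : 0 < μ)
    (hQ : Resample μ Q) (hst : Stage R N q a b) (hv : Monot B v)
    (hK : ∑ j ∈ Finset.range N, R.k j ≤ K) :
    ∫⁻ p, ENNReal.ofReal (v (virt L q (rem R p.2 (S p) (ENNReal.ofReal b))
        (svc R p.2 (S p) (ENNReal.ofReal b)))) ∂Q ≤
      ∫⁻ p, ENNReal.ofReal (valueFn K v (L * μ) b a (virt L q (rem R p.2 (S p) (ENNReal.ofReal a))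
        (svc R p.2 (S p) (ENNReal.ofReal a)))) ∂Q := by
  have hlam : 0 ≤ L * μ := by positivity
  set f := valueFn K v (L * μ) b with hf
  set l : 𝒰 × (Chunk → ℝ) → ℝ → Multiset ℕ := fun p t =>
    virt L q (remLeft R p.2 (S p) (ENNReal.ofReal t)) (svcLeft R p.2 (S p) (ENNReal.ofReal t))
    with hl
  set G : ℕ → 𝒰 × (Chunk → ℝ) → ℝ → ℝ := fun _ p t => max 0 (f t (l p t) - f t (step (l p t)))
    with hG
  set g : ℕ → (𝒰 × (Chunk → ℝ)) × ℝ → ℝ≥0∞ := fun i y => ENNReal.ofReal (G i y.1 y.2) with hg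
  have hfm : ∀ r, Measurable fun t => f t r := fun r => (continuous_valueFn _ b r).measurable
  have hlm : Measurable fun y : (𝒰 × (Chunk → ℝ)) × ℝ => l y.1 y.2 :=
    measurable_virt L q (fun j => measurable_remLeft hS j) fun j => measurable_svcLeft hS j
  have hgm : ∀ i, Measurable (g i) := fun i => ENNReal.measurable_ofReal.comp
    (measurable_const.max ((measurable_comp_multiset hfm measurable_snd hlm).sub
      (measurable_comp_multiset hfm measurable_snd
        ((Measurable.of_discrete (f := step)).comp hlm))))
  have hgp : ∀ i, Predictable S (g i) := fun i u x x' t h => by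
    have e := predictable_remLeft (R := R) u x x' t h
    have e' := predictable_svcLeft (R := R) u x x' t h
    simp only at e e'
    simp only [hg, hG, hl, e, e']
  have hJ := lintegral_downloadSum hS hμ hQ q hst.nonneg (b := b) hgm hgp
  have hmax : ∀ p t, t ≤ b → G 0 p t = f t (l p t) - f t (step (l p t)) := fun p t ht =>
    max_eq_right (sub_nonneg.2 ((hv.valueFn hlam ht).mono (dom_step_self _)))
  have hJI : ∫⁻ p, downloadSum R S q a b g p ∂Q =
      ∫⁻ p, (∫⁻ t in Set.Ioc a b, ENNReal.ofReal (valueRate K v (L * μ) b t (l p t))) ∂Q := by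
    rw [hJ, ← lintegral_const_mul' _ _ ENNReal.ofReal_ne_top]
    refine lintegral_congr_ae ?_
    filter_upwards [hQ.ae_pos] with p hp
    rw [← lintegral_const_mul' _ _ ENNReal.ofReal_ne_top]
    refine setLIntegral_congr_fun measurableSet_Ioc fun t ht => ?_
    have hfs := hS.feasible p.1 p.2 hp
    have hG0 : ∀ i, G i p t = G 0 p t := fun _ => rfl
    simp only [hg, hG0]
    rw [← Finset.sum_mul, valueRate, mul_assoc (L : ℝ), ENNReal.ofReal_mul (by positivity),
      ENNReal.ofReal_mul hμ.le, ENNReal.ofReal_natCast]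
    rw [← mul_assoc, mul_comm (ENNReal.ofReal μ), mul_assoc, hmax p t ht.2]
    -- With an unfinished request all L threads are busy and the total rate is exactly L μ; without
    -- one, a step does nothing and both sides vanish.
    by_cases h0 : ∃ j < q, 0 < remLeft R p.2 (S p) (ENNReal.ofReal t) j
    · obtain ⟨j, hj, hj0⟩ := h0
      rw [← Nat.cast_sum, hst.sum_svcLeft_eq hfs hp hd (hA p.1 p.2 hp) ht.1 ht.2 hj hj0]
    · push Not at h0
      have e : step (l p t) = l p t := step_virt_of_forall fun j hj => not_lt.2 (h0 j hj)
      rw [e, hf, sub_self]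
      simp
  have hpath : ∀ᵐ p ∂Q, ENNReal.ofReal (f b (virt L q (rem R p.2 (S p) (ENNReal.ofReal b))
      (svc R p.2 (S p) (ENNReal.ofReal b)))) + downloadSum R S q a b g p ≤
      ENNReal.ofReal (f a (virt L q (rem R p.2 (S p) (ENNReal.ofReal a))
      (svc R p.2 (S p) (ENNReal.ofReal a)))) +
      ∫⁻ t in Set.Ioc a b, ENNReal.ofReal (valueRate K v (L * μ) b t (l p t)) := by
    filter_upwards [hQ.ae_pos, ae_finish_ne hS hQ] with p hp hties
    have hfs := hS.feasible p.1 p.2 hp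
    have htr := (hst.trajectory_virt hfs hp hd (hA p.1 p.2 hp) hties).1
    refine htr.le_add hst (hv.timeDeriv hlam fun t => (sum_virt_le L q _ _).trans
        (sum_rem_le hst.le hK _)) ((hv.valueFn hlam le_rfl).nonneg _) (G := fun i => G i p)
      (fun i t => rfl) (fun i _ t _ _ => le_max_left _ _) fun i hi c hc hne t hat htb hfin => ?_
    obtain ⟨h1, h2⟩ := hst.virt_jump hfs hp hties hi hc hne hat hfin
    split_ifs with hk
    · rw [(h1 hk).1]
      exact (hmax p t htb).le
    · rw [(h2 hk).1, sub_self]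
  have hint := lintegral_mono_ae hpath
  have hIm : AEMeasurable (fun p => ∫⁻ t in Set.Ioc a b,
      ENNReal.ofReal (valueRate K v (L * μ) b t (l p t))) Q := by
    refine (Measurable.lintegral_prod_right' (f := fun y : (𝒰 × (Chunk → ℝ)) × ℝ =>
      ENNReal.ofReal (valueRate K v (L * μ) b y.2 (l y.1 y.2))) ?_).aemeasurable
    exact ENNReal.measurable_ofReal.comp (measurable_comp_multiset
      (fun r => (continuous_valueRate _ b r).measurable) measurable_snd hlm)
  rw [lintegral_add_right' _ hIm, lintegral_add_right _ (measurable_downloadSum hS q a b hgm),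
    hJI] at hint
  have hne := lintegral_valueRate_ne_top (a := a) (b := b) (K := K) (Q := Q) hv hlam l
  have := ENNReal.le_of_add_le_add_right hne hint
  simpa only [hf, valueFn_self] using this

/-- A quantity `Ψ` that decreases at the downloads under SEDPT-R bounds the integral of the
decrements. -/
lemma lintegral_decrease_le [IsProbabilityMeasure Q] (hS : OnlineSchedule R N L S)
    (hA : IsSEDPT R N L S) (hd : ∀ i < N, L ≤ R.d i) (hμ : 0 < μ)
    (hQ : Resample μ Q) (hst : Stage R N q a b) {H : Multiset ℕ → Multiset ℕ → ℕ}
    (hH : ∀ r r', posCount r = 0 → H r r' = 0) {Ψ : (ℕ → ℕ) → (ℕ → ℕ) → ℕ}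
    (htr : ∀ p : 𝒰 × (Chunk → ℝ), (∀ c, 0 < p.2 c) → Feasible R N p.2 (S p) L →
      (∀ t, SEDPTAssignment R N p.2 (S p) L t) →
      (∀ c c', c ≠ c' → S p c ≠ ∞ → finish p.2 (S p) c ≠ finish p.2 (S p) c') →
      Trajectory R p.2 (S p) q a b
        (fun t => Ψ (remLeft R p.2 (S p) (ENNReal.ofReal t)) (svcLeft R p.2 (S p) (ENNReal.ofReal t)))
        (fun t => Ψ (rem R p.2 (S p) (ENNReal.ofReal t)) (svc R p.2 (S p) (ENNReal.ofReal t))))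
    (hjump : ∀ p : 𝒰 × (Chunk → ℝ), (∀ c, 0 < p.2 c) → Feasible R N p.2 (S p) L →
      (∀ c c', c ≠ c' → S p c ≠ ∞ → finish p.2 (S p) c ≠ finish p.2 (S p) c') →
      ∀ i < q, ∀ c < R.n i, S p (i, c) ≠ ∞ → ∀ t, a < t →
      finish p.2 (S p) (i, c) = ENNReal.ofReal t →
      (downloadedLt R p.2 (S p) (ENNReal.ofReal t) i < R.k i →
        Ψ (rem R p.2 (S p) (ENNReal.ofReal t)) (svc R p.2 (S p) (ENNReal.ofReal t)) +
          H (load q (remLeft R p.2 (S p) (ENNReal.ofReal t)))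
            (virt L q (remLeft R p.2 (S p) (ENNReal.ofReal t))
              (svcLeft R p.2 (S p) (ENNReal.ofReal t))) ≤
        Ψ (remLeft R p.2 (S p) (ENNReal.ofReal t)) (svcLeft R p.2 (S p) (ENNReal.ofReal t))) ∧
      (¬downloadedLt R p.2 (S p) (ENNReal.ofReal t) i < R.k i →
        Ψ (rem R p.2 (S p) (ENNReal.ofReal t)) (svc R p.2 (S p) (ENNReal.ofReal t)) =
        Ψ (remLeft R p.2 (S p) (ENNReal.ofReal t)) (svcLeft R p.2 (S p) (ENNReal.ofReal t)))) :
    ∫⁻ p, (Ψ (rem R p.2 (S p) (ENNReal.ofReal b)) (svc R p.2 (S p) (ENNReal.ofReal b)) : ℝ≥0∞) ∂Q +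
      ENNReal.ofReal μ * L * ∫⁻ t in Set.Ioc a b, (∫⁻ p, (H (load q (rem R p.2 (S p)
        (ENNReal.ofReal t))) (virt L q (rem R p.2 (S p) (ENNReal.ofReal t))
          (svc R p.2 (S p) (ENNReal.ofReal t))) : ℝ≥0∞) ∂Q) ≤
      ∫⁻ p, (Ψ (rem R p.2 (S p) (ENNReal.ofReal a)) (svc R p.2 (S p) (ENNReal.ofReal a)) : ℝ≥0∞) ∂Q
      := by
  classical
  set h : 𝒰 × (Chunk → ℝ) → ℝ → ℕ := fun p t => H (load q (remLeft R p.2 (S p) (ENNReal.ofReal t)))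
    (virt L q (remLeft R p.2 (S p) (ENNReal.ofReal t)) (svcLeft R p.2 (S p) (ENNReal.ofReal t)))
    with hh
  set G : ℕ → 𝒰 × (Chunk → ℝ) → ℝ → ℝ := fun _ p t => h p t with hG
  set g : ℕ → (𝒰 × (Chunk → ℝ)) × ℝ → ℝ≥0∞ := fun i y => ENNReal.ofReal (G i y.1 y.2) with hg
  have hHm : Measurable fun z : Multiset ℕ × Multiset ℕ => H z.1 z.2 := Measurable.of_discrete
  have hhm : Measurable fun y : (𝒰 × (Chunk → ℝ)) × ℝ => h y.1 y.2 :=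
    hHm.comp ((measurable_load q fun j => measurable_remLeft hS j).prodMk
      (measurable_virt L q (fun j => measurable_remLeft hS j) fun j => measurable_svcLeft hS j))
  have hgm : ∀ i, Measurable (g i) := fun i => ENNReal.measurable_ofReal.comp
    ((Measurable.of_discrete (f := fun n : ℕ => (n : ℝ))).comp hhm)
  have hgp : ∀ i, Predictable S (g i) := fun i u x x' t hsb => by
    have e := predictable_remLeft (R := R) u x x' t hsb
    have e' := predictable_svcLeft (R := R) u x x' t hsb
    simp only at e e'
    simp only [hg, hG, hh, e, e']
  have hJ := lintegral_downloadSum hS hμ hQ q hst.nonneg (b := b) hgm hgp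
  have hJI : ∫⁻ p, downloadSum R S q a b g p ∂Q = ENNReal.ofReal μ * L *
      ∫⁻ p, (∫⁻ t in Set.Ioc a b, (h p t : ℝ≥0∞)) ∂Q := by
    rw [hJ, mul_assoc, ← lintegral_const_mul' _ _ (ENNReal.natCast_ne_top L)]
    congr 1
    refine lintegral_congr_ae ?_
    filter_upwards [hQ.ae_pos] with p hp
    rw [← lintegral_const_mul' _ _ (ENNReal.natCast_ne_top L)]
    refine setLIntegral_congr_fun measurableSet_Ioc fun t ht => ?_
    have hfs := hS.feasible p.1 p.2 hp
    simp only [hg, hG, ENNReal.ofReal_natCast]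
    rw [← Finset.sum_mul]
    by_cases h0 : ∃ j < q, 0 < remLeft R p.2 (S p) (ENNReal.ofReal t) j
    · obtain ⟨j, hj, hj0⟩ := h0
      rw [← Nat.cast_sum, hst.sum_svcLeft_eq hfs hp hd (hA p.1 p.2 hp) ht.1 ht.2 hj hj0]
    · push Not at h0
      have e : h p t = 0 := hH _ _ (posCount_load_eq_zero fun j hj => not_lt.2 (h0 j hj))
      simp [e]
  have hswap : ∫⁻ p, (∫⁻ t in Set.Ioc a b, (h p t : ℝ≥0∞)) ∂Q =
      ∫⁻ t in Set.Ioc a b, (∫⁻ p, (H (load q (rem R p.2 (S p)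
        (ENNReal.ofReal t))) (virt L q (rem R p.2 (S p) (ENNReal.ofReal t))
          (svc R p.2 (S p) (ENNReal.ofReal t))) : ℝ≥0∞) ∂Q) := by
    set k : 𝒰 × (Chunk → ℝ) → ℝ → ℕ := fun p t => H (load q (rem R p.2 (S p) (ENNReal.ofReal t)))
      (virt L q (rem R p.2 (S p) (ENNReal.ofReal t)) (svc R p.2 (S p) (ENNReal.ofReal t)))
      with hk
    have hkm : Measurable fun y : (𝒰 × (Chunk → ℝ)) × ℝ => k y.1 y.2 :=
      hHm.comp ((measurable_load q fun j => measurable_rem hS j).prodMk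
        (measurable_virt L q (fun j => measurable_rem hS j) fun j => measurable_svc hS j))
    have hkm' : Measurable fun y : (𝒰 × (Chunk → ℝ)) × ℝ => (k y.1 y.2 : ℝ≥0∞) :=
      (Measurable.of_discrete (f := fun n : ℕ => (n : ℝ≥0∞))).comp hkm
    rw [← lintegral_lintegral_swap (f := fun p t => (k p t : ℝ≥0∞)) hkm'.aemeasurable]
    refine lintegral_congr fun p => setLIntegral_congr_fun_ae measurableSet_Ioc ?_
    set F : Finset ℝ := (Finset.range q).biUnion fun i => (Finset.range (R.n i)).image
      fun c => (finish p.2 (S p) (i, c)).toReal with hF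
    -- The state differs from its left limit at finitely many times only, which form a null set.
    filter_upwards [F.countable_toSet.ae_notMem volume] with t ht hat
    have e : ∀ i < q, rem R p.2 (S p) (ENNReal.ofReal t) i = remLeft R p.2 (S p) (ENNReal.ofReal t) i ∧
        svc R p.2 (S p) (ENNReal.ofReal t) i = svcLeft R p.2 (S p) (ENNReal.ofReal t) i :=
      fun i hi => state_eq_of_ne (hst.nonneg.trans hat.1.le) fun c hc _ he => ht (by
        rw [hF, Finset.mem_coe, Finset.mem_biUnion]
        exact ⟨i, Finset.mem_range.2 hi, Finset.mem_image.2 ⟨c, Finset.mem_range.2 hc, he⟩⟩)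
    simp only [hh, hk]
    rw [load_congr fun j hj => (e j hj).1,
      (virt_congr (L := L) (fun j hj => (e j hj).1) fun j hj => (e j hj).2).1]
  have hpath : ∀ᵐ p ∂Q, (Ψ (rem R p.2 (S p) (ENNReal.ofReal b))
        (svc R p.2 (S p) (ENNReal.ofReal b)) : ℝ≥0∞) + downloadSum R S q a b g p ≤
      Ψ (rem R p.2 (S p) (ENNReal.ofReal a)) (svc R p.2 (S p) (ENNReal.ofReal a)) := by
    filter_upwards [hQ.ae_pos, ae_finish_ne hS hQ] with p hp hties
    have hfs := hS.feasible p.1 p.2 hp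
    have := Trajectory.le_add (f := fun _ (n : ℕ) => (n : ℝ)) (f' := fun _ _ => 0) (g := g)
      (htr p hp hfs (hA p.1 p.2 hp) hties) hst
      ⟨fun _ _ _ _ => hasDerivAt_const _ _, fun _ _ _ => continuous_const, fun _ _ _ => le_rfl⟩
      (Nat.cast_nonneg _) (G := fun i => G i p) (fun i t => rfl)
      (fun i _ t _ _ => Nat.cast_nonneg _) fun i hi c hc hne t hat htb hfin => by
        obtain ⟨h1, h2⟩ := hjump p hp hfs hties i hi c hc hne t hat hfin
        split_ifs with hk
        · exact le_sub_iff_add_le'.2 (by simp only [hG]; exact_mod_cast h1 hk)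
        · exact (sub_eq_zero.2 (congrArg _ (h2 hk).symm)).ge
    simpa using this
  have hint := lintegral_mono_ae hpath
  rwa [lintegral_add_right _ (measurable_downloadSum hS q a b hgm), hJI, hswap] at hint

/-- The potential bounds the time that requests spend unfinished but virtually finished. -/
lemma lintegral_potential_le [IsProbabilityMeasure Q] (hS : OnlineSchedule R N L S)
    (hA : IsSEDPT R N L S) (hd : ∀ i < N, L ≤ R.d i) (hμ : 0 < μ)
    (hQ : Resample μ Q) (hst : Stage R N q a b) :
    ∫⁻ p, (potential L q (rem R p.2 (S p) (ENNReal.ofReal b))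
        (svc R p.2 (S p) (ENNReal.ofReal b)) : ℝ≥0∞) ∂Q +
      ENNReal.ofReal μ * L * ∫⁻ t in Set.Ioc a b, (∫⁻ p, ((posCount (load q (rem R p.2 (S p)
        (ENNReal.ofReal t))) - posCount (virt L q (rem R p.2 (S p) (ENNReal.ofReal t))
          (svc R p.2 (S p) (ENNReal.ofReal t))) : ℕ) : ℝ≥0∞) ∂Q) ≤
      ∫⁻ p, (potential L q (rem R p.2 (S p) (ENNReal.ofReal a))
        (svc R p.2 (S p) (ENNReal.ofReal a)) : ℝ≥0∞) ∂Q := by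
  refine lintegral_decrease_le hS hA hd hμ hQ hst (H := fun r r' => posCount r - posCount r')
    (Ψ := potential L q) (fun r r' h => by simp [h])
    (fun p hp hfs hAp hties => (hst.trajectory_virt hfs hp hd hAp hties).2)
    fun p hp hfs hties i hi c hc hne t hat hfin => ?_
  obtain ⟨h1, h2⟩ := hst.virt_jump hfs hp hties hi hc hne hat hfin
  refine ⟨fun hk => ?_, fun hk => (h2 hk).2⟩
  have h3 := (h1 hk).2
  have h4 := posCount_virt_le L q (remLeft R p.2 (S p) (ENNReal.ofReal t))
    (svcLeft R p.2 (S p) (ENNReal.ofReal t))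
  omega

/-- The number of remaining chunks bounds the time during which there are unfinished requests. -/
lemma lintegral_sum_rem_le [IsProbabilityMeasure Q] (hS : OnlineSchedule R N L S)
    (hA : IsSEDPT R N L S) (hd : ∀ i < N, L ≤ R.d i) (hμ : 0 < μ)
    (hQ : Resample μ Q) (hst : Stage R N q a b) :
    ∫⁻ p, (∑ j ∈ Finset.range q, rem R p.2 (S p) (ENNReal.ofReal b) j : ℕ) ∂Q +
      ENNReal.ofReal μ * L * ∫⁻ t in Set.Ioc a b, (∫⁻ p, (min 1 (posCount (load q (rem R p.2 (S p)
        (ENNReal.ofReal t)))) : ℕ) ∂Q) ≤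
      ∫⁻ p, (∑ j ∈ Finset.range q, rem R p.2 (S p) (ENNReal.ofReal a) j : ℕ) ∂Q := by
  refine lintegral_decrease_le hS hA hd hμ hQ hst (H := fun r _ => min 1 (posCount r))
    (Ψ := fun α _ => ∑ j ∈ Finset.range q, α j) (fun r r' h => by simp [h])
    (fun p hp hfs hAp hties => ⟨hties, fun p' t hp' hpt ht hF => ?_, fun t hat htb hF => ?_⟩)
    fun p hp hfs hties i hi c hc hne t hat hfin => ?_
  · simp only [hst.remLeft_eq hfs hp' hpt ht hF]
  · exact Finset.sum_congr rfl fun j hj =>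
      (state_eq_of_ne (hst.nonneg.trans hat.le) (hF j (Finset.mem_range.1 hj))).1
  · obtain ⟨h1, h2, h3⟩ := state_at_finish hp hties hc hne hfin
    refine ⟨fun hk => ?_, fun hk => Finset.sum_congr rfl fun j _ => ?_⟩
    · obtain ⟨e1, -, e2, -⟩ := h1 hk
      have := sum_range_eq_of_eq_add (c := 1) hi (f := rem R p.2 (S p) (ENNReal.ofReal t))
        (f' := remLeft R p.2 (S p) (ENNReal.ofReal t)) (by omega) fun j hj => ((h3 j hj).1).symm
      omega
    · rcases eq_or_ne j i with rfl | hj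
      · exact (h2 hk).1
      · exact (h3 j hj).1

end

/-! ### From stages to the whole time axis -/

section

section Arrivals

variable {R : RequestSeq} {N L q : ℕ} {a b τ : ℝ}

/-- The number of requests that arrive before time `τ`. -/
def arrivedCount (R : RequestSeq) (N : ℕ) (τ : ℝ) : ℕ :=
  ((Finset.range N).filter fun j => (R.a j : ℝ) < τ).card

lemma arrivedCount_le : arrivedCount R N τ ≤ N :=
  (Finset.card_filter_le _ _).trans (Finset.card_range N).le

lemma lt_arrivedCount_iff {j : ℕ} (hj : j < N) : j < arrivedCount R N τ ↔ (R.a j : ℝ) < τ := by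
  constructor
  · intro h
    by_contra hτ
    refine absurd h (not_lt.2 ?_)
    conv_rhs => rw [← Finset.card_range j]
    refine Finset.card_le_card fun i hi => Finset.mem_range.2 ?_
    by_contra hij
    have h1 : (R.a j : ℝ) ≤ R.a i := by exact_mod_cast R.mono (not_lt.1 hij)
    exact hτ (h1.trans_lt (Finset.mem_filter.1 hi).2)
  · intro h
    rw [← Nat.succ_le_iff]
    conv_lhs => rw [← Finset.card_range j.succ]
    refine Finset.card_le_card fun i hi => ?_
    have hij : i ≤ j := Nat.lt_succ_iff.1 (Finset.mem_range.1 hi)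
    have h1 : (R.a i : ℝ) ≤ R.a j := by exact_mod_cast R.mono hij
    exact Finset.mem_filter.2 ⟨Finset.mem_range.2 (hij.trans_lt hj), h1.trans_lt h⟩

lemma stage_arrivedCount (hτ : 0 ≤ τ) : Stage R N (arrivedCount R N τ) τ τ where
  le := arrivedCount_le
  nonneg := hτ
  le' := le_rfl
  arrived _ hj := ((lt_arrivedCount_iff (hj.trans_le arrivedCount_le)).1 hj).le
  not_arrived _ hj hjN := not_lt.1 fun h => absurd ((lt_arrivedCount_iff hjN).2 h) (not_lt.2 hj)

/-- The strict inequality in `arrivedCount` fits intervals (a, b]: a request that arrives at `b` is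
not counted yet. -/
lemma Stage.arrivedCount_eq (h : Stage R N q a b) (hat : a < τ) (hτ : τ ≤ b) :
    arrivedCount R N τ = q := by
  refine le_antisymm (not_lt.1 fun hq => ?_) (not_lt.1 fun hq => ?_)
  · have hqN := hq.trans_le arrivedCount_le
    exact absurd ((lt_arrivedCount_iff hqN).1 hq) (not_lt.2 (hτ.trans (h.not_arrived q le_rfl hqN)))
  · exact absurd ((lt_arrivedCount_iff (hq.trans_le h.le)).2 ((h.arrived _ hq).trans_lt hat))
      (lt_irrefl _)

/-- The state just before request `q` is added. The inequalities in `Stage` are weak, so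
simultaneous arrivals give stages of length zero. -/
lemma stage_at_arrival (hq : q < N) : Stage R N q (R.a q) (R.a q) where
  le := hq.le
  nonneg := (R.a q).2
  le' := le_rfl
  arrived _ hj := by exact_mod_cast R.mono hj.le
  not_arrived _ hj _ := by exact_mod_cast R.mono hj

lemma Stage.from_arrival {t : ℝ} (h : Stage R N (q + 1) t t) : Stage R N (q + 1) (R.a q) t where
  le := h.le
  nonneg := (R.a q).2
  le' := h.arrived q (Nat.lt_succ_self q)
  arrived j hj := by exact_mod_cast R.mono (Nat.lt_succ_iff.1 hj)
  not_arrived := h.not_arrived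

/-- Adding up a bound on the stages. -/
lemma add_lintegral_le_sum (hN : 1 ≤ N) {A : ℕ → ℝ → ℝ≥0∞} {h : ℕ → ℝ → ℝ≥0∞} {C : ℝ≥0∞}
    {w : ℕ → ℝ≥0∞} (hstep : ∀ q a b, Stage R N q a b →
      A q b + C * ∫⁻ t in Set.Ioc a b, h q t ≤ A q a)
    (harr : ∀ q < N, A (q + 1) (R.a q) ≤ A q (R.a q) + w q) (h0 : A 0 0 = 0) :
    ∀ q t, Stage R N q t t →
      A q t + C * ∫⁻ τ in Set.Ioc 0 t, h (arrivedCount R N τ) τ ≤ ∑ i ∈ Finset.range q, w i := by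
  intro q
  induction q with
  | zero =>
    intro t hst
    have h1 := hst.not_arrived 0 le_rfl hN
    rw [R.first, NNReal.coe_zero] at h1
    obtain rfl : t = 0 := le_antisymm h1 hst.nonneg
    simp [h0]
  | succ q ih =>
    intro t hst
    have hqN : q < N := hst.le
    have hst' := hst.from_arrival
    have e : Set.Ioc 0 t = Set.Ioc 0 (R.a q : ℝ) ∪ Set.Ioc (R.a q : ℝ) t :=
      (Set.Ioc_union_Ioc_eq_Ioc (R.a q).2 hst'.le').symm
    have e2 : ∫⁻ τ in Set.Ioc (R.a q : ℝ) t, h (arrivedCount R N τ) τ =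
        ∫⁻ τ in Set.Ioc (R.a q : ℝ) t, h (q + 1) τ :=
      setLIntegral_congr_fun measurableSet_Ioc fun τ hτ => by
        simp only [hst'.arrivedCount_eq hτ.1 hτ.2]
    rw [e, lintegral_union measurableSet_Ioc (Set.Ioc_disjoint_Ioc_of_le le_rfl), e2,
      Finset.sum_range_succ, mul_add]
    calc _ = (A (q + 1) t + C * ∫⁻ τ in Set.Ioc (R.a q : ℝ) t, h (q + 1) τ) +
          C * ∫⁻ τ in Set.Ioc 0 (R.a q : ℝ), h (arrivedCount R N τ) τ := by ring
      _ ≤ A q (R.a q) + w q + C * ∫⁻ τ in Set.Ioc 0 (R.a q : ℝ), h (arrivedCount R N τ) τ := by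
          exact add_le_add ((hstep _ _ _ hst').trans (harr q hqN)) le_rfl
      _ = (A q (R.a q) + C * ∫⁻ τ in Set.Ioc 0 (R.a q : ℝ), h (arrivedCount R N τ) τ) + w q := by
          ring
      _ ≤ _ := by
          gcongr
          exact ih _ (stage_at_arrival hqN)

lemma lintegral_Ioi_le {h : ℝ → ℝ≥0∞} {C W : ℝ≥0∞}
    (hW : ∀ t, 0 ≤ t → C * ∫⁻ τ in Set.Ioc 0 t, h τ ≤ W) : C * ∫⁻ τ in Set.Ioi 0, h τ ≤ W := by
  have e : Set.Ioi (0 : ℝ) = ⋃ n : ℕ, Set.Ioc 0 (n : ℝ) := by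
    ext t
    simp only [Set.mem_Ioi, Set.mem_iUnion, Set.mem_Ioc, exists_and_left, iff_self_and]
    exact fun _ => exists_nat_ge t
  rw [e, setLIntegral_iUnion_of_directed _ (Monotone.directed_le fun m n hmn =>
    Set.Ioc_subset_Ioc_right (Nat.cast_le.2 hmn)), ENNReal.mul_iSup]
  exact iSup_le fun n => hW n (Nat.cast_nonneg n)

lemma lintegral_Ioi_le_sum (hN : 1 ≤ N) {A : ℕ → ℝ → ℝ≥0∞} {h : ℕ → ℝ → ℝ≥0∞} {C : ℝ≥0∞}
    {w : ℕ → ℝ≥0∞} (hstep : ∀ q a b, Stage R N q a b →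
      A q b + C * ∫⁻ t in Set.Ioc a b, h q t ≤ A q a)
    (harr : ∀ q < N, A (q + 1) (R.a q) ≤ A q (R.a q) + w q) (h0 : A 0 0 = 0) :
    C * ∫⁻ τ in Set.Ioi 0, h (arrivedCount R N τ) τ ≤ ∑ i ∈ Finset.range N, w i :=
  lintegral_Ioi_le fun t ht => le_add_self.trans
    ((add_lintegral_le_sum hN hstep harr h0 _ t (stage_arrivedCount ht)).trans
      (Finset.sum_le_sum_of_subset (Finset.range_mono arrivedCount_le)))

end Arrivals

/-! ### Comparison of policies and flow times -/

variable {𝒰 : Type*} [MeasurableSpace 𝒰] {R : RequestSeq} {N L q : ℕ} {μ B : ℝ}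
  {S S' : 𝒰 × (Chunk → ℝ) → Schedule} {Q : Measure (𝒰 × (Chunk → ℝ))}

/-- In the virtual state, SEDPT-R is better than any online policy. -/
lemma lintegral_virt_le_load [IsProbabilityMeasure Q] (hS : OnlineSchedule R N L S)
    (hA : IsSEDPT R N L S) (hd : ∀ i < N, L ≤ R.d i) (hμ : 0 < μ) (hQ : Resample μ Q)
    (hS' : OnlineSchedule R N L S') : ∀ q (t : ℝ) (v : Multiset ℕ → ℝ), Monot B v →
      Stage R N q t t →
      ∫⁻ p, ENNReal.ofReal (v (virt L q (rem R p.2 (S p) (ENNReal.ofReal t))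
        (svc R p.2 (S p) (ENNReal.ofReal t)))) ∂Q ≤
      ∫⁻ p, ENNReal.ofReal (v (load q (rem R p.2 (S' p) (ENNReal.ofReal t)))) ∂Q := by
  intro q
  induction q with
  | zero =>
    intro t v _ _
    refine lintegral_mono fun p => ENNReal.ofReal_le_ofReal (le_of_eq (congrArg v ?_))
    rw [Multiset.card_eq_zero.1 (card_virt L 0 _ _), Multiset.card_eq_zero.1 (card_load 0 _)]
  | succ q ih =>
    intro t v hv hst
    have hqN : q < N := hst.le
    have hst' := hst.from_arrival
    set K := ∑ j ∈ Finset.range N, R.k j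
    have hlam : 0 ≤ L * μ := by positivity
    have hm := hv.valueFn (K := K) hlam hst'.le'
    refine (lintegral_virt_le hS hA hd hμ hQ hst' hv le_rfl).trans (le_trans ?_
      (lintegral_load_ge hS' hμ hQ hst' hv le_rfl))
    -- Over the last stage both policies are compared with the same value function. At the arrival
    -- of `q` the induction hypothesis is applied to that function precomposed with adding the entry
    -- `k q`.
    refine le_trans (lintegral_mono_ae ?_) ((ih _ _ (hm.cons (R.k q))
      (stage_at_arrival hqN)).trans (lintegral_mono_ae ?_))
    · filter_upwards [hQ.ae_pos] with p hp
      have hfs := hS.feasible p.1 p.2 hp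
      rw [ENNReal.ofReal_coe_nnreal]
      have h1 := (virt_arrival (L := L) (α := rem R p.2 (S p) (R.a q))
        (svc_eq_zero hfs (t := R.a q) (i := q) fun _ => le_rfl)).1
      rw [rem_eq_of_le_arrival hfs hp (t := R.a q) (i := q) fun _ => le_rfl] at h1
      exact ENNReal.ofReal_le_ofReal (hm.mono h1)
    · filter_upwards [hQ.ae_pos] with p hp
      have hfs := hS'.feasible p.1 p.2 hp
      rw [ENNReal.ofReal_coe_nnreal, load_succ,
        rem_eq_of_le_arrival hfs hp (t := R.a q) (i := q) fun _ => le_rfl]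

/-- The expected number of unfinished requests at time `t`. -/
def meanUnfinished (R : RequestSeq) (N : ℕ) (S : 𝒰 × (Chunk → ℝ) → Schedule)
    (Q : Measure (𝒰 × (Chunk → ℝ))) (t : ℝ) : ℝ≥0∞ :=
  ∫⁻ p, posCount (load (arrivedCount R N t) (rem R p.2 (S p) (ENNReal.ofReal t))) ∂Q

/-- The expected number of requests that are unfinished, but finished in the virtual state. -/
def meanHidden (R : RequestSeq) (S : 𝒰 × (Chunk → ℝ) → Schedule)
    (Q : Measure (𝒰 × (Chunk → ℝ))) (L q : ℕ) (t : ℝ) : ℝ≥0∞ :=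
  ∫⁻ p, (posCount (load q (rem R p.2 (S p) (ENNReal.ofReal t))) -
    posCount (virt L q (rem R p.2 (S p) (ENNReal.ofReal t))
      (svc R p.2 (S p) (ENNReal.ofReal t))) : ℕ) ∂Q

lemma measurable_natCast_lintegral [SFinite Q] {f : 𝒰 × (Chunk → ℝ) → ℝ → ℕ}
    (hf : Measurable fun y : (𝒰 × (Chunk → ℝ)) × ℝ => f y.1 y.2) :
    Measurable fun t => ∫⁻ p, (f p t : ℝ≥0∞) ∂Q :=
  Measurable.lintegral_prod_left' ((Measurable.of_discrete (f := fun n : ℕ => (n : ℝ≥0∞))).comp hf)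

lemma measurable_section {f : 𝒰 × (Chunk → ℝ) → ℝ → ℕ} (t : ℝ)
    (hf : Measurable fun y : (𝒰 × (Chunk → ℝ)) × ℝ => f y.1 y.2) :
    Measurable fun p => (f p t : ℝ≥0∞) :=
  (Measurable.of_discrete (f := fun n : ℕ => (n : ℝ≥0∞))).comp
    (hf.comp (measurable_id.prodMk measurable_const))

/-- The N arrivals raise the potential by at most N L in total, and it is consumed at rate L μ times
the hidden number. -/
lemma lintegral_meanHidden_le [IsProbabilityMeasure Q] (hN : 1 ≤ N) (hL : 1 ≤ L)
    (hS : OnlineSchedule R N L S)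
    (hA : IsSEDPT R N L S) (hd : ∀ i < N, L ≤ R.d i) (hμ : 0 < μ) (hQ : Resample μ Q) :
    ∫⁻ t in Set.Ioi 0, meanHidden R S Q L (arrivedCount R N t) t ≤ N * ENNReal.ofReal (1 / μ) := by
  have h := lintegral_Ioi_le_sum hN (R := R) (C := ENNReal.ofReal μ * L) (w := fun _ => (L : ℝ≥0∞))
    (A := fun q t => ∫⁻ p, (potential L q (rem R p.2 (S p) (ENNReal.ofReal t))
        (svc R p.2 (S p) (ENNReal.ofReal t)) : ℝ≥0∞) ∂Q) (h := meanHidden R S Q L)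
    (fun q a b hst => lintegral_potential_le hS hA hd hμ hQ hst) (fun q hq => ?_) ?_
  · rw [Finset.sum_const, Finset.card_range, nsmul_eq_mul] at h
    have hL0 : (L : ℝ≥0∞) ≠ 0 := by exact_mod_cast (by omega : L ≠ 0)
    have e1 : ENNReal.ofReal (1 / μ) * ENNReal.ofReal μ = 1 := by
      rw [← ENNReal.ofReal_mul (by positivity), one_div, inv_mul_cancel₀ hμ.ne', ENNReal.ofReal_one]
    have e2 : (L : ℝ≥0∞)⁻¹ * L = 1 := ENNReal.inv_mul_cancel hL0 (ENNReal.natCast_ne_top L)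
    set M := ∫⁻ t in Set.Ioi 0, meanHidden R S Q L (arrivedCount R N t) t
    calc M = (ENNReal.ofReal (1 / μ) * ENNReal.ofReal μ) * ((L : ℝ≥0∞)⁻¹ * L) * M := by
          rw [e1, e2, one_mul, one_mul]
      _ = ENNReal.ofReal (1 / μ) * (L : ℝ≥0∞)⁻¹ * (ENNReal.ofReal μ * L * M) := by ring
      _ ≤ ENNReal.ofReal (1 / μ) * (L : ℝ≥0∞)⁻¹ * (N * L) := by gcongr
      _ = N * ENNReal.ofReal (1 / μ) * ((L : ℝ≥0∞)⁻¹ * L) := by ring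
      _ = _ := by rw [e2, mul_one]
  · calc _ ≤ ∫⁻ p, ((potential L q (rem R p.2 (S p) (ENNReal.ofReal (R.a q)))
        (svc R p.2 (S p) (ENNReal.ofReal (R.a q))) : ℝ≥0∞) + L) ∂Q := by
          refine lintegral_mono_ae ?_
          filter_upwards [hQ.ae_pos] with p hp
          have hfs := hS.feasible p.1 p.2 hp
          rw [ENNReal.ofReal_coe_nnreal]
          exact_mod_cast (virt_arrival (L := L) (α := rem R p.2 (S p) (R.a q))
            (svc_eq_zero hfs (t := R.a q) (i := q) fun _ => le_rfl)).2
      _ = _ := by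
          rw [lintegral_add_right _ measurable_const, lintegral_const, measure_univ, mul_one]
  · have : ∀ α δ, potential L 0 α δ = 0 := fun α δ => by
      have h1 : ∀ n, step^[n] (backlog 0 α δ) = 0 := fun n =>
        Multiset.card_eq_zero.1 (by rw [card_step_iterate, backlog, card_load])
      simp [potential, load, posCount, h1]
    simp [this]

lemma meanUnfinished_le [IsProbabilityMeasure Q] (hS : OnlineSchedule R N L S)
    (hA : IsSEDPT R N L S) (hd : ∀ i < N, L ≤ R.d i) (hμ : 0 < μ) (hQ : Resample μ Q)
    (hS' : OnlineSchedule R N L S') {t : ℝ} (ht : 0 ≤ t) :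
    meanUnfinished R N S Q t ≤
      meanUnfinished R N S' Q t + meanHidden R S Q L (arrivedCount R N t) t := by
  set q := arrivedCount R N t with hq
  have hqN : q ≤ N := arrivedCount_le
  -- The cap at `N` supplies the bound required by `Monot`; it has no effect on states of at most
  -- `N` requests.
  have hv : Monot (N : ℝ) fun r => ((min (posCount r) N : ℕ) : ℝ) :=
    ⟨fun r => Nat.cast_nonneg _, fun r => Nat.cast_le.2 (min_le_right _ _),
      fun h => Nat.cast_le.2 (min_le_min_right _ h.posCount_le)⟩
  have h1 := lintegral_virt_le_load hS hA hd hμ hQ hS' q t _ hv (stage_arrivedCount ht)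
  simp only [ENNReal.ofReal_natCast] at h1
  have e1 : ∀ α δ, min (posCount (virt L q α δ)) N = posCount (virt L q α δ) := fun α δ =>
    min_eq_left ((posCount_le_card _).trans ((card_virt L q α δ).le.trans hqN))
  have e2 : ∀ α, min (posCount (load q α)) N = posCount (load q α) := fun α =>
    min_eq_left ((posCount_le_card _).trans ((card_load q α).le.trans hqN))
  simp only [e1, e2] at h1
  rw [meanUnfinished, meanUnfinished, ← hq]
  refine le_trans ?_ (add_le_add_left h1 _)
  have hm := measurable_section (f := fun p t => posCount (virt L q
    (rem R p.2 (S p) (ENNReal.ofReal t)) (svc R p.2 (S p) (ENNReal.ofReal t)))) t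
    ((Measurable.of_discrete (f := posCount)).comp
      (measurable_virt L q (fun j => measurable_rem hS j) fun j => measurable_svc hS j))
  rw [meanHidden, ← lintegral_add_left hm]
  refine lintegral_mono fun p => ?_
  have := posCount_virt_le L q (rem R p.2 (S p) (ENNReal.ofReal t))
    (svc R p.2 (S p) (ENNReal.ofReal t))
  rw [← Nat.cast_add]
  exact Nat.cast_le.2 (by omega)

/-- Whenever work is present it is done at rate L μ, so the expected busy time is at most the sum of
all k / (L μ); at most `N` requests are unfinished at any time. -/
lemma lintegral_meanUnfinished_ne_top [IsProbabilityMeasure Q] (hN : 1 ≤ N) (hL : 1 ≤ L)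
    (hS : OnlineSchedule R N L S)
    (hA : IsSEDPT R N L S) (hd : ∀ i < N, L ≤ R.d i) (hμ : 0 < μ) (hQ : Resample μ Q) :
    ∫⁻ t in Set.Ioi 0, meanUnfinished R N S Q t ≠ ∞ := by
  have h := lintegral_Ioi_le_sum hN (R := R) (C := ENNReal.ofReal μ * L)
    (w := fun q => (R.k q : ℝ≥0∞))
    (A := fun q t => ∫⁻ p, (∑ j ∈ Finset.range q, rem R p.2 (S p) (ENNReal.ofReal t) j : ℕ) ∂Q)
    (h := fun q t => ∫⁻ p, (min 1 (posCount (load q (rem R p.2 (S p) (ENNReal.ofReal t)))) : ℕ) ∂Q)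
    (fun q a b hst => lintegral_sum_rem_le hS hA hd hμ hQ hst) (fun q hq => ?_) ?_
  · have hC : ENNReal.ofReal μ * L ≠ 0 :=
      mul_ne_zero (by simpa using hμ) (by exact_mod_cast (by omega : L ≠ 0))
    have hne : ∫⁻ t in Set.Ioi 0, (∫⁻ p, (min 1 (posCount (load (arrivedCount R N t)
        (rem R p.2 (S p) (ENNReal.ofReal t)))) : ℕ) ∂Q) ≠ ∞ := fun e => by
      rw [e, ENNReal.mul_top hC, top_le_iff] at h
      exact ENNReal.sum_ne_top.2 (fun i _ => ENNReal.natCast_ne_top _) h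
    refine ne_top_of_le_ne_top (ENNReal.mul_ne_top (ENNReal.natCast_ne_top N) hne) ?_
    rw [← lintegral_const_mul' _ _ (ENNReal.natCast_ne_top N)]
    refine lintegral_mono fun t => ?_
    rw [meanUnfinished, ← lintegral_const_mul' _ _ (ENNReal.natCast_ne_top N)]
    refine lintegral_mono fun p => ?_
    rw [← Nat.cast_mul]
    refine Nat.cast_le.2 ?_
    have h1 := (posCount_le_card (load (arrivedCount R N t) (rem R p.2 (S p) (ENNReal.ofReal t)))).trans
      ((card_load _ _).le.trans (arrivedCount_le (N := N)))
    rcases Nat.eq_zero_or_pos (posCount (load (arrivedCount R N t)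
      (rem R p.2 (S p) (ENNReal.ofReal t)))) with h0 | h0
    · simp [h0]
    · rwa [min_eq_left h0, mul_one]
  · calc _ ≤ ∫⁻ p, ((∑ j ∈ Finset.range q, rem R p.2 (S p) (ENNReal.ofReal (R.a q)) j : ℕ) +
          (R.k q : ℝ≥0∞)) ∂Q := by
          refine lintegral_mono fun p => ?_
          rw [← Nat.cast_add, Finset.sum_range_succ]
          exact Nat.cast_le.2 (Nat.add_le_add_left (Nat.sub_le _ _) _)
      _ = _ := by
          rw [lintegral_add_right _ measurable_const, lintegral_const, measure_univ, mul_one]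
  · simp

lemma measurable_completion (hS : OnlineSchedule R N L S) (i : ℕ) :
    Measurable fun p => completion R p.2 (S p) i := by
  refine measurable_of_Iic fun τ => ?_
  have e : (fun p : 𝒰 × (Chunk → ℝ) => completion R p.2 (S p) i) ⁻¹' Set.Iic τ =
      {p | R.k i ≤ downloaded R p.2 (S p) i τ} := by
    ext p
    exact completion_le_iff
  rw [e]
  exact measurableSet_le measurable_const
    (measurable_card_filter fun c => measurableSet_le (measurable_finish hS (i, c)) measurable_const)

lemma lintegral_Ioi_indicator (a : ℝ≥0) (c : ℝ≥0∞) :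
    ∫⁻ t in Set.Ioi (0 : ℝ), (if (a : ℝ) < t ∧ ENNReal.ofReal t < c then 1 else 0 : ℕ) = c - a := by
  set A : Set ℝ := {t | (a : ℝ) < t ∧ ENNReal.ofReal t < c} with hA
  have hAm : MeasurableSet A := (measurableSet_lt measurable_const measurable_id).inter
    (measurableSet_lt ENNReal.measurable_ofReal measurable_const)
  have e : (fun t => ((if (a : ℝ) < t ∧ ENNReal.ofReal t < c then 1 else 0 : ℕ) : ℝ≥0∞)) =
      A.indicator 1 := by
    ext t
    by_cases h : (a : ℝ) < t ∧ ENNReal.ofReal t < c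
    · rw [Set.indicator_of_mem (show t ∈ A from h), if_pos h]; simp
    · rw [Set.indicator_of_notMem (show t ∉ A from h), if_neg h]; simp
  have hA0 : A ∩ Set.Ioi 0 = A := Set.inter_eq_left.2 fun t ht => lt_of_le_of_lt a.2 ht.1
  rw [e, lintegral_indicator_one hAm, Measure.restrict_apply hAm, hA0]
  induction c with
  | top =>
    have : A = Set.Ioi (a : ℝ) := by ext t; simp [hA]
    rw [this, Real.volume_Ioi, ENNReal.top_sub_coe]
  | coe c =>
    have : A = Set.Ioo (a : ℝ) c := by
      ext t
      refine and_congr_right fun h => ?_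
      rw [← ENNReal.ofReal_coe_nnreal,
        ENNReal.ofReal_lt_ofReal_iff_of_nonneg (a.2.trans (le_of_lt h))]
    rw [this, Real.volume_Ioo, ENNReal.ofReal_sub _ a.coe_nonneg, ENNReal.ofReal_coe_nnreal,
      ENNReal.ofReal_coe_nnreal]

/-- The indicator that request `i` has arrived before time `t` and is unfinished at time `t`. -/
def unfinishedInd (R : RequestSeq) (S : 𝒰 × (Chunk → ℝ) → Schedule) (i : ℕ)
    (p : 𝒰 × (Chunk → ℝ)) (t : ℝ) : ℕ :=
  if (R.a i : ℝ) < t ∧ ENNReal.ofReal t < completion R p.2 (S p) i then 1 else 0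

lemma measurable_unfinishedInd (hS : OnlineSchedule R N L S) (i : ℕ) :
    Measurable fun y : (𝒰 × (Chunk → ℝ)) × ℝ => unfinishedInd R S i y.1 y.2 :=
  Measurable.ite ((measurableSet_lt measurable_const measurable_snd).inter
    (measurableSet_lt measurable_time ((measurable_completion hS i).comp measurable_fst)))
    measurable_const measurable_const

lemma meanUnfinished_eq_sum (hS : OnlineSchedule R N L S) (t : ℝ) :
    meanUnfinished R N S Q t = ∑ i ∈ Finset.range N, ∫⁻ p, unfinishedInd R S i p t ∂Q := by
  have hsum : ∀ p, posCount (load (arrivedCount R N t) (rem R p.2 (S p) (ENNReal.ofReal t))) =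
      ∑ i ∈ Finset.range N, unfinishedInd R S i p t := fun p => by
    simp only [unfinishedInd]
    rw [posCount_load, ← Finset.card_filter]
    congr 1
    ext i
    simp only [Finset.mem_filter, Finset.mem_range, rem_pos_iff]
    refine ⟨fun h => ?_, fun h => ⟨(lt_arrivedCount_iff h.1).2 h.2.1, h.2.2⟩⟩
    have hi := h.1.trans_le arrivedCount_le
    exact ⟨hi, (lt_arrivedCount_iff hi).1 h.1, h.2⟩
  simp only [meanUnfinished, hsum, Nat.cast_sum]
  exact lintegral_finsetSum _ fun i _ => measurable_section t (measurable_unfinishedInd hS i)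

lemma measurable_meanUnfinished [SFinite Q] (hS : OnlineSchedule R N L S) :
    Measurable fun t => meanUnfinished R N S Q t := by
  simp only [meanUnfinished_eq_sum hS]
  exact Finset.measurable_sum _ fun i _ =>
    measurable_natCast_lintegral (measurable_unfinishedInd hS i)

/-- The total flow time is the integral of the expected number of unfinished requests. -/
lemma sum_flowTime [IsProbabilityMeasure Q] (hS : OnlineSchedule R N L S) (hQ : Resample μ Q) :
    ∑ i ∈ Finset.range N, ((∫⁻ p, completion R p.2 (S p) i ∂Q) - R.a i) =
      ∫⁻ t in Set.Ioi 0, meanUnfinished R N S Q t := by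
  have hum := measurable_unfinishedInd hS
  simp only [meanUnfinished_eq_sum hS]
  rw [lintegral_finsetSum _ fun i _ => measurable_natCast_lintegral (hum i)]
  refine Finset.sum_congr rfl fun i hi => ?_
  rw [← lintegral_lintegral_swap (f := fun p t => (unfinishedInd R S i p t : ℝ≥0∞))
    ((Measurable.of_discrete (f := fun n : ℕ => (n : ℝ≥0∞))).comp (hum i)).aemeasurable]
  simp only [unfinishedInd, lintegral_Ioi_indicator]
  -- The truncated subtraction commutes with the expectation because completion never precedes
  -- arrival: at arrival k ≥ 1 chunks remain.
  rw [lintegral_sub measurable_const (by simp), lintegral_const, measure_univ, mul_one]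
  filter_upwards [hQ.ae_pos] with p hp
  refine (rem_pos_iff.1 ?_).le
  rw [rem_eq_of_le_arrival (hS.feasible p.1 p.2 hp) hp (t := R.a i) (i := i) fun _ => le_rfl]
  exact R.k_pos i

section FlowTimes

variable {Ω : Type*} [MeasurableSpace Ω] {P : Measure Ω} [IsProbabilityMeasure P]
  {X : Chunk → Ω → ℝ} {U : Ω → 𝒰}

lemma avgFlowTime_eq (hX : ∀ c, Measurable (X c)) (hU : Measurable U)
    (hQ : Resample μ (P.map fun ω => (U ω, fun c => X c ω))) (π : Policy L 𝒰) (R : RequestSeq)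
    (N : ℕ) : avgFlowTime P U X π R N =
      (∫⁻ t in Set.Ioi 0, meanUnfinished R N (fun p => π.start R N p.1 p.2)
        (P.map fun ω => (U ω, fun c => X c ω)) t) / N := by
  have hm : Measurable fun ω => (U ω, fun c => X c ω) := hU.prodMk (measurable_pi_lambda _ hX)
  have : IsProbabilityMeasure (P.map fun ω => (U ω, fun c => X c ω)) :=
    Measure.isProbabilityMeasure_map hm.aemeasurable
  have hS := π.onlineSchedule R N
  rw [avgFlowTime, ← sum_flowTime hS hQ]
  simp only [lintegral_map (measurable_completion hS _) hm]

/-- SEDPT-R is within `1 / μ` of any online policy. -/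
lemma avgFlowTime_le_add (hL : 1 ≤ L) (hμ : 0 < μ) (hX : ∀ c, Measurable (X c)) (hU : Measurable U)
    (hQ : Resample μ (P.map fun ω => (U ω, fun c => X c ω))) {π : Policy L 𝒰} (hπ : π.IsSEDPTR)
    (π' : Policy L 𝒰) (hN : 1 ≤ N) (hd : ∀ i < N, L ≤ R.d i) :
    avgFlowTime P U X π R N ≤ avgFlowTime P U X π' R N + ENNReal.ofReal (1 / μ) := by
  have hm : Measurable fun ω => (U ω, fun c => X c ω) := hU.prodMk (measurable_pi_lambda _ hX)
  have : IsProbabilityMeasure (P.map fun ω => (U ω, fun c => X c ω)) :=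
    Measure.isProbabilityMeasure_map hm.aemeasurable
  have hS := π.onlineSchedule R N
  have hA : IsSEDPT R N L fun p : 𝒰 × (Chunk → ℝ) => π.start R N p.1 p.2 := fun u x hx =>
    hπ R N u x hx
  have h1 := setLIntegral_mono_ae' (μ := volume) measurableSet_Ioi (Eventually.of_forall
    fun t (ht : t ∈ Set.Ioi (0 : ℝ)) => meanUnfinished_le hS hA hd hμ hQ (π'.onlineSchedule R N)
      (le_of_lt ht))
  rw [lintegral_add_left (measurable_meanUnfinished (π'.onlineSchedule R N))] at h1
  have h2 := h1.trans (add_le_add_right (lintegral_meanHidden_le hN hL hS hA hd hμ hQ) _)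
  have hN0 : (N : ℝ≥0∞) ≠ 0 := by exact_mod_cast (by omega : N ≠ 0)
  rw [avgFlowTime_eq hX hU hQ, avgFlowTime_eq hX hU hQ]
  refine (ENNReal.div_le_div_right h2 _).trans_eq ?_
  rw [ENNReal.add_div, mul_comm (N : ℝ≥0∞), ENNReal.mul_div_cancel_right hN0
    (ENNReal.natCast_ne_top N)]

lemma avgFlowTime_lt_top (hL : 1 ≤ L) (hμ : 0 < μ) (hX : ∀ c, Measurable (X c)) (hU : Measurable U)
    (hQ : Resample μ (P.map fun ω => (U ω, fun c => X c ω))) {π : Policy L 𝒰} (hπ : π.IsSEDPTR)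
    (hN : 1 ≤ N) (hd : ∀ i < N, L ≤ R.d i) : avgFlowTime P U X π R N < ∞ := by
  have hm : Measurable fun ω => (U ω, fun c => X c ω) := hU.prodMk (measurable_pi_lambda _ hX)
  have : IsProbabilityMeasure (P.map fun ω => (U ω, fun c => X c ω)) :=
    Measure.isProbabilityMeasure_map hm.aemeasurable
  rw [avgFlowTime_eq hX hU hQ]
  refine ENNReal.div_lt_top (lintegral_meanUnfinished_ne_top hN hL (π.onlineSchedule R N)
    (fun u x hx => hπ R N u x hx) hd hμ hQ) ?_
  exact_mod_cast (by omega : N ≠ 0)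

end FlowTimes

end

end Srpt

end

theorem theorem3 {Ω 𝒰 : Type*} [MeasurableSpace Ω] [MeasurableSpace 𝒰]
    (P : Measure Ω) [IsProbabilityMeasure P] (L : ℕ) (hL : 1 ≤ L) (μ : ℝ) (hμ : 0 < μ)
    (X : Chunk → Ω → ℝ) (hX : ∀ c, Measurable (X c)) (hXindep : iIndepFun X P)
    (hXexp : ∀ c, P.map (X c) = expMeasure μ)
    (U : Ω → 𝒰) (hU : Measurable U) (hUindep : IndepFun U (fun ω c => X c ω) P)
    (π : Policy L 𝒰) (hπ : π.IsSEDPTR) (R : RequestSeq) :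
    (∀ N : ℕ, 1 ≤ N → (∀ i < N, L ≤ R.d i) →
      avgFlowTime P U X π R N < ∞ ∧
      optFlowTime P U X L R N ≤ avgFlowTime P U X π R N ∧
      avgFlowTime P U X π R N ≤ optFlowTime P U X L R N + ENNReal.ofReal (1 / μ)) ∧
    ((∀ i, L ≤ R.d i) →
      optLimFlowTime P U X L R ≤ limAvgFlowTime P U X π R ∧
      limAvgFlowTime P U X π R ≤ optLimFlowTime P U X L R + ENNReal.ofReal (1 / μ)) := by
  have hQ := Srpt.resample_map P hμ hX hXindep hXexp hU hUindep
  refine ⟨fun N hN hd => ⟨Srpt.avgFlowTime_lt_top hL hμ hX hU hQ hπ hN hd, iInf_le _ π, ?_⟩,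
    fun hd => ⟨iInf_le _ π, ?_⟩⟩
  · rw [optFlowTime, ENNReal.iInf_add]
    exact le_iInf fun π' => Srpt.avgFlowTime_le_add hL hμ hX hU hQ hπ π' hN hd
  · rw [optLimFlowTime, ENNReal.iInf_add]
    refine le_iInf fun π' => ?_
    -- The finite bound holds for every N ≥ 1, and the constant 1 / μ comes out of the limsup.
    calc limAvgFlowTime P U X π R
        ≤ limsup (fun N => avgFlowTime P U X π' R N + ENNReal.ofReal (1 / μ)) atTop := by
          refine limsup_le_limsup ?_
          filter_upwards [eventually_ge_atTop 1] with N hN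
          exact Srpt.avgFlowTime_le_add hL hμ hX hU hQ hπ π' hN fun i _ => hd i
      _ = _ := limsup_add_const _ _ _ (by isBoundedDefault)
          (by isBoundedDefault)
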